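/- Let n be a natural number. A 2-face on the vertex set [n] is a 3-element subset of [n] and an edge is a 2-element subset. Let $\partial_2$ be the $\binom n2\times\binom n3$ inclusion matrix over $\mathbb F_2$ of edges versus 2-faces. The rank of a set of 2-faces is the $\mathbb F_2$-rank of the corresponding columns of $\partial_2$. A set $S$ of 2-faces is acyclic if $\mathrm{rank}(S)=|S|$. A hypertree is a maximal acyclic set. A (2-dimensional) hypercut over $\mathbb F_2$ is an inclusion-minimal set of 2-faces that meets every hypertree. An almost-hypertree is an acyclic set of size $\binom{n-1}2-1$. The shadow of $S$ is the set of 2-faces $\sigma\notin S$ with $\mathrm{rank}(S\cup\{\sigma\})=\mathrm{rank}(S)$. A coboundary is a set of 2-faces whose characteristic vector lies in the row space of $\partial_2$. For a set $D$ of 2-faces and a vertex $v$, $\mathrm{link}_v(D)$ is the graph on $[n]\setminus\{v\}$ in which $uw$ is an edge iff $\{v,u,w\}\in D$. The spider with legs of lengths $\ell_1,\dots,\ell_k$ is the tree obtained from disjoint paths with $\ell_1,\dots,\ell_k$ vertices by adding one new vertex (the centre) and joining it to one end vertex of each path. **Theorem.** There is an $N$ such that the following hold for all $n\ge N$. 1.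 If $n$ is even, the largest size of a 2-dimensional hypercut over $\mathbb F_2$ on $n$ vertices is exactly $\binom n3-\left(\frac34n^2-\frac72n+4\right)$. A set $C$ of 2-faces is a hypercut of largest size if and only if $C$ is a coboundary and there is a vertex $v$ such that $\mathrm{link}_v(\overline C)$, where $\overline C$ is the complement of $C$ in the set of all 2-faces, is isomorphic either to the spider with $(n-2)/2$ legs of length 2, or to the spider with one leg of length 1, one leg of length 3 and $(n-6)/2$ legs of length 2. 2. If $n$ is odd, the largest size of a 2-dimensional hypercut over $\mathbb F_2$ on $n$ vertices is exactly $\binom n3-\left(\frac34n^2-4n+\frac{25}4\right)$. A set $C$ of 2-faces is a hypercut of largest size if and only if $C$ is a coboundary and there is a vertex $v$ such that $\mathrm{link}_v(\overline C)$ is isomorphic to the spider with one leg of length 1 and $(n-3)/2$ legs of length 2. Moreover, for all sufficiently large $n$ there are almost-hypertrees over $\mathbb F_2$ on $n$ vertices, and the least size $s(n)$ of the shadow of such an almost-hypertree satisfies $s(n)-\frac{n^2}4=\Theta(n)$, that is, $c_1n\le\left|s(n)-\frac{n^2}4\right|\le c_2n$ for all large $n$, with constants $c_1,c_2>0$. 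-/

import Mathlib

open Filter Asymptotics
open scoped Matrix

noncomputable section

namespace SimplicialCut

/-- Edges (`1`-faces) of the full complex on the vertex set `Fin n`. -/
abbrev Edge (n : ℕ) : Type := {e : Finset (Fin n) // e.card = 2}

/-- `2`-faces of the full complex on the vertex set `Fin n`. -/
abbrev Face (n : ℕ) : Type := {σ : Finset (Fin n) // σ.card = 3}

/-- The boundary matrix `∂₂` over `𝔽₂`: rows are edges, columns are `2`-faces. -/
def boundary (n : ℕ) : Matrix (Edge n) (Face n) (ZMod 2) :=
  Matrix.of fun e σ => if e.1 ⊆ σ.1 then 1 else 0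

/-- The rank over `𝔽₂` of a set of `2`-faces: the rank of the corresponding columns of `∂₂`. -/
def faceRank {n : ℕ} (S : Finset (Face n)) : ℕ :=
  Module.finrank (ZMod 2)
    (Submodule.span (ZMod 2) ((fun σ : Face n => (boundary n).col σ) '' (S : Set (Face n))))

/-- `S` is acyclic over `𝔽₂`. -/
def Acyclic {n : ℕ} (S : Finset (Face n)) : Prop :=
  faceRank S = S.card

/-- A `2`-dimensional hypertree over `𝔽₂`: a maximal acyclic set of `2`-faces. -/
def IsHypertree {n : ℕ} (T : Finset (Face n)) : Prop :=
  Maximal Acyclic T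

/-- An almost-hypertree: an acyclic set of `(n-1 choose 2) - 1` faces. -/
def IsAlmostHypertree {n : ℕ} (S : Finset (Face n)) : Prop :=
  Acyclic S ∧ S.card + 1 = (n - 1).choose 2

/-- A `2`-dimensional hypercut over `𝔽₂`: an inclusion-minimal set of `2`-faces that meets
every hypertree. -/
def IsHypercut {n : ℕ} (C : Finset (Face n)) : Prop :=
  Minimal (fun D : Finset (Face n) => ∀ T, IsHypertree T → (D ∩ T).Nonempty) C

/-- A hypercut with the largest number of faces. -/
def IsLargestHypercut {n : ℕ} (C : Finset (Face n)) : Prop :=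
  IsHypercut C ∧ ∀ D : Finset (Face n), IsHypercut D → D.card ≤ C.card

/-- The shadow of `S`: the faces outside `S` whose addition does not increase the rank. -/
def shadow {n : ℕ} (S : Finset (Face n)) : Finset (Face n) :=
  open Classical in
  Finset.univ.filter fun σ => σ ∉ S ∧ faceRank (insert σ S) = faceRank S

/-- `C` is a coboundary: its characteristic vector is in the left image of `∂₂`. -/
def IsCoboundary {n : ℕ} (C : Finset (Face n)) : Prop :=
  ∃ y : Edge n → ZMod 2, ∀ σ : Face n, (y ᵥ* boundary n) σ = if σ ∈ C then 1 else 0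

/-- The link of the vertex `v` in the set of faces `C`, as a graph on the other vertices. -/
def linkGraph {n : ℕ} (C : Finset (Face n)) (v : Fin n) : SimpleGraph {u : Fin n // u ≠ v} where
  Adj u w := ∃ σ ∈ C, σ.1 = {v, u.1, w.1} ∧ u ≠ w
  symm := ⟨by
    rintro u w ⟨σ, hσ, h, hne⟩
    exact ⟨σ, hσ, by rw [h, Finset.pair_comm u.1 w.1], hne.symm⟩⟩
  loopless := ⟨by
    rintro u ⟨σ, _, _, hne⟩
    exact hne rfl⟩

/-- The spider tree with legs of lengths `L`: a centre `none`, from which for each `i` a path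
`⟨i, 0⟩, ⟨i, 1⟩, …` with `L[i]` vertices issues. -/
def spider (L : List ℕ) : SimpleGraph (Option (Σ i : Fin L.length, Fin (L.get i))) :=
  SimpleGraph.fromRel fun x y =>
    match x, y with
    | none, some q => q.2.val = 0
    | some p, some q => p.1 = q.1 ∧ q.2.val = p.2.val + 1
    | _, none => False

end SimplicialCut

end

/-!
The complements of coboundaries over `𝔽₂` are the sets `oddFaces G` of triples spanning an odd number
of edges of a graph `G` on `Fin n`; two graphs give the same set exactly when they differ by Seidel
switching, and the link at an isolated vertex of `G` is `G` without that vertex. Hypercuts are the cocircuits of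
the binary matroid of `∂₂`, that is, the minimal nonempty coboundaries (`isHypercut_iff`). So the
problem is to minimise the number of odd triples of `G` among the graphs giving hypercuts. With `d_u`
the degrees and `T` the number of ordered triangles,
`6 * #(oddFaces G) = 3 * ∑ u, d_u * (n - 2 * d_u) + 4 * T` (`six_mul_card_oddFaces_eq`).

*Lower bound.* A representative `G` with the fewest edges in its switching class has all degrees at
most `(n - 1) / 2` and `O(n)` edges (`exists_sparse_representative`). Minimality of the coboundary
enters only through `no_twin_sets`: two disjoint vertex sets without edges between them cannot look
the same from every other vertex, since the complete bipartite graph between them would give a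
smaller coboundary. Hence, for a nonempty set `B` of vertices, the components of `G - B` that `B` sees
uniformly are determined by their traces on `B`. Taking for `B` the vertices of linear degree, of
which there are boundedly many, the resulting bound on the number of components forces one vertex `x`
of degree close to `n / 2`, all other degrees being small (`exists_center`).

Next the sum over vertices is split along the components of `G - x`. After normalisation
(`excess`), a component of two vertices, one of them adjacent to `x`, contributes `0`; one with
`k ≥ 3` vertices contributes at least about `2 * (k - 2) * n`; an isolated vertex and a single leaf
at `x`, of which there is at most one each, contribute about `-2 * n`. Comparing with the claimed
minimum leaves only an isolated vertex together with a spider centred at `x` (`exists_legs`).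

*Attainment.* `sum_vdeg_spider` evaluates the formula for a spider. That a spider with at most one leg
of length one gives a minimal coboundary follows by sliding a nonadjacent pair along the legs to the
tip of a leg and the centre (`spider_pairs_constant`).

*Shadows.* The closure of an almost-hypertree is the complement of a hypercut and conversely, and
`∂₂` has rank `(n - 1).choose 2`, so the least shadow size is the least size of the complement of a
hypercut minus `(n - 1).choose 2 - 1`.
-/

namespace SimplicialCut

variable {n : ℕ}

/-! ### Hypercuts, almost-hypertrees and coboundaries -/

/-- The subspace of the edge space spanned by the columns of `∂₂` indexed by `S`. -/
noncomputable def faceSpan (S : Finset (Face n)) : Submodule (ZMod 2) (Edge n → ZMod 2) :=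
  Submodule.span (ZMod 2) ((fun σ : Face n => (boundary n).col σ) '' (S : Set (Face n)))

/-- The coboundary of an edge cochain `y`, as a set of faces. -/
noncomputable def cobd (y : Edge n → ZMod 2) : Finset (Face n) :=
  Finset.univ.filter fun σ => (y ᵥ* boundary n) σ ≠ 0

/-- An inclusion-minimal nonempty coboundary. -/
def IsMinimalCoboundary (C : Finset (Face n)) : Prop :=
  Minimal (fun D : Finset (Face n) => IsCoboundary D ∧ D.Nonempty) C

lemma mem_cobd {y : Edge n → ZMod 2} {σ : Face n} :
    σ ∈ cobd y ↔ (y ᵥ* boundary n) σ ≠ 0 := by simp [cobd]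

lemma zmod_two_eq_one_of_ne_zero {a : ZMod 2} (h : a ≠ 0) : a = 1 := by
  revert a; decide

lemma isCoboundary_iff {C : Finset (Face n)} : IsCoboundary C ↔ ∃ y, C = cobd y := by
  constructor
  · rintro ⟨y, hy⟩
    refine ⟨y, ?_⟩
    ext σ
    rw [mem_cobd, hy σ]
    split_ifs with h <;> simp [h]
  · rintro ⟨y, rfl⟩
    refine ⟨y, fun σ => ?_⟩
    split_ifs with h
    · exact zmod_two_eq_one_of_ne_zero (mem_cobd.1 h)
    · simpa [mem_cobd] using h

lemma faceRank_eq (S : Finset (Face n)) :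
    faceRank S = Module.finrank (ZMod 2) (faceSpan S) := rfl

lemma faceRank_congr {S T : Finset (Face n)} (h : faceSpan S = faceSpan T) :
    faceRank S = faceRank T := by
  rw [faceRank_eq, faceRank_eq, h]

lemma faceSpan_mono {S T : Finset (Face n)} (h : S ⊆ T) : faceSpan S ≤ faceSpan T :=
  Submodule.span_mono (Set.image_mono (by exact_mod_cast h))

lemma col_mem_faceSpan {S : Finset (Face n)} {σ : Face n} (h : σ ∈ S) :
    (boundary n).col σ ∈ faceSpan S :=
  Submodule.subset_span ⟨σ, by exact_mod_cast h, rfl⟩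

lemma faceSpan_le {S : Finset (Face n)} {W : Submodule (ZMod 2) (Edge n → ZMod 2)} :
    faceSpan S ≤ W ↔ ∀ σ ∈ S, (boundary n).col σ ∈ W := by
  rw [faceSpan, Submodule.span_le]
  constructor
  · intro h σ hσ
    exact h ⟨σ, by exact_mod_cast hσ, rfl⟩
  · rintro h _ ⟨σ, hσ, rfl⟩
    exact h σ (by exact_mod_cast hσ)

lemma acyclic_iff {S : Finset (Face n)} :
    Acyclic S ↔ LinearIndepOn (ZMod 2) (fun σ : Face n => (boundary n).col σ) (S : Set (Face n)) := by
  rw [LinearIndepOn, linearIndependent_iff_card_eq_finrank_span, Acyclic, faceRank, Set.finrank]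
  have : Set.range (fun x : (S : Set (Face n)) => (boundary n).col (x : Face n))
      = (fun σ : Face n => (boundary n).col σ) '' (S : Set (Face n)) := by
    rw [Set.image_eq_range]
  rw [this]
  simp [eq_comm]

/-- Inside any set of faces, an acyclic set extends to a basis of the span. -/
lemma exists_acyclic_extension {S A : Finset (Face n)} (hS : Acyclic S) (hSA : S ⊆ A) :
    ∃ T, S ⊆ T ∧ T ⊆ A ∧ Acyclic T ∧ faceSpan T = faceSpan A := by
  obtain ⟨b, hbA, hSb, hsp, hli⟩ := exists_linearIndepOn_extension (acyclic_iff.1 hS)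
    (show (S : Set (Face n)) ⊆ (A : Set (Face n)) by exact_mod_cast hSA)
  have hb : ((b.toFinite.toFinset : Finset (Face n)) : Set (Face n)) = b := by simp
  refine ⟨b.toFinite.toFinset, ?_, ?_, ?_, ?_⟩
  · intro σ hσ; simpa using hSb (by exact_mod_cast hσ)
  · intro σ hσ; exact_mod_cast hbA (by simpa using hσ)
  · rw [acyclic_iff, hb]; exact hli
  · apply le_antisymm
    · apply faceSpan_mono
      intro σ hσ; exact_mod_cast hbA (by simpa using hσ)
    · rw [faceSpan_le]
      intro σ hσ
      have := hsp ⟨σ, by exact_mod_cast hσ, rfl⟩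
      rw [faceSpan, hb]
      exact this

lemma acyclic_empty : Acyclic (∅ : Finset (Face n)) := by
  rw [acyclic_iff]; simp

lemma isHypertree_iff {T : Finset (Face n)} :
    IsHypertree T ↔ Acyclic T ∧ faceSpan T = faceSpan Finset.univ := by
  constructor
  · intro h
    refine ⟨h.prop, ?_⟩
    obtain ⟨T', h1, -, h3, h4⟩ := exists_acyclic_extension h.prop (Finset.subset_univ T)
    rw [← h4, h.eq_of_le h3 h1]
  · rintro ⟨hac, hsp⟩
    refine ⟨hac, fun T' hT' hle => ?_⟩
    have h1 : T'.card = T.card := by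
      rw [← hT', ← hac]
      refine faceRank_congr (le_antisymm ?_ (faceSpan_mono hle))
      rw [hsp]; exact faceSpan_mono (Finset.subset_univ _)
    exact (Finset.eq_of_subset_of_card_le hle h1.le).ge

lemma vecMul_boundary_apply (y : Edge n → ZMod 2) (σ : Face n) :
    (y ᵥ* boundary n) σ = y ⬝ᵥ (boundary n).col σ := rfl

/-- Separation by an edge cochain: a vector outside a subspace is detected by a `y` vanishing on
the subspace. -/
lemma exists_cochain_separating {W : Submodule (ZMod 2) (Edge n → ZMod 2)} {x : Edge n → ZMod 2}
    (hx : x ∉ W) : ∃ y : Edge n → ZMod 2, y ⬝ᵥ x ≠ 0 ∧ ∀ w ∈ W, y ⬝ᵥ w = 0 := by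
  obtain ⟨f, hfx, hW⟩ := Submodule.exists_le_ker_of_notMem hx
  have key : ∀ z, (fun e => f (Pi.single e 1)) ⬝ᵥ z = f z := by
    intro z
    rw [LinearMap.pi_apply_eq_sum_univ f z]
    simp only [dotProduct, smul_eq_mul]
    refine Finset.sum_congr rfl fun e _ => ?_
    rw [mul_comm]
    congr 2
    ext j; simp [Pi.single_apply, eq_comm]
  refine ⟨fun e => f (Pi.single e 1), by rwa [key], fun w hw => ?_⟩
  rw [key]; exact hW hw

/-- A cochain whose coboundary avoids `S` vanishes on the span of `S`. -/
lemma dotProduct_eq_zero_of_mem_faceSpan {S : Finset (Face n)} {y : Edge n → ZMod 2}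
    (h : ∀ σ ∈ S, (y ᵥ* boundary n) σ = 0) {x : Edge n → ZMod 2} (hx : x ∈ faceSpan S) :
    y ⬝ᵥ x = 0 := by
  induction hx using Submodule.span_induction with
  | mem x hx =>
    obtain ⟨σ, hσ, rfl⟩ := hx
    exact h σ (by exact_mod_cast hσ)
  | zero => simp
  | add a b _ _ ha hb => rw [dotProduct_add, ha, hb, add_zero]
  | smul c a _ ha => rw [dotProduct_smul, ha, smul_zero]

lemma meets_of_cobd {y : Edge n → ZMod 2} (hy : (cobd y).Nonempty) {T : Finset (Face n)}
    (hT : IsHypertree T) : (cobd y ∩ T).Nonempty := by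
  by_contra hne
  rw [Finset.not_nonempty_iff_eq_empty] at hne
  obtain ⟨σ, hσ⟩ := hy
  have h0 : ∀ τ ∈ T, (y ᵥ* boundary n) τ = 0 := by
    intro τ hτ
    by_contra h
    have : τ ∈ cobd y ∩ T := Finset.mem_inter.2 ⟨mem_cobd.2 h, hτ⟩
    simp [hne] at this
  refine mem_cobd.1 hσ (dotProduct_eq_zero_of_mem_faceSpan h0 ?_)
  rw [(isHypertree_iff.1 hT).2]
  exact col_mem_faceSpan (Finset.mem_univ σ)

/-- If the complement of `D` spanned everything it would contain a hypertree; a cochain separating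
that span from some column is therefore supported in `D`. -/
lemma exists_cobd_subset_of_meets {D : Finset (Face n)}
    (hD : ∀ T, IsHypertree T → (D ∩ T).Nonempty) : ∃ y, (cobd y).Nonempty ∧ cobd y ⊆ D := by
  have hlt : ∃ σ : Face n, (boundary n).col σ ∉ faceSpan Dᶜ := by
    by_contra! hall
    obtain ⟨T, -, hT, hac, hsp⟩ :=
      exists_acyclic_extension (acyclic_empty (n := n)) (Finset.empty_subset Dᶜ)
    have : IsHypertree T := by
      rw [isHypertree_iff]
      refine ⟨hac, hsp.trans (le_antisymm (faceSpan_mono (Finset.subset_univ _)) ?_)⟩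
      exact faceSpan_le.2 fun σ _ => hall σ
    obtain ⟨σ, hσ⟩ := hD T this
    rw [Finset.mem_inter] at hσ
    exact (Finset.mem_compl.1 (hT hσ.2)) hσ.1
  obtain ⟨σ, hσ⟩ := hlt
  obtain ⟨y, hy, hyW⟩ := exists_cochain_separating hσ
  refine ⟨y, ⟨σ, mem_cobd.2 hy⟩, fun τ hτ => ?_⟩
  by_contra h
  exact mem_cobd.1 hτ (hyW _ (col_mem_faceSpan (Finset.mem_compl.2 h)))

/-- Hypercuts are the cocircuits of the binary matroid represented by `∂₂`. -/
lemma isHypercut_iff {C : Finset (Face n)} : IsHypercut C ↔ IsMinimalCoboundary C := by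
  constructor
  · intro h
    obtain ⟨y, hy, hyC⟩ := exists_cobd_subset_of_meets h.prop
    have : cobd y = C := (h.eq_of_ge (fun T hT => meets_of_cobd hy hT) hyC).symm
    refine ⟨⟨isCoboundary_iff.2 ⟨y, this.symm⟩, this ▸ hy⟩, ?_⟩
    rintro D ⟨hD, hDne⟩ hle
    obtain ⟨z, rfl⟩ := isCoboundary_iff.1 hD
    exact h.le_of_le (fun T hT => meets_of_cobd hDne hT) hle
  · intro h
    obtain ⟨y, rfl⟩ := isCoboundary_iff.1 h.prop.1
    refine ⟨fun T hT => meets_of_cobd h.prop.2 hT, fun D hD hle => ?_⟩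
    obtain ⟨z, hz, hzD⟩ := exists_cobd_subset_of_meets hD
    have := h.le_of_le ⟨isCoboundary_iff.2 ⟨z, rfl⟩, hz⟩ (hzD.trans hle)
    exact this.trans hzD

/-- The value of a cochain on a pair of vertices, `0` on the diagonal. -/
noncomputable def pairVal (y : Edge n → ZMod 2) (u w : Fin n) : ZMod 2 :=
  if h : u ≠ w then y ⟨{u, w}, Finset.card_pair h⟩ else 0

lemma pairVal_comm (y : Edge n → ZMod 2) (u w : Fin n) : pairVal y u w = pairVal y w u := by
  unfold pairVal
  by_cases h : u = w
  · subst h; rfl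
  · simp only [ne_eq, h, not_false_eq_true, dite_true, Ne.symm h, Finset.pair_comm u w]

/-- The face on three distinct vertices. -/
def face (a b c : Fin n) (hab : a ≠ b) (hac : a ≠ c) (hbc : b ≠ c) : Face n :=
  ⟨{a, b, c}, Finset.card_eq_three.2 ⟨a, b, c, hab, hac, hbc, rfl⟩⟩

lemma Face.exists_eq (σ : Face n) :
    ∃ a b c, ∃ hab : a ≠ b, ∃ hac : a ≠ c, ∃ hbc : b ≠ c, σ = face a b c hab hac hbc := by
  obtain ⟨a, b, c, hab, hac, hbc, h⟩ := Finset.card_eq_three.1 σ.2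
  exact ⟨a, b, c, hab, hac, hbc, Subtype.ext h⟩

lemma vecMul_boundary_face (y : Edge n → ZMod 2) {a b c : Fin n} (hab : a ≠ b) (hac : a ≠ c)
    (hbc : b ≠ c) : (y ᵥ* boundary n) (face a b c hab hac hbc)
      = pairVal y a b + pairVal y b c + pairVal y a c := by
  have h : (y ᵥ* boundary n) (face a b c hab hac hbc)
      = ∑ e ∈ Finset.univ.filter (fun e : Edge n => e.1 ⊆ {a, b, c}), y e := by
    rw [Finset.sum_filter]
    simp [Matrix.vecMul, dotProduct, boundary, face]
  have hset : Finset.univ.filter (fun e : Edge n => e.1 ⊆ {a, b, c})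
      = {⟨{a, b}, Finset.card_pair hab⟩, ⟨{b, c}, Finset.card_pair hbc⟩,
          ⟨{a, c}, Finset.card_pair hac⟩} := by
    ext ⟨e, he⟩
    simp only [Finset.mem_filter, Finset.mem_univ, true_and, Finset.mem_insert,
      Finset.mem_singleton, Subtype.mk.injEq]
    constructor
    · intro hsub
      obtain ⟨u, w, huw, rfl⟩ := Finset.card_eq_two.1 he
      have hu : u ∈ ({a, b, c} : Finset (Fin n)) := hsub (by simp)
      have hw : w ∈ ({a, b, c} : Finset (Fin n)) := hsub (by simp)
      simp only [Finset.mem_insert, Finset.mem_singleton] at hu hw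
      rcases hu with rfl | rfl | rfl <;> rcases hw with rfl | rfl | rfl <;>
        first | exact absurd rfl huw | simp [Finset.pair_comm]
    · rintro (rfl | rfl | rfl) <;> intro z <;> simp <;> tauto
  rw [h, hset, Finset.sum_insert, Finset.sum_insert, Finset.sum_singleton]
  · simp [pairVal, hab, hac, hbc, add_assoc]
  · simp only [Finset.mem_singleton, Subtype.mk.injEq]
    intro h
    have : b ∈ ({a, c} : Finset (Fin n)) := h ▸ (by simp)
    simp at this; tauto
  · simp only [Finset.mem_insert, Finset.mem_singleton, Subtype.mk.injEq, not_or]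
    constructor <;> intro h
    · have : a ∈ ({b, c} : Finset (Fin n)) := h ▸ (by simp)
      simp at this; tauto
    · have : b ∈ ({a, c} : Finset (Fin n)) := h ▸ (by simp)
      simp at this; tauto

/-- The faces containing a given vertex. -/
def starFaces (v : Fin n) : Finset (Face n) := Finset.univ.filter fun σ => v ∈ σ.1

lemma card_starFaces (v : Fin n) : (starFaces v).card = (n - 1).choose 2 := by
  have : (Finset.univ.erase v).card = n - 1 := by simp
  rw [← this, ← Finset.card_powersetCard]
  refine Finset.card_bij (fun σ _ => σ.1.erase v) ?_ ?_ ?_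
  · intro σ hσ
    simp only [starFaces, Finset.mem_filter, Finset.mem_univ, true_and] at hσ
    rw [Finset.mem_powersetCard]
    refine ⟨Finset.erase_subset_erase _ (Finset.subset_univ _), ?_⟩
    rw [Finset.card_erase_of_mem hσ, σ.2]
  · intro σ hσ τ hτ h
    simp only [starFaces, Finset.mem_filter, Finset.mem_univ, true_and] at hσ hτ
    apply Subtype.ext
    rw [← Finset.insert_erase hσ, ← Finset.insert_erase hτ, h]
  · intro e he
    rw [Finset.mem_powersetCard] at he
    have hv : v ∉ e := fun h => by simpa using he.1 h
    refine ⟨⟨insert v e, by rw [Finset.card_insert_of_notMem hv, he.2]⟩, ?_, ?_⟩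
    · simp [starFaces]
    · simp [hv]

/-- Each face `σ` containing `v` is the only one with the edge `σ \ {v}`. -/
lemma acyclic_starFaces (v : Fin n) : Acyclic (starFaces v) := by
  rw [acyclic_iff, linearIndepOn_finset_iff]
  intro g hg σ hσ
  have hσv : v ∈ σ.1 := by simpa [starFaces] using hσ
  have hcard : (σ.1.erase v).card = 2 := by rw [Finset.card_erase_of_mem hσv, σ.2]
  have := congrFun hg ⟨σ.1.erase v, hcard⟩
  rw [Finset.sum_apply, Finset.sum_eq_single σ] at this
  · simpa [boundary, Finset.erase_subset] using this
  · intro τ hτ hne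
    have hτv : v ∈ τ.1 := by simpa [starFaces] using hτ
    have : ¬ σ.1.erase v ⊆ τ.1 := by
      intro hsub
      have h2 : σ.1 ⊆ τ.1 := by
        rw [← Finset.insert_erase hσv]
        exact Finset.insert_subset hτv hsub
      exact hne (Subtype.ext (Finset.eq_of_subset_of_card_le h2 (by rw [σ.2, τ.2])).symm)
    simp [boundary, this]
  · exact fun h => absurd hσ h

lemma mem_starFaces_face {v a b : Fin n} (h1 h2 h3) : face v a b h1 h2 h3 ∈ starFaces v := by
  simp [starFaces, face]

/-- The star of a vertex spans the boundaries: a cochain vanishing on the star has zero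
coboundary, because `∂₁ ∂₂ = 0`. -/
lemma faceSpan_starFaces (v : Fin n) : faceSpan (starFaces v) = faceSpan Finset.univ := by
  apply le_antisymm (faceSpan_mono (Finset.subset_univ _))
  rw [faceSpan_le]
  intro σ _
  by_contra hσ
  obtain ⟨y, hy, hyW⟩ := exists_cochain_separating hσ
  have hstar : ∀ a b, a ≠ b → v ≠ a → v ≠ b →
      pairVal y a b = pairVal y v a + pairVal y v b := by
    intro a b hab ha hb
    have := hyW _ (col_mem_faceSpan (mem_starFaces_face ha hb hab))
    rw [← vecMul_boundary_apply, vecMul_boundary_face] at this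
    generalize pairVal y a b = p at *
    generalize pairVal y v a = q at *
    generalize pairVal y v b = r at *
    revert p q r; decide
  by_cases hv : σ ∈ starFaces v
  · exact hσ (col_mem_faceSpan hv)
  obtain ⟨a, b, c, hab, hac, hbc, rfl⟩ := σ.exists_eq
  rw [← vecMul_boundary_apply, vecMul_boundary_face] at hy
  simp only [starFaces, face, Finset.mem_filter, Finset.mem_univ, true_and, Finset.mem_insert,
    Finset.mem_singleton, not_or] at hv
  rw [hstar a b hab hv.1 hv.2.1, hstar b c hbc hv.2.1 hv.2.2, hstar a c hac hv.1 hv.2.2] at hy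
  apply hy
  generalize pairVal y v a = p
  generalize pairVal y v b = q
  generalize pairVal y v c = r
  revert p q r; decide

lemma finrank_faceSpan_univ (hn : 0 < n) :
    Module.finrank (ZMod 2) (faceSpan (Finset.univ : Finset (Face n))) = (n - 1).choose 2 := by
  rw [← faceSpan_starFaces ⟨0, hn⟩, ← faceRank_eq, acyclic_starFaces, card_starFaces]

/-- A hypercut is the complement of a flat of corank one. -/
lemma finrank_faceSpan_compl {C : Finset (Face n)} (hn : 0 < n) (hC : IsMinimalCoboundary C) :
    faceRank Cᶜ + 1 = (n - 1).choose 2 := by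
  obtain ⟨y, rfl⟩ := isCoboundary_iff.1 hC.prop.1
  obtain ⟨σ, hσ⟩ := hC.prop.2
  have hz : ∀ τ ∈ (cobd y)ᶜ, (y ᵥ* boundary n) τ = 0 := by
    intro τ hτ; simpa [mem_cobd] using hτ
  have hnot : (boundary n).col σ ∉ faceSpan (cobd y)ᶜ := fun h =>
    mem_cobd.1 hσ (dotProduct_eq_zero_of_mem_faceSpan hz h)
  have hspan : faceSpan (cobd y)ᶜ ⊔ Submodule.span (ZMod 2) {(boundary n).col σ}
      = faceSpan Finset.univ := by
    apply le_antisymm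
    · refine sup_le (faceSpan_mono (Finset.subset_univ _)) ?_
      rw [Submodule.span_singleton_le_iff_mem]
      exact col_mem_faceSpan (Finset.mem_univ _)
    · rw [faceSpan_le]
      intro τ _
      by_contra hτ
      obtain ⟨z, hzτ, hzW⟩ := exists_cochain_separating hτ
      have hsub : cobd z ⊆ cobd y := by
        intro ρ hρ
        by_contra h
        exact mem_cobd.1 hρ (hzW _ (Submodule.mem_sup_left
          (col_mem_faceSpan (Finset.mem_compl.2 h))))
      have heq := hC.le_of_le ⟨isCoboundary_iff.2 ⟨z, rfl⟩, τ, mem_cobd.2 hzτ⟩ hsub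
      exact mem_cobd.1 (heq hσ) (hzW _ (Submodule.mem_sup_right (Submodule.mem_span_singleton_self _)))
  rw [← finrank_faceSpan_univ hn, ← hspan, faceRank_eq]
  have h0 : (boundary n).col σ ≠ 0 := fun h => hnot (h ▸ Submodule.zero_mem _)
  have hdisj : faceSpan (cobd y)ᶜ ⊓ Submodule.span (ZMod 2) {(boundary n).col σ} = ⊥ := by
    rw [← disjoint_iff]
    exact (Submodule.disjoint_span_singleton' h0).2 hnot
  have := Submodule.finrank_sup_add_finrank_inf_eq (faceSpan (cobd y)ᶜ)
    (Submodule.span (ZMod 2) {(boundary n).col σ})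
  rw [hdisj, finrank_bot, finrank_span_singleton h0] at this
  omega

lemma mem_faceSpan_iff_faceRank_insert {S : Finset (Face n)} {σ : Face n} :
    faceRank (insert σ S) = faceRank S ↔ (boundary n).col σ ∈ faceSpan S := by
  constructor
  · intro h
    rw [faceRank_eq, faceRank_eq] at h
    rw [Submodule.eq_of_le_of_finrank_eq (faceSpan_mono (Finset.subset_insert σ S)) h.symm]
    exact col_mem_faceSpan (Finset.mem_insert_self _ _)
  · intro h
    refine faceRank_congr (le_antisymm ?_ (faceSpan_mono (Finset.subset_insert σ S)))
    rw [faceSpan_le]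
    intro τ hτ
    rcases Finset.mem_insert.1 hτ with rfl | hτ
    · exact h
    · exact col_mem_faceSpan hτ

lemma mem_union_shadow {S : Finset (Face n)} {σ : Face n} :
    σ ∈ S ∪ shadow S ↔ (boundary n).col σ ∈ faceSpan S := by
  simp only [shadow, Finset.mem_union, Finset.mem_filter, Finset.mem_univ, true_and,
    mem_faceSpan_iff_faceRank_insert]
  constructor
  · rintro (h | h)
    · exact col_mem_faceSpan h
    · exact h.2
  · intro h
    by_cases hS : σ ∈ S
    · exact Or.inl hS
    · exact Or.inr ⟨hS, h⟩

lemma card_add_card_shadow {S C : Finset (Face n)} (h : Cᶜ = S ∪ shadow S) :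
    S.card + (shadow S).card = Cᶜ.card := by
  rw [h, Finset.card_union_of_disjoint]
  rw [Finset.disjoint_left]
  intro σ hσ
  simp [shadow, hσ]

/-- The closure of an almost-hypertree is the complement of a hypercut. -/
lemma IsAlmostHypertree.exists_hypercut {S : Finset (Face n)} (hn : 0 < n)
    (hS : IsAlmostHypertree S) : ∃ C : Finset (Face n), IsHypercut C ∧ S.card + (shadow S).card = Cᶜ.card := by
  have hr : faceRank S + 1 = Module.finrank (ZMod 2) (faceSpan (Finset.univ : Finset (Face n))) := by
    rw [finrank_faceSpan_univ hn, hS.1, hS.2]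
  have hex : ∃ σ : Face n, (boundary n).col σ ∉ faceSpan S := by
    by_contra! hall
    have : faceSpan S = faceSpan Finset.univ :=
      le_antisymm (faceSpan_mono (Finset.subset_univ _)) (faceSpan_le.2 fun σ _ => hall σ)
    rw [← this, faceRank_eq] at hr
    omega
  obtain ⟨σ, hσ⟩ := hex
  obtain ⟨y, hy, hyW⟩ := exists_cochain_separating hσ
  have hspan : faceSpan (insert σ S) = faceSpan Finset.univ := by
    apply Submodule.eq_of_le_of_finrank_le (faceSpan_mono (Finset.subset_univ _))
    rw [← hr]
    have h1 : faceRank S ≤ faceRank (insert σ S) :=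
      Submodule.finrank_mono (faceSpan_mono (Finset.subset_insert σ S))
    have h2 := mem_faceSpan_iff_faceRank_insert.not.2 hσ
    rw [← faceRank_eq]
    omega
  -- cochains vanishing on `S` but not at `σ` have the same coboundary, as `S` spans a hyperplane
  have hcompl : ∀ z : Edge n → ZMod 2, (∀ τ ∈ S, (z ᵥ* boundary n) τ = 0) → 
      (z ᵥ* boundary n) σ ≠ 0 → ∀ τ, τ ∈ cobd z ↔ (boundary n).col τ ∉ faceSpan S := by
    intro z hz hzσ τ
    rw [mem_cobd]
    constructor
    · intro h hmem
      exact h (dotProduct_eq_zero_of_mem_faceSpan hz hmem)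
    · intro h hzero
      have hmem : (boundary n).col τ ∈ faceSpan (insert σ S) := by
        rw [hspan]; exact col_mem_faceSpan (Finset.mem_univ _)
      rw [faceSpan, Finset.coe_insert, Set.image_insert_eq, Submodule.mem_span_insert] at hmem
      obtain ⟨a, w, hw, haw⟩ := hmem
      have hdot : z ⬝ᵥ (boundary n).col τ = a • (z ⬝ᵥ (boundary n).col σ) + z ⬝ᵥ w := by
        rw [haw, dotProduct_add, dotProduct_smul]
      rw [dotProduct_eq_zero_of_mem_faceSpan hz hw, ← vecMul_boundary_apply, hzero, add_zero,
        ← vecMul_boundary_apply, smul_eq_mul] at hdot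
      rcases mul_eq_zero.1 hdot.symm with ha | ha
      · apply h
        rw [haw, ha, zero_smul, zero_add]
        exact hw
      · exact hzσ ha
  have hyS : ∀ τ ∈ S, (y ᵥ* boundary n) τ = 0 := fun τ hτ => hyW _ (col_mem_faceSpan hτ)
  refine ⟨cobd y, ?_, card_add_card_shadow ?_⟩
  · rw [isHypercut_iff]
    refine ⟨⟨isCoboundary_iff.2 ⟨y, rfl⟩, σ, mem_cobd.2 hy⟩, ?_⟩
    rintro D ⟨hD, ρ, hρ⟩ hle
    obtain ⟨z, rfl⟩ := isCoboundary_iff.1 hD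
    have hzS : ∀ τ ∈ S, (z ᵥ* boundary n) τ = 0 := by
      intro τ hτ
      by_contra h
      exact mem_cobd.1 (hle (mem_cobd.2 h)) (hyS τ hτ)
    have hzσ : (z ᵥ* boundary n) σ ≠ 0 := by
      intro h
      refine mem_cobd.1 hρ (dotProduct_eq_zero_of_mem_faceSpan (S := insert σ S) ?_ ?_)
      · intro τ hτ
        rcases Finset.mem_insert.1 hτ with rfl | hτ
        · exact h
        · exact hzS τ hτ
      · rw [hspan]; exact col_mem_faceSpan (Finset.mem_univ _)
    intro τ hτ
    rw [hcompl z hzS hzσ, ← hcompl y hyS hy]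
    exact hτ
  · ext τ
    rw [Finset.mem_compl, hcompl y hyS hy, mem_union_shadow, not_not]

/-- Every hypercut is the complement of the closure of an almost-hypertree. -/
lemma IsHypercut.exists_almostHypertree {C : Finset (Face n)} (hn : 0 < n) (hC : IsHypercut C) :
    ∃ S : Finset (Face n), IsAlmostHypertree S ∧ S.card + (shadow S).card = Cᶜ.card := by
  have hC' := isHypercut_iff.1 hC
  obtain ⟨S, -, hS, hac, hsp⟩ :=
    exists_acyclic_extension (acyclic_empty (n := n)) (Finset.empty_subset Cᶜ)
  refine ⟨S, ⟨hac, ?_⟩, card_add_card_shadow ?_⟩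
  · rw [← hac, faceRank_eq, hsp, ← faceRank_eq, finrank_faceSpan_compl hn hC']
  · ext τ
    rw [mem_union_shadow, hsp]
    refine ⟨col_mem_faceSpan, fun h => ?_⟩
    obtain ⟨y, rfl⟩ := isCoboundary_iff.1 hC'.prop.1
    have := dotProduct_eq_zero_of_mem_faceSpan (S := (cobd y)ᶜ) (y := y)
      (fun ρ hρ => by simpa [mem_cobd] using hρ) h
    rw [Finset.mem_compl, mem_cobd, not_not]
    exact this

/-! ### Odd faces of graphs, switching and twin sets -/

open Classical in
/-- Adjacency in a graph as an element of `𝔽₂`. -/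
noncomputable def adjBit {V : Type*} (G : SimpleGraph V) (u w : V) : ZMod 2 :=
  if G.Adj u w then 1 else 0

open Classical in
/-- Adjacency in a graph as an integer `0` or `1`. -/
noncomputable def adjInt {V : Type*} (G : SimpleGraph V) (u w : V) : ℤ :=
  if G.Adj u w then 1 else 0

/-- The degree of a vertex, as an integer. -/
noncomputable def vdeg {V : Type*} [Fintype V] (G : SimpleGraph V) (u : V) : ℤ :=
  ∑ w, adjInt G u w

lemma adjBit_congr {V W : Type*} {G : SimpleGraph V} {G' : SimpleGraph W} {u w : V} {u' w' : W}
    (h : G.Adj u w ↔ G'.Adj u' w') : adjBit G u w = adjBit G' u' w' := by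
  unfold adjBit; split_ifs <;> tauto

lemma adjInt_congr {V W : Type*} {G : SimpleGraph V} {G' : SimpleGraph W} {u w : V} {u' w' : W}
    (h : G.Adj u w ↔ G'.Adj u' w') : adjInt G u w = adjInt G' u' w' := by
  unfold adjInt; split_ifs <;> tauto

lemma adjBit_comm {V : Type*} (G : SimpleGraph V) (u w : V) : adjBit G u w = adjBit G w u :=
  adjBit_congr (G.adj_comm u w)

lemma adjInt_comm {V : Type*} (G : SimpleGraph V) (u w : V) : adjInt G u w = adjInt G w u :=
  adjInt_congr (G.adj_comm u w)

lemma adjInt_self {V : Type*} (G : SimpleGraph V) (u : V) : adjInt G u u = 0 := by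
  simp [adjInt]

lemma adjBit_self {V : Type*} (G : SimpleGraph V) (u : V) : adjBit G u u = 0 := by
  simp [adjBit]

lemma adjInt_of_adj {V : Type*} {G : SimpleGraph V} {u w : V} (h : G.Adj u w) :
    adjInt G u w = 1 := by simp [adjInt, h]

lemma adjInt_of_not_adj {V : Type*} {G : SimpleGraph V} {u w : V} (h : ¬ G.Adj u w) :
    adjInt G u w = 0 := by simp [adjInt, h]

lemma adjInt_eq_ite_of_iff {V : Type*} {G : SimpleGraph V} {u w : V} {p : Prop} [Decidable p]
    (h : G.Adj u w ↔ p) : adjInt G u w = if p then 1 else 0 := by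
  unfold adjInt; split_ifs <;> tauto

lemma adjInt_nonneg {V : Type*} (G : SimpleGraph V) (u w : V) : 0 ≤ adjInt G u w := by
  unfold adjInt; split_ifs <;> simp

lemma adjInt_le_one {V : Type*} (G : SimpleGraph V) (u w : V) : adjInt G u w ≤ 1 := by
  unfold adjInt; split_ifs <;> simp

lemma vdeg_nonneg {V : Type*} [Fintype V] (G : SimpleGraph V) (u : V) : 0 ≤ vdeg G u :=
  Finset.sum_nonneg fun _ _ => adjInt_nonneg _ _ _

open Classical in
/-- The edge cochain given by the indicator of the edges of a graph. -/
noncomputable def edgeCochain (G : SimpleGraph (Fin n)) (e : Edge n) : ZMod 2 :=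
  if ∃ u w, e.1 = {u, w} ∧ G.Adj u w then 1 else 0

/-- The faces spanning an odd number of edges of a graph. -/
noncomputable def oddFaces (G : SimpleGraph (Fin n)) : Finset (Face n) := cobd (edgeCochain G)

lemma exists_pair_adj_iff (G : SimpleGraph (Fin n)) {u w : Fin n} :
    (∃ u' w', ({u, w} : Finset (Fin n)) = {u', w'} ∧ G.Adj u' w') ↔ G.Adj u w := by
  constructor
  · rintro ⟨a, b, h, hadj⟩
    have ha : a ∈ ({u, w} : Finset (Fin n)) := h ▸ (by simp)
    have hb : b ∈ ({u, w} : Finset (Fin n)) := h ▸ (by simp)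
    simp only [Finset.mem_insert, Finset.mem_singleton] at ha hb
    rcases ha with rfl | rfl <;> rcases hb with rfl | rfl
    · exact absurd hadj (G.loopless.irrefl _)
    · exact hadj
    · exact hadj.symm
    · exact absurd hadj (G.loopless.irrefl _)
  · intro h
    exact ⟨u, w, rfl, h⟩

lemma pairVal_edgeCochain (G : SimpleGraph (Fin n)) (u w : Fin n) :
    pairVal (edgeCochain G) u w = adjBit G u w := by
  unfold pairVal
  split_ifs with h
  · unfold edgeCochain adjBit
    by_cases hadj : G.Adj u w
    · rw [if_pos hadj]; exact if_pos ((exists_pair_adj_iff G).2 hadj)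
    · rw [if_neg hadj]; exact if_neg fun h' => hadj ((exists_pair_adj_iff G).1 h')
  · rw [not_not] at h
    rw [h, adjBit_self]

lemma face_mem_oddFaces (G : SimpleGraph (Fin n)) {a b c : Fin n} (hab hac hbc) :
    face a b c hab hac hbc ∈ oddFaces G ↔ adjBit G a b + adjBit G b c + adjBit G a c ≠ 0 := by
  rw [oddFaces, mem_cobd, vecMul_boundary_face]
  simp only [pairVal_edgeCochain]

lemma isCoboundary_oddFaces (G : SimpleGraph (Fin n)) : IsCoboundary (oddFaces G) :=
  isCoboundary_iff.2 ⟨_, rfl⟩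

/-- Since a face has three edges, complementing the graph complements its coboundary; thus the
complements of coboundaries are the sets `oddFaces G`. -/
lemma isCoboundary_iff_compl {C : Finset (Face n)} :
    IsCoboundary C ↔ ∃ G : SimpleGraph (Fin n), Cᶜ = oddFaces G := by
  rw [isCoboundary_iff]
  have key : ∀ (y : Edge n → ZMod 2) (G : SimpleGraph (Fin n)),
      (∀ u w, u ≠ w → pairVal y u w = 1 + adjBit G u w) → (cobd y)ᶜ = oddFaces G := by
    intro y G h
    ext σ
    obtain ⟨a, b, c, hab, hac, hbc, rfl⟩ := Face.exists_eq σ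
    rw [face_mem_oddFaces, Finset.mem_compl, mem_cobd, vecMul_boundary_face, h a b hab, h b c hbc,
      h a c hac]
    generalize adjBit G a b = p
    generalize adjBit G b c = q
    generalize adjBit G a c = r
    revert p q r; decide
  constructor
  · rintro ⟨y, rfl⟩
    let G : SimpleGraph (Fin n) :=
      { Adj := fun u w => u ≠ w ∧ pairVal y u w = 0
        symm := ⟨fun u w h => ⟨h.1.symm, by rw [pairVal_comm]; exact h.2⟩⟩
        loopless := ⟨fun u h => h.1 rfl⟩ }
    refine ⟨G, key y G fun u w huw => ?_⟩
    have : adjBit G u w = if pairVal y u w = 0 then 1 else 0 := by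
      simp [adjBit, G, huw]
    rw [this]
    generalize pairVal y u w = p
    revert p; decide
  · rintro ⟨G, hG⟩
    refine ⟨fun e => 1 + edgeCochain G e, ?_⟩
    rw [← compl_inj_iff, hG]
    refine (key _ G fun u w huw => ?_).symm
    rw [← pairVal_edgeCochain]
    simp [pairVal, huw]

/-- The indicator of an ordered triple spanning an odd number of edges, as a polynomial in the
adjacencies; it vanishes on degenerate triples. -/
noncomputable def triOdd {V : Type*} (G : SimpleGraph V) (a b c : V) : ℤ :=
  adjInt G a b + adjInt G b c + adjInt G a c
    - 2 * (adjInt G a b * adjInt G b c + adjInt G b c * adjInt G a c + adjInt G a b * adjInt G a c)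
    + 4 * (adjInt G a b * adjInt G b c * adjInt G a c)

lemma triOdd_eq {V : Type*} (G : SimpleGraph V) (a b c : V) :
    triOdd G a b c = if adjBit G a b + adjBit G b c + adjBit G a c ≠ 0 then 1 else 0 := by
  unfold triOdd adjInt adjBit
  by_cases h1 : G.Adj a b <;> by_cases h2 : G.Adj b c <;> by_cases h3 : G.Adj a c <;>
    simp [h1, h2, h3] <;> decide

/-- A set of faces has six times as many orderings as elements. -/
lemma card_orderings (D : Finset (Face n)) :
    (Finset.univ.filter fun t : Fin n × Fin n × Fin n =>
      ({t.1, t.2.1, t.2.2} : Finset (Fin n)) ∈ D.image Subtype.val).card = 6 * D.card := by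
  rw [Finset.card_eq_sum_card_fiberwise (t := D.image Subtype.val)
    (f := fun t : Fin n × Fin n × Fin n => ({t.1, t.2.1, t.2.2} : Finset (Fin n)))
    (by intro t ht; simpa using ht)]
  rw [Finset.sum_const_nat (m := 6)]
  · rw [Finset.card_image_of_injective _ Subtype.val_injective, mul_comm]
  · intro s hs
    obtain ⟨σ, -, rfl⟩ := Finset.mem_image.1 hs
    obtain ⟨a, b, c, hab, hac, hbc, rfl⟩ := Face.exists_eq σ
    have : (Finset.univ.filter fun t : Fin n × Fin n × Fin n =>
        ({t.1, t.2.1, t.2.2} : Finset (Fin n)) ∈ D.image Subtype.val).filter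
        (fun t => ({t.1, t.2.1, t.2.2} : Finset (Fin n)) = (face a b c hab hac hbc).1)
        = {(a, b, c), (a, c, b), (b, a, c), (b, c, a), (c, a, b), (c, b, a)} := by
      ext ⟨u, v, w⟩
      simp only [Finset.mem_filter, Finset.mem_univ, true_and, Finset.mem_insert,
        Finset.mem_singleton, Prod.mk.injEq]
      constructor
      · rintro ⟨-, h⟩
        have hc : ({u, v, w} : Finset (Fin n)).card = 3 := h ▸ (face a b c hab hac hbc).2
        have huv : u ≠ v := by
          rintro rfl
          rw [Finset.insert_eq_of_mem (by simp)] at hc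
          exact absurd hc (by have := Finset.card_le_two (a := u) (b := w); omega)
        have huw : u ≠ w := by
          rintro rfl
          rw [Finset.insert_eq_of_mem (by simp)] at hc
          exact absurd hc (by have := Finset.card_le_two (a := v) (b := u); omega)
        have hvw : v ≠ w := by
          rintro rfl
          rw [Finset.pair_eq_singleton] at hc
          exact absurd hc (by have := Finset.card_le_two (a := u) (b := v); omega)
        have hu : u ∈ ({a, b, c} : Finset (Fin n)) := by
          have : u ∈ (face a b c hab hac hbc).1 := h ▸ (by simp)
          exact this
        have hv : v ∈ ({a, b, c} : Finset (Fin n)) := by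
          have : v ∈ (face a b c hab hac hbc).1 := h ▸ (by simp)
          exact this
        have hw : w ∈ ({a, b, c} : Finset (Fin n)) := by
          have : w ∈ (face a b c hab hac hbc).1 := h ▸ (by simp)
          exact this
        simp only [Finset.mem_insert, Finset.mem_singleton] at hu hv hw
        rcases hu with rfl | rfl | rfl <;> rcases hv with rfl | rfl | rfl <;>
          rcases hw with rfl | rfl | rfl <;> first | contradiction | simp
      · have himg : (face a b c hab hac hbc).1 ∈ D.image Subtype.val := hs
        intro h
        have : ({u, v, w} : Finset (Fin n)) = (face a b c hab hac hbc).1 := by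
          unfold face
          rcases h with ⟨rfl, rfl, rfl⟩ | ⟨rfl, rfl, rfl⟩ | ⟨rfl, rfl, rfl⟩ | ⟨rfl, rfl, rfl⟩ |
            ⟨rfl, rfl, rfl⟩ | ⟨rfl, rfl, rfl⟩ <;> ext z <;> simp <;> tauto
        exact ⟨this ▸ himg, this⟩
    rw [this]
    simp [Finset.card_insert_of_notMem, hab, hac, hbc, hab.symm, hac.symm, hbc.symm]

lemma six_mul_card_oddFaces (G : SimpleGraph (Fin n)) :
    6 * ((oddFaces G).card : ℤ) = ∑ u, ∑ v, ∑ w, triOdd G u v w := by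
  have h1 : 6 * ((oddFaces G).card : ℤ) = ((6 * (oddFaces G).card : ℕ) : ℤ) := by push_cast; rfl
  rw [h1, ← card_orderings, Finset.card_filter]
  push_cast
  rw [Fintype.sum_prod_type]
  refine Finset.sum_congr rfl fun u _ => ?_
  rw [Fintype.sum_prod_type]
  refine Finset.sum_congr rfl fun v _ => Finset.sum_congr rfl fun w _ => ?_
  rw [triOdd_eq]
  by_cases huv : u = v
  · subst huv
    rw [if_neg, if_neg]
    · rw [adjBit_self]
      generalize adjBit G u w = p
      revert p; decide
    · intro h
      obtain ⟨σ, -, hσ⟩ := Finset.mem_image.1 h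
      have h3 := σ.2
      rw [hσ] at h3
      simp only [Finset.mem_insert, Finset.mem_singleton, true_or, Finset.insert_eq_of_mem] at h3
      have := Finset.card_le_two (a := u) (b := w); omega
  by_cases hvw : v = w
  · subst hvw
    rw [if_neg, if_neg]
    · rw [adjBit_self]
      generalize adjBit G u v = p
      revert p; decide
    · intro h
      obtain ⟨σ, -, hσ⟩ := Finset.mem_image.1 h
      have h3 := σ.2
      rw [hσ] at h3
      simp only [Finset.mem_singleton, Finset.insert_eq_of_mem] at h3
      have := Finset.card_le_two (a := u) (b := v); omega
  by_cases huw : u = w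
  · subst huw
    rw [if_neg, if_neg]
    · rw [adjBit_self, adjBit_comm G v u]
      generalize adjBit G u v = p
      revert p; decide
    · intro h
      obtain ⟨σ, -, hσ⟩ := Finset.mem_image.1 h
      have h3 := σ.2
      rw [hσ] at h3
      simp only [Finset.mem_insert, Finset.mem_singleton, or_true, Finset.insert_eq_of_mem] at h3
      have := Finset.card_le_two (a := v) (b := u); omega
  have : ({u, v, w} : Finset (Fin n)) ∈ (oddFaces G).image Subtype.val ↔
      face u v w huv huw hvw ∈ oddFaces G := by
    rw [Finset.mem_image]
    constructor
    · rintro ⟨σ, hσ, h⟩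
      have : σ = face u v w huv huw hvw := Subtype.ext h
      exact this ▸ hσ
    · intro h
      exact ⟨_, h, rfl⟩
  simp only [this, face_mem_oddFaces]

/-- The number of ordered triangles of a graph. -/
noncomputable def triangleSum {V : Type*} [Fintype V] (G : SimpleGraph V) : ℤ :=
  ∑ u, ∑ v, ∑ w, adjInt G u v * adjInt G v w * adjInt G u w

lemma triangleSum_nonneg {V : Type*} [Fintype V] (G : SimpleGraph V) : 0 ≤ triangleSum G :=
  Finset.sum_nonneg fun _ _ => Finset.sum_nonneg fun _ _ => Finset.sum_nonneg fun _ _ =>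
    mul_nonneg (mul_nonneg (adjInt_nonneg _ _ _) (adjInt_nonneg _ _ _)) (adjInt_nonneg _ _ _)

lemma sum_triOdd {V : Type*} [Fintype V] (G : SimpleGraph V) :
    ∑ u, ∑ v, ∑ w, triOdd G u v w =
      3 * ∑ u, vdeg G u * (Fintype.card V - 2 * vdeg G u) + 4 * triangleSum G := by
  have e1 : ∑ u, ∑ v, ∑ _w : V, adjInt G u v = Fintype.card V * ∑ u, vdeg G u := by
    simp [vdeg, Finset.mul_sum]
  have e2 : ∑ _u : V, ∑ v, ∑ w, adjInt G v w = Fintype.card V * ∑ u, vdeg G u := by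
    simp [vdeg]
  have e3 : ∑ u, ∑ _v : V, ∑ w, adjInt G u w = Fintype.card V * ∑ u, vdeg G u := by
    simp [vdeg, Finset.mul_sum]
  have f1 : ∑ u, ∑ v, ∑ w, adjInt G u v * adjInt G v w = ∑ v, vdeg G v * vdeg G v := by
    rw [Finset.sum_comm]
    refine Finset.sum_congr rfl fun v _ => ?_
    simp only [vdeg, Finset.sum_mul_sum]
    refine Finset.sum_congr rfl fun u _ => Finset.sum_congr rfl fun w _ => ?_
    rw [adjInt_comm G u v]
  have f3 : ∑ u, ∑ v, ∑ w, adjInt G u v * adjInt G u w = ∑ v, vdeg G v * vdeg G v := by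
    simp only [vdeg, Finset.sum_mul_sum]
  have f2 : ∑ u, ∑ v, ∑ w, adjInt G v w * adjInt G u w = ∑ v, vdeg G v * vdeg G v := by
    rw [← f1]
    refine Finset.sum_congr rfl fun u _ => ?_
    rw [Finset.sum_comm]
    refine Finset.sum_congr rfl fun w _ => Finset.sum_congr rfl fun v _ => ?_
    rw [adjInt_comm G v w, mul_comm]
  have expand : ∑ u, ∑ v, ∑ w, triOdd G u v w
      = ∑ u, ∑ v, ∑ _w : V, adjInt G u v + ∑ _u : V, ∑ v, ∑ w, adjInt G v w
        + ∑ u, ∑ _v : V, ∑ w, adjInt G u w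
        - 2 * (∑ u, ∑ v, ∑ w, adjInt G u v * adjInt G v w
          + ∑ u, ∑ v, ∑ w, adjInt G v w * adjInt G u w
          + ∑ u, ∑ v, ∑ w, adjInt G u v * adjInt G u w) + 4 * triangleSum G := by
    unfold triOdd triangleSum
    simp only [Finset.mul_sum, ← Finset.sum_add_distrib, ← Finset.sum_sub_distrib]
  rw [expand, e1, e2, e3, f1, f2, f3]
  simp only [mul_sub, Finset.sum_sub_distrib]
  have g1 : ∑ u, vdeg G u * (Fintype.card V : ℤ) = Fintype.card V * ∑ u, vdeg G u := by
    rw [Finset.mul_sum]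
    exact Finset.sum_congr rfl fun u _ => mul_comm _ _
  have g2 : ∑ u, vdeg G u * (2 * vdeg G u) = 2 * ∑ u, vdeg G u * vdeg G u := by
    rw [Finset.mul_sum]
    exact Finset.sum_congr rfl fun u _ => by ring
  rw [g1, g2]
  ring

/-- The number of odd faces of a graph in terms of its degrees and triangles. -/
lemma six_mul_card_oddFaces_eq (G : SimpleGraph (Fin n)) :
    6 * ((oddFaces G).card : ℤ) = 3 * ∑ u, vdeg G u * (n - 2 * vdeg G u) + 4 * triangleSum G := by
  rw [six_mul_card_oddFaces, sum_triOdd, Fintype.card_fin]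

/-- Seidel switching of a graph along a set of vertices with indicator `f`. -/
def switch {V : Type*} (G : SimpleGraph V) (f : V → ZMod 2) : SimpleGraph V where
  Adj u w := u ≠ w ∧ adjBit G u w + f u + f w ≠ 0
  symm := ⟨fun u w h => ⟨h.1.symm, by
    rw [adjBit_comm, add_assoc, add_comm (f w), ← add_assoc]; exact h.2⟩⟩
  loopless := ⟨fun u h => h.1 rfl⟩

lemma adjBit_switch {V : Type*} (G : SimpleGraph V) (f : V → ZMod 2) {u w : V} (h : u ≠ w) :
    adjBit (switch G f) u w = adjBit G u w + f u + f w := by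
  have : adjBit (switch G f) u w = if adjBit G u w + f u + f w ≠ 0 then 1 else 0 := by
    conv_lhs => unfold adjBit
    simp [switch, h]
  rw [this]
  generalize adjBit G u w + f u + f w = p
  revert p; decide

lemma oddFaces_switch (G : SimpleGraph (Fin n)) (f : Fin n → ZMod 2) :
    oddFaces (switch G f) = oddFaces G := by
  ext σ
  obtain ⟨a, b, c, hab, hac, hbc, rfl⟩ := Face.exists_eq σ
  rw [face_mem_oddFaces, face_mem_oddFaces, adjBit_switch G f hab, adjBit_switch G f hbc,
    adjBit_switch G f hac]
  generalize adjBit G a b = p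
  generalize adjBit G b c = q
  generalize adjBit G a c = r
  generalize f a = x
  generalize f b = y
  generalize f c = z
  revert p q r x y z; decide

lemma adjInt_eq_ite {V : Type*} (G : SimpleGraph V) (u w : V) :
    adjInt G u w = if adjBit G u w ≠ 0 then 1 else 0 := by
  unfold adjInt adjBit; split_ifs <;> simp_all

/-- Every odd-face set comes from a graph of minimal size in its switching class. Minimality under
switching single vertices bounds the degrees by `(n-1)/2`; comparison with the graphs in the class
having an isolated vertex, averaged over that vertex, bounds the number of edges. -/
lemma exists_sparse_representative (G₀ : SimpleGraph (Fin n)) :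
    ∃ G : SimpleGraph (Fin n), oddFaces G = oddFaces G₀ ∧ (∀ u, 2 * vdeg G u ≤ n - 1) ∧
      n * ∑ u, vdeg G u ≤ 6 * (oddFaces G).card := by
  obtain ⟨G, hG, hmin⟩ : ∃ G : SimpleGraph (Fin n), oddFaces G = oddFaces G₀ ∧
      ∀ G', oddFaces G' = oddFaces G₀ → ∑ u, vdeg G u ≤ ∑ u, vdeg G' u := by
    obtain ⟨⟨G, hG⟩, hmin⟩ := @Finite.exists_min {G : SimpleGraph (Fin n) // oddFaces G = oddFaces G₀}
      ℤ _ ⟨⟨G₀, rfl⟩⟩ _ (fun G => ∑ u, vdeg G.1 u)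
    exact ⟨G, hG, fun G' hG' => hmin ⟨G', hG'⟩⟩
  refine ⟨G, hG, fun u => ?_, ?_⟩
  · have h := hmin (switch G (Pi.single u 1)) ((oddFaces_switch _ _).trans hG)
    have hadj : ∀ x w, adjInt (switch G (Pi.single u 1)) x w = adjInt G x w
        + ((if x = u then 1 else 0) + if w = u then 1 else 0) * (1 - 2 * adjInt G x w)
        - 2 * ((if x = u then 1 else 0) * if w = u then 1 else 0) := by
      intro x w
      by_cases hxw : x = w
      · subst hxw
        rw [adjInt_self, adjInt_self]
        split_ifs <;> norm_num
      · rw [adjInt_eq_ite (switch _ _), adjInt_eq_ite G, adjBit_switch G _ hxw]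
        simp only [Pi.single_apply]
        generalize adjBit G x w = p
        by_cases h1 : x = u
        · have h2 : w ≠ u := fun h2 => hxw (h1.trans h2.symm)
          simp only [h1, h2, if_true, if_false]
          revert p; decide
        · by_cases h2 : w = u
          · simp only [h1, h2, if_true, if_false]
            revert p; decide
          · simp only [h1, h2, if_false]
            revert p; decide
    have hsum : ∑ x, vdeg (switch G (Pi.single u 1)) x
        = ∑ x, vdeg G x + 2 * (n - 2 * vdeg G u) - 2 := by
      have s1 : ∑ x, ∑ w, (if x = u then (1 : ℤ) else 0) * (1 - 2 * adjInt G x w)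
          = n - 2 * vdeg G u := by
        simp [vdeg, ← Finset.mul_sum, Finset.sum_ite_irrel]
      have s2 : ∑ x, ∑ w, (if w = u then (1 : ℤ) else 0) * (1 - 2 * adjInt G x w)
          = n - 2 * vdeg G u := by
        rw [Finset.sum_comm, ← s1]
        refine Finset.sum_congr rfl fun x _ => Finset.sum_congr rfl fun w _ => ?_
        rw [adjInt_comm]
      have s3 : ∑ x : Fin n, ∑ w : Fin n,
          (if x = u then (1 : ℤ) else 0) * (if w = u then 1 else 0) = 1 := by
        simp
      simp only [vdeg] at s1 s2 ⊢
      simp only [hadj, Finset.sum_add_distrib, Finset.sum_sub_distrib, add_mul, ← Finset.mul_sum] at s1 s2 s3 ⊢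
      rw [s1, s2, s3]
      ring
    rw [hsum] at h
    linarith
  · -- switching along the neighbourhood of `v` isolates `v` and leaves its link, whose ordered edges
    -- are counted by the odd triples through `v`
    have hlink : ∀ v, ∑ u, vdeg G u ≤ ∑ u, ∑ w, triOdd G v u w := by
      intro v
      refine (hmin (switch G (fun u => adjBit G v u)) ((oddFaces_switch _ _).trans hG)).trans_eq ?_
      refine Finset.sum_congr rfl fun u _ => Finset.sum_congr rfl fun w _ => ?_
      rw [triOdd_eq, adjInt_eq_ite]
      by_cases huw : u = w
      · subst huw
        rw [adjBit_self, adjBit_self]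
        generalize adjBit G v u = p
        revert p; decide
      · rw [adjBit_switch G _ huw]
        generalize adjBit G v u = p
        generalize adjBit G u w = q
        generalize adjBit G v w = r
        revert p q r; decide
    have := Finset.sum_le_sum fun v (_ : v ∈ Finset.univ) => hlink v
    rw [← six_mul_card_oddFaces, Finset.sum_const, Finset.card_univ, Fintype.card_fin,
      nsmul_eq_mul] at this
    exact this

lemma six_mul_choose_three (n : ℕ) : 6 * (n.choose 3 : ℤ) = n * (n - 1) * (n - 2) := by
  rcases n with _ | _ | n
  · simp
  · simp [Nat.choose]
  have h := Nat.descFactorial_eq_factorial_mul_choose (n + 2) 3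
  have h2 : (n + 2).descFactorial 3 = (n + 2) * (n + 1) * n := by
    simp [Nat.descFactorial]; ring
  rw [h2] at h
  have h3 : Nat.factorial 3 = 6 := rfl
  rw [h3] at h
  have h4 : 6 * ((n + 2).choose 3 : ℤ) = ((6 * (n + 2).choose 3 : ℕ) : ℤ) := by push_cast; rfl
  rw [h4, ← h]
  push_cast
  ring

lemma card_add_card_compl (C : Finset (Face n)) : C.card + Cᶜ.card = n.choose 3 := by
  rw [Finset.card_add_card_compl, Fintype.card_finset_len, Fintype.card_fin]

open Classical in
/-- The complete bipartite graph between two vertex sets. -/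
noncomputable def bipartiteGraph (K₁ K₂ : Finset (Fin n)) : SimpleGraph (Fin n) :=
  SimpleGraph.fromRel fun u w => u ∈ K₁ ∧ w ∈ K₂

/-- In a large hypercut complement there are no two nonadjacent sets of vertices that every other
vertex sees in the same way: the complete bipartite graph between them would give a coboundary
inside the hypercut, and hence equal to it, which has too few faces. -/
lemma no_twin_sets {C : Finset (Face n)} {G : SimpleGraph (Fin n)} (hC : IsMinimalCoboundary C)
    (hG : Cᶜ = oddFaces G) (hn : 12 ≤ n) (hcard : (Cᶜ.card : ℤ) ≤ n ^ 2) {K₁ K₂ : Finset (Fin n)}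
    (h₁ : K₁.Nonempty) (h₂ : K₂.Nonempty) (hd : Disjoint K₁ K₂) (hz : ∃ z, z ∉ K₁ ∧ z ∉ K₂)
    (hno : ∀ u ∈ K₁, ∀ w ∈ K₂, ¬ G.Adj u w)
    (hun : ∀ z, z ∉ K₁ → z ∉ K₂ → ∀ u ∈ K₁, ∀ w ∈ K₂, (G.Adj z u ↔ G.Adj z w)) : False := by
  set B := bipartiteGraph K₁ K₂ with hB
  have hd' : ∀ x, x ∈ K₁ → x ∉ K₂ := fun _ h => Finset.disjoint_left.1 hd h
  have hBadj : ∀ u w, B.Adj u w ↔ (u ∈ K₁ ∧ w ∈ K₂) ∨ (w ∈ K₁ ∧ u ∈ K₂) := by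
    intro u w
    simp only [hB, bipartiteGraph, SimpleGraph.fromRel_adj]
    constructor
    · exact fun h => h.2
    · intro h
      refine ⟨?_, h⟩
      rintro rfl
      rcases h with h | h <;> exact hd' _ h.1 h.2
  have hsub : oddFaces B ⊆ C := by
    intro σ hσ
    by_contra hσC
    rw [← Finset.mem_compl, hG] at hσC
    obtain ⟨a, b, c, hab, hac, hbc, rfl⟩ := Face.exists_eq σ
    rw [face_mem_oddFaces] at hσ hσC
    have key : ∀ u w z, u ∈ K₁ → w ∈ K₂ → z ∉ K₁ → z ∉ K₂ →
        adjBit G u w = 0 ∧ adjBit G z u = adjBit G z w := by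
      intro u w z hu hw hz1 hz2
      refine ⟨by simp [adjBit, hno u hu w hw], ?_⟩
      exact adjBit_congr (hun z hz1 hz2 u hu w hw)
    have dbl : ∀ p : ZMod 2, p + p = 0 := by decide
    have hBbit : ∀ u w, adjBit B u w = (if u ∈ K₁ then 1 else 0) * (if w ∈ K₂ then 1 else 0)
        + (if w ∈ K₁ then 1 else 0) * (if u ∈ K₂ then 1 else 0) := by
      intro u w
      unfold adjBit
      by_cases u1 : u ∈ K₁ <;> by_cases u2 : u ∈ K₂ <;> by_cases w1 : w ∈ K₁ <;>
        by_cases w2 : w ∈ K₂ <;> first | exact absurd u2 (hd' _ u1) | exact absurd w2 (hd' _ w1) |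
          simp [hBadj, u1, u2, w1, w2]
    rw [hBbit, hBbit, hBbit] at hσ
    by_cases a1 : a ∈ K₁ <;> by_cases a2 : a ∈ K₂ <;> by_cases b1 : b ∈ K₁ <;>
      by_cases b2 : b ∈ K₂ <;> by_cases c1 : c ∈ K₁ <;> by_cases c2 : c ∈ K₂ <;>
      simp only [a1, a2, b1, b2, c1, c2, if_true, if_false, mul_zero, mul_one, add_zero, zero_add,
        dbl, ne_eq, not_true_eq_false] at hσ
    all_goals first
      | exact hd' _ a1 a2
      | exact hd' _ b1 b2
      | exact hd' _ c1 c2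
      | skip
    · obtain ⟨e1, e2⟩ := key a b c a1 b2 c1 c2
      apply hσC; rw [e1, adjBit_comm G b c, adjBit_comm G a c, e2, zero_add, dbl]
    · obtain ⟨e1, e2⟩ := key a c b a1 c2 b1 b2
      apply hσC; rw [e1, adjBit_comm G a b, e2, add_zero, dbl]
    · obtain ⟨e1, e2⟩ := key b a c b1 a2 c1 c2
      apply hσC; rw [adjBit_comm G a b, e1, adjBit_comm G b c, adjBit_comm G a c, e2, zero_add, dbl]
    · obtain ⟨e1, e2⟩ := key c a b c1 a2 b1 b2
      apply hσC; rw [adjBit_comm G a c, e1, adjBit_comm G a b, e2, add_zero, dbl]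
    · obtain ⟨e1, e2⟩ := key b c a b1 c2 a1 a2
      apply hσC; rw [e1, e2, add_zero, dbl]
    · obtain ⟨e1, e2⟩ := key c b a c1 b2 a1 a2
      apply hσC; rw [adjBit_comm G b c, e1, e2, add_zero, dbl]
  have hne : (oddFaces B).Nonempty := by
    obtain ⟨u, hu⟩ := h₁
    obtain ⟨w, hw⟩ := h₂
    obtain ⟨z, hz1, hz2⟩ := hz
    have huw : u ≠ w := fun h => hd' u hu (h ▸ hw)
    have huz : u ≠ z := fun h => hz1 (h ▸ hu)
    have hwz : w ≠ z := fun h => hz2 (h ▸ hw)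
    refine ⟨face u w z huw huz hwz, ?_⟩
    rw [face_mem_oddFaces]
    simp [adjBit, hBadj, hu, hw, hz1, hz2]
  have hEq : oddFaces B = C :=
    (hC.eq_of_ge ⟨isCoboundary_oddFaces B, hne⟩ hsub).symm
  have hBint : ∀ u w, adjInt B u w = (if u ∈ K₁ then 1 else 0) * (if w ∈ K₂ then 1 else 0)
      + (if w ∈ K₁ then 1 else 0) * (if u ∈ K₂ then 1 else 0) := by
    intro u w
    unfold adjInt
    by_cases u1 : u ∈ K₁ <;> by_cases u2 : u ∈ K₂ <;> by_cases w1 : w ∈ K₁ <;>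
      by_cases w2 : w ∈ K₂ <;> first | exact absurd u2 (hd' _ u1) | exact absurd w2 (hd' _ w1) |
        simp [hBadj, u1, u2, w1, w2]
  have hT : triangleSum B = 0 := by
    refine Finset.sum_eq_zero fun u _ => Finset.sum_eq_zero fun v _ =>
      Finset.sum_eq_zero fun w _ => ?_
    rw [mul_eq_zero, mul_eq_zero]
    by_contra hcon
    push Not at hcon
    have f : ∀ a b, adjInt B a b ≠ 0 → B.Adj a b := by
      intro a b h
      by_contra h'
      exact h (by simp [adjInt, h'])
    have g1 := (hBadj _ _).1 (f _ _ hcon.1.1)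
    have g2 := (hBadj _ _).1 (f _ _ hcon.1.2)
    have g3 := (hBadj _ _).1 (f _ _ hcon.2)
    have := hd' u
    have := hd' v
    have := hd' w
    tauto
  have hdeg : ∀ u, vdeg B u = (if u ∈ K₁ then 1 else 0) * K₂.card
      + (if u ∈ K₂ then 1 else 0) * K₁.card := by
    intro u
    simp only [vdeg, hBint, Finset.sum_add_distrib, ← Finset.mul_sum, ← Finset.sum_mul]
    simp [mul_comm]
  have h6 := six_mul_card_oddFaces_eq B
  have hsum : ∑ u, vdeg B u * (n - 2 * vdeg B u)
      = 2 * (K₁.card * K₂.card * (n - K₁.card - K₂.card) : ℤ) := by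
    have : ∀ u, vdeg B u * (n - 2 * vdeg B u)
        = (if u ∈ K₁ then 1 else 0) * (K₂.card * (n - 2 * K₂.card) : ℤ)
          + (if u ∈ K₂ then 1 else 0) * (K₁.card * (n - 2 * K₁.card) : ℤ) := by
      intro u
      rw [hdeg]
      by_cases u1 : u ∈ K₁
      · simp [u1, hd' u u1]
      · by_cases u2 : u ∈ K₂ <;> simp [u1, u2]
    simp only [this, Finset.sum_add_distrib, ← Finset.sum_mul]
    simp
    ring
  rw [hsum, hT, hEq] at h6
  have h7 := six_mul_choose_three n
  have h8 := card_add_card_compl C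
  have h9 : K₁.card + K₂.card ≤ n := by
    rw [← Finset.card_union_of_disjoint hd]
    exact (Finset.card_le_univ _).trans_eq (Fintype.card_fin n)
  have h10 : (C.card : ℤ) + Cᶜ.card = n.choose 3 := by exact_mod_cast h8
  rw [← h10] at h7
  obtain ⟨s, hs⟩ : ∃ s : ℕ, n = K₁.card + K₂.card + s := ⟨n - (K₁.card + K₂.card), by omega⟩
  have hs' : (n : ℤ) - K₁.card - K₂.card = s := by
    have : (n : ℤ) = K₁.card + K₂.card + s := by exact_mod_cast hs
    linarith
  rw [hs'] at h6
  have amgm : ∀ a b c : ℤ, 0 ≤ a → 0 ≤ b → 0 ≤ c → 27 * (a * b * c) ≤ (a + b + c) ^ 3 := by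
    intro a b c ha hb hc
    nlinarith [mul_nonneg ha (sq_nonneg (b - c)), mul_nonneg hb (sq_nonneg (a - c)),
      mul_nonneg hc (sq_nonneg (a - b)), mul_nonneg ha (sq_nonneg (a - b)),
      mul_nonneg ha (sq_nonneg (a - c)), mul_nonneg hb (sq_nonneg (a - b)),
      mul_nonneg hb (sq_nonneg (b - c)), mul_nonneg hc (sq_nonneg (a - c)),
      mul_nonneg hc (sq_nonneg (b - c))]
  have h11 := amgm K₁.card K₂.card s (by positivity) (by positivity) (by positivity)
  have h12 : ((K₁.card : ℤ) + K₂.card + s) = n := by linarith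
  rw [h12] at h11
  have hn' : (12 : ℤ) ≤ n := by exact_mod_cast hn
  nlinarith [sq_nonneg (n : ℤ), mul_le_mul_of_nonneg_left hn' (sq_nonneg (n : ℤ))]

/-! ### Components after deleting vertices, and the centre -/

lemma vdeg_eq_degree {V : Type*} [Fintype V] (G : SimpleGraph V) [DecidableRel G.Adj] (u : V) :
    vdeg G u = G.degree u := by
  rw [← SimpleGraph.card_neighborFinset_eq_degree, SimpleGraph.neighborFinset_eq_filter,
    Finset.card_filter]
  push_cast
  refine Finset.sum_congr rfl fun w _ => ?_
  unfold adjInt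
  split_ifs <;> rfl

lemma sum_vdeg_eq_two_mul {V : Type*} [Fintype V] (G : SimpleGraph V) :
    ∑ u, vdeg G u = 2 * Nat.card G.edgeSet := by
  classical
  simp only [vdeg_eq_degree]
  rw [Nat.card_eq_fintype_card, ← SimpleGraph.edgeFinset_card]
  exact_mod_cast G.sum_degrees_eq_twice_card_edges

lemma two_mul_le_sum_vdeg {V : Type*} [Fintype V] {G : SimpleGraph V} (hG : G.Connected) :
    2 * ((Fintype.card V : ℤ) - 1) ≤ ∑ u, vdeg G u := by
  rw [sum_vdeg_eq_two_mul]
  have := hG.card_vert_le_card_edgeSet_add_one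
  rw [Nat.card_eq_fintype_card] at this
  omega

/-- The graph with the edges at `B` removed. -/
def deleteAt (G : SimpleGraph (Fin n)) (B : Finset (Fin n)) : SimpleGraph (Fin n) where
  Adj u w := G.Adj u w ∧ u ∉ B ∧ w ∉ B
  symm := ⟨fun _ _ h => ⟨h.1.symm, h.2.2, h.2.1⟩⟩
  loopless := ⟨fun _ h => G.loopless.irrefl _ h.1⟩

open Classical in
/-- The vertex set of the component of `u` after deleting `B`. -/
noncomputable def compOf (G : SimpleGraph (Fin n)) (B : Finset (Fin n)) (u : Fin n) :
    Finset (Fin n) :=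
  Finset.univ.filter fun w => (deleteAt G B).Reachable u w

open Classical in
/-- The vertex sets of the components of `G - B`. -/
noncomputable def comps (G : SimpleGraph (Fin n)) (B : Finset (Fin n)) :
    Finset (Finset (Fin n)) :=
  Bᶜ.image (compOf G B)

/-- The sum of the degrees of the graph induced on `K`. -/
noncomputable def innerSum (G : SimpleGraph (Fin n)) (K : Finset (Fin n)) : ℤ :=
  ∑ u ∈ K, ∑ w ∈ K, adjInt G u w

section Components

variable {G : SimpleGraph (Fin n)} {B K K₁ K₂ : Finset (Fin n)} {u w : Fin n}

lemma mem_compOf : w ∈ compOf G B u ↔ (deleteAt G B).Reachable u w := by simp [compOf]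

lemma self_mem_compOf : u ∈ compOf G B u := mem_compOf.2 (SimpleGraph.Reachable.refl _)

lemma mem_comps : K ∈ comps G B ↔ ∃ u, u ∉ B ∧ compOf G B u = K := by simp [comps]

lemma compOf_mem_comps (h : u ∉ B) : compOf G B u ∈ comps G B := mem_comps.2 ⟨u, h, rfl⟩

lemma compOf_eq_of_mem (h : w ∈ compOf G B u) : compOf G B w = compOf G B u := by
  ext z
  rw [mem_compOf] at h
  rw [mem_compOf, mem_compOf]
  exact ⟨fun h' => h.trans h', fun h' => h.symm.trans h'⟩

lemma eq_compOf_of_mem (hK : K ∈ comps G B) (hu : u ∈ K) : K = compOf G B u := by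
  obtain ⟨w, -, rfl⟩ := mem_comps.1 hK
  exact (compOf_eq_of_mem hu).symm

lemma notMem_of_mem_comps (hK : K ∈ comps G B) (hu : u ∈ K) : u ∉ B := by
  obtain ⟨w, hw, rfl⟩ := mem_comps.1 hK
  rw [mem_compOf] at hu
  obtain ⟨p⟩ := hu.symm
  cases p with
  | nil => exact hw
  | cons h _ => exact h.2.1

lemma comps_nonempty (hK : K ∈ comps G B) : K.Nonempty := by
  obtain ⟨w, hw, rfl⟩ := mem_comps.1 hK
  exact ⟨w, self_mem_compOf⟩

lemma eq_of_mem_comps (h₁ : K₁ ∈ comps G B) (h₂ : K₂ ∈ comps G B) (hu : u ∈ K₁) (hu' : u ∈ K₂) :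
    K₁ = K₂ := by rw [eq_compOf_of_mem h₁ hu, eq_compOf_of_mem h₂ hu']

lemma mem_of_adj (hK : K ∈ comps G B) (hu : u ∈ K) (hw : w ∉ B) (h : G.Adj u w) : w ∈ K := by
  rw [eq_compOf_of_mem hK hu, mem_compOf]
  exact SimpleGraph.Adj.reachable ⟨h, notMem_of_mem_comps hK hu, hw⟩

lemma sum_comps {M : Type*} [AddCommMonoid M] (f : Fin n → M) :
    ∑ K ∈ comps G B, ∑ u ∈ K, f u = ∑ u ∈ Bᶜ, f u := by
  classical
  rw [← Finset.sum_biUnion]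
  · refine Finset.sum_congr ?_ fun _ _ => rfl
    ext u
    rw [Finset.mem_biUnion, Finset.mem_compl]
    constructor
    · rintro ⟨K, hK, hu⟩
      exact notMem_of_mem_comps hK hu
    · exact fun h => ⟨_, compOf_mem_comps h, self_mem_compOf⟩
  · intro K₁ h₁ K₂ h₂ hne
    rw [Function.onFun, Finset.disjoint_left]
    exact fun u hu hu' => hne (eq_of_mem_comps (Finset.mem_coe.1 h₁) (Finset.mem_coe.1 h₂) hu hu')

lemma connected_induce_comps (hK : K ∈ comps G B) : (G.induce (K : Set (Fin n))).Connected := by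
  obtain ⟨u, hu, rfl⟩ := mem_comps.1 hK
  have h := ((deleteAt G B).connectedComponentMk u).connected_toSimpleGraph
  have hs : ((deleteAt G B).connectedComponentMk u).supp = (compOf G B u : Set (Fin n)) := by
    ext w
    rw [SimpleGraph.ConnectedComponent.mem_supp_iff, SimpleGraph.ConnectedComponent.eq,
      Finset.mem_coe, mem_compOf]
    exact ⟨fun h => h.symm, fun h => h.symm⟩
  have h2 : ((deleteAt G B).induce (compOf G B u : Set (Fin n))).Connected := by
    rw [← hs]; exact h
  exact h2.mono fun a b hab => And.left hab

lemma innerSum_eq_sum_vdeg (G : SimpleGraph (Fin n)) (K : Finset (Fin n)) :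
    innerSum G K = ∑ u, vdeg (G.induce (K : Set (Fin n))) u := by
  unfold innerSum vdeg
  rw [← Finset.sum_coe_sort K]
  refine Finset.sum_congr rfl fun u _ => ?_
  rw [← Finset.sum_coe_sort K]
  rfl

lemma even_innerSum (G : SimpleGraph (Fin n)) (K : Finset (Fin n)) : Even (innerSum G K) := by
  rw [innerSum_eq_sum_vdeg, sum_vdeg_eq_two_mul]
  exact even_two_mul _

lemma le_innerSum (hK : K ∈ comps G B) : 2 * ((K.card : ℤ) - 1) ≤ innerSum G K := by
  rw [innerSum_eq_sum_vdeg]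
  have := two_mul_le_sum_vdeg (connected_induce_comps hK)
  simpa using this

/-- The number of neighbours in `B` of a vertex. -/
noncomputable def degIn (G : SimpleGraph (Fin n)) (B : Finset (Fin n)) (u : Fin n) : ℤ :=
  ∑ b ∈ B, adjInt G u b

lemma degIn_nonneg : 0 ≤ degIn G B u := Finset.sum_nonneg fun _ _ => adjInt_nonneg _ _ _

lemma vdeg_eq_add (hK : K ∈ comps G B) (hu : u ∈ K) :
    vdeg G u = ∑ w ∈ K, adjInt G u w + degIn G B u := by
  classical
  have hdisj : Disjoint K B := Finset.disjoint_left.2 fun w hw => notMem_of_mem_comps hK hw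
  rw [degIn, ← Finset.sum_union hdisj, vdeg]
  refine (Finset.sum_subset (Finset.subset_univ _) fun w _ hw => ?_).symm
  rw [Finset.mem_union, not_or] at hw
  have : ¬ G.Adj u w := fun h => hw.1 (mem_of_adj hK hu hw.2 h)
  simp [adjInt, this]

lemma sum_vdeg_comp (hK : K ∈ comps G B) :
    ∑ u ∈ K, vdeg G u = innerSum G K + ∑ u ∈ K, degIn G B u := by
  rw [innerSum, ← Finset.sum_add_distrib]
  exact Finset.sum_congr rfl fun u hu => vdeg_eq_add hK hu

/-- Two components of `G - B` cannot both be seen uniformly, and in the same way, from `B`. -/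
lemma eq_of_uniform {C : Finset (Face n)} (hC : IsMinimalCoboundary C)
    (hG : Cᶜ = oddFaces G) (hn : 12 ≤ n) (hcard : (Cᶜ.card : ℤ) ≤ n ^ 2) (hB : B.Nonempty)
    (h₁ : K₁ ∈ comps G B) (h₂ : K₂ ∈ comps G B)
    (hun : ∀ b ∈ B, ∀ u ∈ K₁, ∀ w ∈ K₂, (G.Adj b u ↔ G.Adj b w)) : K₁ = K₂ := by
  by_contra hne
  refine no_twin_sets hC hG hn hcard (comps_nonempty h₁) (comps_nonempty h₂) ?_ ?_ ?_ ?_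
  · rw [Finset.disjoint_left]
    exact fun u hu hu' => hne (eq_of_mem_comps h₁ h₂ hu hu')
  · obtain ⟨b, hb⟩ := hB
    exact ⟨b, fun h => notMem_of_mem_comps h₁ h hb, fun h => notMem_of_mem_comps h₂ h hb⟩
  · intro u hu w hw h
    exact hne (eq_of_mem_comps h₁ h₂ (mem_of_adj h₁ hu (notMem_of_mem_comps h₂ hw) h) hw)
  · intro z hz1 hz2 u hu w hw
    by_cases hzB : z ∈ B
    · exact hun z hzB u hu w hw
    · constructor
      · exact fun h => absurd (mem_of_adj h₁ hu hzB h.symm) hz1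
      · exact fun h => absurd (mem_of_adj h₂ hw hzB h.symm) hz2

/-- The bound on the number of components of `G - B`: those seen uniformly from `B` are determined
by their trace, and each of the others has two vertices and a neighbour in `B`. -/
lemma card_comps_le {C : Finset (Face n)} (hC : IsMinimalCoboundary C)
    (hG : Cᶜ = oddFaces G) (hn : 12 ≤ n) (hcard : (Cᶜ.card : ℤ) ≤ n ^ 2) (hB : B.Nonempty) :
    ∃ ν : ℕ, (comps G B).card ≤ ν + 2 ^ B.card ∧ (ν : ℤ) ≤ ∑ b ∈ B, vdeg G b ∧ 2 * ν ≤ n := by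
  classical
  set 𝒩 := (comps G B).filter fun K => ∃ b ∈ B, ∃ u ∈ K, ∃ w ∈ K, G.Adj b u ∧ ¬ G.Adj b w with h𝒩
  refine ⟨𝒩.card, ?_, ?_, ?_⟩
  · rw [← Finset.card_filter_add_card_filter_not (s := comps G B)
      (fun K => ∃ b ∈ B, ∃ u ∈ K, ∃ w ∈ K, G.Adj b u ∧ ¬ G.Adj b w)]
    refine Nat.add_le_add_left ?_ _
    rw [← Finset.card_powerset]
    refine Finset.card_le_card_of_injOn (fun K => B.filter fun b => ∃ u ∈ K, G.Adj b u) ?_ ?_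
    · intro K _
      simp only [Finset.coe_powerset, Set.mem_preimage, Set.mem_powerset_iff, Finset.coe_subset]
      exact Finset.filter_subset _ _
    · intro K₁ h₁ K₂ h₂ heq
      rw [Finset.mem_coe, Finset.mem_filter] at h₁ h₂
      have e1 := h₁.2
      have e2 := h₂.2
      push Not at e1 e2
      refine eq_of_uniform hC hG hn hcard hB h₁.1 h₂.1 fun b hb u hu w hw => ?_
      have heq' : (∃ u ∈ K₁, G.Adj b u) ↔ (∃ u ∈ K₂, G.Adj b u) := by
        have := Finset.ext_iff.1 heq b
        simpa [hb] using this
      constructor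
      · intro h
        obtain ⟨w', hw', h'⟩ := heq'.1 ⟨u, hu, h⟩
        exact e2 b hb w' hw' w hw h'
      · intro h
        obtain ⟨w', hw', h'⟩ := heq'.2 ⟨w, hw, h⟩
        exact e1 b hb w' hw' u hu h'
  · have h1 : (𝒩.card : ℤ) ≤ ∑ K ∈ 𝒩, ∑ u ∈ K, degIn G B u := by
      rw [Finset.card_eq_sum_ones]
      push_cast
      refine Finset.sum_le_sum fun K hK => ?_
      obtain ⟨hK, b, hb, u, hu, -, -, h, -⟩ := Finset.mem_filter.1 hK
      have e1 : 1 ≤ degIn G B u := by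
        have : adjInt G u b = 1 := by simp [adjInt, h.symm]
        rw [← this]
        exact Finset.single_le_sum (f := fun b => adjInt G u b) (fun _ _ => adjInt_nonneg _ _ _) hb
      exact e1.trans (Finset.single_le_sum (f := fun u => degIn G B u) (fun _ _ => degIn_nonneg) hu)
    have h2 : ∑ K ∈ 𝒩, ∑ u ∈ K, degIn G B u ≤ ∑ u ∈ Bᶜ, degIn G B u := by
      rw [← sum_comps (G := G)]
      exact Finset.sum_le_sum_of_subset_of_nonneg (Finset.filter_subset _ _)
        fun _ _ _ => Finset.sum_nonneg fun _ _ => degIn_nonneg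
    have h3 : ∑ u ∈ Bᶜ, degIn G B u ≤ ∑ b ∈ B, vdeg G b := by
      unfold degIn vdeg
      rw [Finset.sum_comm]
      refine Finset.sum_le_sum fun b _ => ?_
      simp only [adjInt_comm G b]
      exact Finset.sum_le_sum_of_subset_of_nonneg (Finset.subset_univ _)
        fun _ _ _ => adjInt_nonneg _ _ _
    linarith
  · have h1 : ∑ K ∈ 𝒩, 2 ≤ ∑ K ∈ 𝒩, K.card := by
      refine Finset.sum_le_sum fun K hK => ?_
      obtain ⟨hK, b, hb, u, hu, w, hw, h, h'⟩ := Finset.mem_filter.1 hK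
      exact Finset.one_lt_card.2 ⟨u, hu, w, hw, fun e => h' (e ▸ h)⟩
    have h2 : ∑ K ∈ 𝒩, K.card ≤ ∑ K ∈ comps G B, K.card :=
      Finset.sum_le_sum_of_subset (Finset.filter_subset _ _)
    have h3 : ∑ K ∈ comps G B, K.card = Bᶜ.card := by
      have := sum_comps (G := G) (B := B) (fun _ => 1)
      simpa using this
    have h4 : Bᶜ.card ≤ n := (Finset.card_le_univ _).trans_eq (Fintype.card_fin n)
    rw [Finset.sum_const, smul_eq_mul] at h1
    omega

/-- Few components of `G - B` force many edges outside `B`. -/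
lemma sum_vdeg_compl_ge {c : ℕ} (hc : (comps G B).card ≤ c) :
    2 * ((n : ℤ) - B.card - c) + ∑ b ∈ B, vdeg G b - B.card ^ 2 ≤ ∑ u ∈ Bᶜ, vdeg G u := by
  rw [← sum_comps (G := G), Finset.sum_congr rfl fun K hK => sum_vdeg_comp hK,
    Finset.sum_add_distrib, sum_comps]
  have h1 : ∑ K ∈ comps G B, 2 * ((K.card : ℤ) - 1) ≤ ∑ K ∈ comps G B, innerSum G K :=
    Finset.sum_le_sum fun K hK => le_innerSum hK
  have h2 : ∑ K ∈ comps G B, 2 * ((K.card : ℤ) - 1)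
      = 2 * ((n : ℤ) - B.card) - 2 * (comps G B).card := by
    have h3 : ∑ K ∈ comps G B, K.card = Bᶜ.card := by
      have := sum_comps (G := G) (B := B) (fun _ => 1)
      simpa using this
    have h4 : B.card + Bᶜ.card = n := by rw [Finset.card_add_card_compl, Fintype.card_fin]
    have h3' : ∑ K ∈ comps G B, (K.card : ℤ) = Bᶜ.card := by exact_mod_cast h3
    have h4' : (B.card : ℤ) + Bᶜ.card = n := by exact_mod_cast h4
    rw [← Finset.mul_sum, Finset.sum_sub_distrib, h3']
    simp
    linarith
  have h5 : ∑ b ∈ B, vdeg G b - B.card ^ 2 ≤ ∑ u ∈ Bᶜ, degIn G B u := by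
    have e1 : ∑ u ∈ Bᶜ, degIn G B u = ∑ b ∈ B, ∑ u ∈ Bᶜ, adjInt G b u := by
      unfold degIn
      rw [Finset.sum_comm]
      exact Finset.sum_congr rfl fun b _ => Finset.sum_congr rfl fun u _ => adjInt_comm _ _ _
    have e2 : ∀ b, vdeg G b = ∑ u ∈ B, adjInt G b u + ∑ u ∈ Bᶜ, adjInt G b u := by
      intro b
      rw [Finset.sum_add_sum_compl]; rfl
    have e3 : ∑ b ∈ B, ∑ u ∈ B, adjInt G b u ≤ B.card ^ 2 := by
      calc ∑ b ∈ B, ∑ u ∈ B, adjInt G b u ≤ ∑ b ∈ B, ∑ u ∈ B, 1 :=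
            Finset.sum_le_sum fun b _ => Finset.sum_le_sum fun u _ => adjInt_le_one _ _ _
        _ = B.card ^ 2 := by simp [sq]
    simp only [e2, Finset.sum_add_distrib, e1]
    linarith
  have h6 : ((comps G B).card : ℤ) ≤ c := by exact_mod_cast hc
  linarith

end Components

/-- A bound on the number of vertices of degree at least `n / 10000` in a graph with at most `9n/4`
edges, with one vertex added. -/
def largeVertexBound : ℕ := 45001

/-- The numerical core of `exists_center`. Here `D` is the sum of the large degrees, `M` the largest
one, `Y` the sum of the small degrees, `ν` a bound on the number of components, and `S₁`, `S₂` are the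
contributions of the large and the small degrees to the number of odd faces. The two bounds
`ν ≤ D` and `2 * ν ≤ n` give the upper bound on `D` and the lower bound on `M`. -/
lemma center_estimate {n D Y M ν S₁ S₂ : ℤ} (hn0 : 0 < n) (hD0 : 0 ≤ D) (hM0 : 0 ≤ M)
    (h2M : 2 * M ≤ n) (hνD : ν ≤ D) (hνn : 2 * ν ≤ n)
    (hY1 : 10000 * (2 * n - 2 * ν + D - Y) ≤ n) (hDY : 2 * (D + Y) ≤ 9 * n)
    (hS : 2 * (S₁ + S₂) ≤ 3 * n ^ 2) (hS₁ : D * (n - 2 * M) ≤ S₁)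
    (hS₂ : Y * (9998 * n) ≤ 10000 * S₂) : 1000 * D ≤ 501 * n ∧ 498 * n ≤ 1000 * M := by
  have main : 500 * n ^ 2 + 2000 * (D * (n - M)) ≤ 2000 * (ν * n) + n ^ 2 := by
    have e1 : n * (10000 * (2 * n - 2 * ν + D - Y)) ≤ n * n :=
      mul_le_mul_of_nonneg_left hY1 hn0.le
    have e2 : n * (2 * (D + Y)) ≤ n * (9 * n) := mul_le_mul_of_nonneg_left hDY hn0.le
    have e3 : 0 ≤ n * D := mul_nonneg hn0.le hD0
    linarith
  have hD1 : 1000 * D ≤ 501 * n := by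
    have e1 : 0 ≤ D * (n - 2 * M) := mul_nonneg hD0 (by linarith)
    have e2 : 2 * ν * n ≤ n * n := mul_le_mul_of_nonneg_right hνn hn0.le
    have e3 : n * (1000 * D) ≤ n * (501 * n) := by linarith
    exact le_of_mul_le_mul_left e3 hn0
  refine ⟨hD1, ?_⟩
  have e0 : ν * n ≤ D * n := mul_le_mul_of_nonneg_right hνD hn0.le
  have e2 : 1000 * D * M ≤ 501 * n * M := mul_le_mul_of_nonneg_right hD1 hM0
  have e3 : n * (499 * n) ≤ n * (1002 * M) := by linarith
  have e4 := le_of_mul_le_mul_left e3 hn0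
  linarith

/-- The coarse structure: the complement of a large hypercut is represented by a graph with one
vertex of degree almost `n/2`, all other degrees being small. -/
lemma exists_center {C : Finset (Face n)} {G : SimpleGraph (Fin n)} (hC : IsMinimalCoboundary C)
    (hG : Cᶜ = oddFaces G)
    (hn : 10000 * (2 * largeVertexBound + largeVertexBound ^ 2 + 2 * 2 ^ largeVertexBound) ≤ n)
    (hcard : 4 * (Cᶜ.card : ℤ) ≤ 3 * n ^ 2) (hdeg : ∀ u, 2 * vdeg G u ≤ n - 1)
    (hsum : n * ∑ u, vdeg G u ≤ 6 * (oddFaces G).card) :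
    ∃ x, 49 * (n : ℤ) ≤ 100 * vdeg G x ∧ ∀ u, u ≠ x → 200 * vdeg G u ≤ n := by
  classical
  obtain ⟨κ, hκ⟩ : ∃ κ : ℕ, κ = largeVertexBound := ⟨_, rfl⟩
  have hκ' : κ = 45001 := hκ
  rw [← hκ] at hn
  have hn12 : 12 ≤ n := by
    have : 0 < 2 ^ κ := by positivity
    nlinarith
  have hn0 : (0 : ℤ) < n := by exact_mod_cast (show 0 < n by omega)
  have : Nonempty (Fin n) := ⟨⟨0, by omega⟩⟩
  obtain ⟨x, hx⟩ := Finite.exists_max fun u => vdeg G u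
  -- `x` is inserted to make `B` nonempty before it is known that some degree is large
  set B : Finset (Fin n) := insert x (Finset.univ.filter fun u => (n : ℤ) ≤ 10000 * vdeg G u) with hB
  have hxB : x ∈ B := Finset.mem_insert_self _ _
  have hcard2 : (Cᶜ.card : ℤ) ≤ n ^ 2 := by nlinarith
  rw [← hG] at hsum
  have hD9 : 2 * ∑ u, vdeg G u ≤ 9 * n := by
    have : (n : ℤ) * (2 * ∑ u, vdeg G u) ≤ n * (9 * n) := by nlinarith
    exact le_of_mul_le_mul_left this hn0
  have hBκ : B.card ≤ κ := by
    have h1 : ∑ u ∈ Finset.univ.filter (fun u => (n : ℤ) ≤ 10000 * vdeg G u), (n : ℤ)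
        ≤ ∑ u, 10000 * vdeg G u :=
      (Finset.sum_le_sum fun u hu => (Finset.mem_filter.1 hu).2).trans
        (Finset.sum_le_sum_of_subset_of_nonneg (Finset.filter_subset _ _)
          fun u _ _ => mul_nonneg (by norm_num) (vdeg_nonneg _ _))
    rw [Finset.sum_const, nsmul_eq_mul, ← Finset.mul_sum] at h1
    set m := (Finset.univ.filter (fun u => (n : ℤ) ≤ 10000 * vdeg G u)).card with hm
    have h2 : (m : ℤ) * n ≤ 45000 * n := by linarith
    have h3 : (m : ℤ) ≤ 45000 := le_of_mul_le_mul_right h2 hn0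
    have h4 : B.card ≤ m + 1 := Finset.card_insert_le _ _
    omega
  obtain ⟨ν, hν1, hν2, hν3⟩ := card_comps_le hC hG hn12 hcard2 ⟨x, hxB⟩
  have hge := sum_vdeg_compl_ge (G := G) hν1
  set D := ∑ b ∈ B, vdeg G b with hD
  set Y := ∑ u ∈ Bᶜ, vdeg G u with hY
  set M := vdeg G x with hM
  have hM0 : 0 ≤ M := vdeg_nonneg _ _
  have hD0 : 0 ≤ D := Finset.sum_nonneg fun _ _ => vdeg_nonneg _ _
  have hDY : D + Y = ∑ u, vdeg G u := Finset.sum_add_sum_compl B (vdeg G)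
  have hpow : 2 ^ B.card ≤ 2 ^ κ := Nat.pow_le_pow_right (by norm_num) hBκ
  have hsq : B.card ^ 2 ≤ κ ^ 2 := Nat.pow_le_pow_left hBκ 2
  have hY1 : 10000 * (2 * (n : ℤ) - 2 * ν + D - Y) ≤ n := by
    have e1 : 10000 * (2 * (κ : ℤ) + κ ^ 2 + 2 * 2 ^ κ) ≤ n := by exact_mod_cast hn
    have e2 : ((2 ^ B.card : ℕ) : ℤ) ≤ 2 ^ κ := by exact_mod_cast hpow
    have e3 : (B.card : ℤ) ^ 2 ≤ κ ^ 2 := by exact_mod_cast hsq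
    have e4 : (B.card : ℤ) ≤ κ := by exact_mod_cast hBκ
    push_cast at hge e2
    linarith
  have h6 := six_mul_card_oddFaces_eq G
  have hT := triangleSum_nonneg G
  rw [← hG] at h6
  have hsplit : ∑ u, vdeg G u * (n - 2 * vdeg G u)
      = ∑ u ∈ B, vdeg G u * (n - 2 * vdeg G u) + ∑ u ∈ Bᶜ, vdeg G u * (n - 2 * vdeg G u) :=
    (Finset.sum_add_sum_compl B fun u => vdeg G u * (n - 2 * vdeg G u)).symm
  have hB1 : D * (n - 2 * M) ≤ ∑ u ∈ B, vdeg G u * (n - 2 * vdeg G u) := by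
    rw [hD, Finset.sum_mul]
    refine Finset.sum_le_sum fun u _ => mul_le_mul_of_nonneg_left ?_ (vdeg_nonneg _ _)
    have := hx u
    linarith
  have hB2 : Y * (9998 * n) ≤ 10000 * ∑ u ∈ Bᶜ, vdeg G u * (n - 2 * vdeg G u) := by
    rw [hY, Finset.sum_mul, Finset.mul_sum]
    refine Finset.sum_le_sum fun u hu => ?_
    have : ¬ ((n : ℤ) ≤ 10000 * vdeg G u) := by
      intro h
      apply Finset.mem_compl.1 hu
      rw [hB]
      exact Finset.mem_insert_of_mem (by simpa using h)
    have h' : 9998 * (n : ℤ) ≤ 10000 * (n - 2 * vdeg G u) := by linarith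
    have := mul_le_mul_of_nonneg_left h' (vdeg_nonneg G u)
    linarith
  have h2M : 2 * M ≤ n := by have := hdeg x; linarith
  have hν3' : 2 * (ν : ℤ) ≤ n := by exact_mod_cast hν3
  rw [hsplit] at h6
  have hDY9 : 2 * (D + Y) ≤ 9 * n := by rw [hDY]; exact hD9
  obtain ⟨hD1, hM1⟩ := center_estimate hn0 hD0 hM0 h2M hν2 hν3' hY1 hDY9 (by linarith) hB1 hB2
  refine ⟨x, by linarith, fun u hu => ?_⟩
  by_cases huB : u ∈ B
  · have : vdeg G u + vdeg G x ≤ D := by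
      rw [hD, ← Finset.sum_pair hu]
      exact Finset.sum_le_sum_of_subset_of_nonneg
        (Finset.insert_subset huB (Finset.singleton_subset_iff.2 hxB)) fun _ _ _ => vdeg_nonneg _ _
    linarith
  · have : ¬ ((n : ℤ) ≤ 10000 * vdeg G u) := by
      intro h
      apply huB
      rw [hB]
      exact Finset.mem_insert_of_mem (by simpa using h)
    have := vdeg_nonneg G u
    linarith

/-! ### Excess of the components at the centre -/

/-- `K` is a leg at `x`: a path with `ℓ` vertices, exactly the first of which is adjacent to `x`. -/
def IsLeg (G : SimpleGraph (Fin n)) (x : Fin n) (K : Finset (Fin n)) (ℓ : ℕ) : Prop :=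
  ∃ g : Fin ℓ → Fin n, Function.Injective g ∧ (∀ u, u ∈ K ↔ ∃ j, g j = u) ∧
    (∀ j, G.Adj x (g j) ↔ j.val = 0) ∧
    ∀ j j', G.Adj (g j) (g j') ↔ j'.val = j.val + 1 ∨ j.val = j'.val + 1

/-- The contribution of a component of `G - x` to the number of odd faces, normalised so that it
vanishes on legs of length `2`. -/
noncomputable def excess (G : SimpleGraph (Fin n)) (x : Fin n) (K : Finset (Fin n)) : ℤ :=
  2 * ∑ u ∈ K, vdeg G u * (n - 2 * vdeg G u)
    + 2 * vdeg G x * (K.card - 2 * ∑ u ∈ K, adjInt G u x) - (3 * n - 10) * K.card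

section Excess

variable {G : SimpleGraph (Fin n)} {x : Fin n} {K : Finset (Fin n)}

lemma degIn_singleton (u : Fin n) : degIn G {x} u = adjInt G u x := by simp [degIn]

lemma sum_adjInt_center (G : SimpleGraph (Fin n)) (x : Fin n) :
    ∑ K ∈ comps G {x}, ∑ u ∈ K, adjInt G u x = vdeg G x := by
  rw [sum_comps, vdeg, ← Finset.sum_add_sum_compl {x}]
  simp only [Finset.sum_singleton, adjInt_self, zero_add]
  exact Finset.sum_congr rfl fun u _ => adjInt_comm _ _ _

lemma sum_card_comps (G : SimpleGraph (Fin n)) (x : Fin n) :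
    ∑ K ∈ comps G {x}, (K.card : ℤ) = n - 1 := by
  have h3 : ∑ K ∈ comps G {x}, K.card = ({x} : Finset (Fin n))ᶜ.card := by
    have := sum_comps (G := G) (B := {x}) (fun _ => 1)
    simpa using this
  have h4 : ({x} : Finset (Fin n)).card + ({x} : Finset (Fin n))ᶜ.card = n := by
    rw [Finset.card_add_card_compl, Fintype.card_fin]
  rw [Finset.card_singleton] at h4
  have : (1 : ℤ) + ({x} : Finset (Fin n))ᶜ.card = n := by exact_mod_cast h4
  rw [← Nat.cast_sum, h3]
  linarith

/-- The count of odd faces, organised by the components of `G - x`. -/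
lemma sum_excess (G : SimpleGraph (Fin n)) (x : Fin n) :
    2 * ∑ u, vdeg G u * (n - 2 * vdeg G u)
      = 2 * vdeg G x + (3 * n - 10) * (n - 1) + ∑ K ∈ comps G {x}, excess G x K := by
  have e1 := sum_adjInt_center G x
  have e2 := sum_card_comps G x
  have e3 := sum_comps (G := G) (B := {x}) fun u => vdeg G u * (n - 2 * vdeg G u)
  have e4 : ∑ u, vdeg G u * (n - 2 * vdeg G u) = vdeg G x * (n - 2 * vdeg G x)
      + ∑ u ∈ ({x} : Finset (Fin n))ᶜ, vdeg G u * (n - 2 * vdeg G u) := by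
    rw [← Finset.sum_add_sum_compl {x}, Finset.sum_singleton]
  have e5 : ∑ K ∈ comps G {x}, excess G x K
      = 2 * ∑ K ∈ comps G {x}, ∑ u ∈ K, vdeg G u * (n - 2 * vdeg G u)
        + 2 * vdeg G x * (∑ K ∈ comps G {x}, (K.card : ℤ)
          - 2 * ∑ K ∈ comps G {x}, ∑ u ∈ K, adjInt G u x)
        - (3 * n - 10) * ∑ K ∈ comps G {x}, (K.card : ℤ) := by
    unfold excess
    rw [Finset.sum_sub_distrib, Finset.sum_add_distrib, ← Finset.mul_sum, ← Finset.mul_sum,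
      ← Finset.mul_sum, Finset.sum_sub_distrib, ← Finset.mul_sum]
  rw [e5, e4, e3, e1, e2]
  ring

lemma sum_adjInt_nonneg : 0 ≤ ∑ u ∈ K, adjInt G u x :=
  Finset.sum_nonneg fun _ _ => adjInt_nonneg _ _ _

lemma sum_adjInt_le : ∑ u ∈ K, adjInt G u x ≤ K.card := by
  calc ∑ u ∈ K, adjInt G u x ≤ ∑ u ∈ K, 1 := Finset.sum_le_sum fun _ _ => adjInt_le_one _ _ _
    _ = K.card := by simp

/-- The lower bound on the excess from the smallness of the degrees in `K`. -/
lemma excess_ge (hK : K ∈ comps G {x}) (hd : 49 * (n : ℤ) ≤ 100 * vdeg G x)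
    (hd' : 2 * vdeg G x ≤ n - 1) (hsmall : ∀ u, u ≠ x → 200 * vdeg G u ≤ n) :
    n * (198 * innerSum G K - 204 * K.card) ≤ 100 * excess G x K := by
  set a := ∑ u ∈ K, adjInt G u x with ha
  set d := vdeg G x with hdd
  have ha0 : 0 ≤ a := sum_adjInt_nonneg
  have hak : a ≤ K.card := sum_adjInt_le
  have hn : (0 : ℤ) ≤ n := by positivity
  have hW : 99 * n * (innerSum G K + a) ≤ 100 * ∑ u ∈ K, vdeg G u * (n - 2 * vdeg G u) := by
    have := sum_vdeg_comp hK
    simp only [degIn_singleton] at this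
    rw [← this, Finset.mul_sum, Finset.mul_sum]
    refine Finset.sum_le_sum fun u hu => ?_
    have hux : u ≠ x := by simpa using notMem_of_mem_comps hK hu
    have h1 : 99 * (n : ℤ) ≤ 100 * (n - 2 * vdeg G u) := by linarith [hsmall u hux]
    have := mul_le_mul_of_nonneg_right h1 (vdeg_nonneg G u)
    linarith
  have ht : (100 * n - 2 * n) * (K.card : ℤ) - 200 * n * a ≤ 200 * d * (K.card - 2 * a) := by
    have h1 : 0 ≤ (200 * d - 98 * n) * (K.card : ℤ) := mul_nonneg (by linarith) (by positivity)
    have h2 : 0 ≤ (100 * n - 200 * d) * (2 * a) := mul_nonneg (by linarith) (by linarith)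
    linarith
  have h3 : (n : ℤ) * a ≤ n * K.card := mul_le_mul_of_nonneg_left hak hn
  unfold excess
  rw [← ha, ← hdd]
  have h4 : (0 : ℤ) ≤ K.card := by positivity
  linarith

lemma exists_eq_of_card_one (hK : K ∈ comps G {x}) (h : K.card = 1) :
    ∃ u, K = {u} ∧ u ≠ x ∧ vdeg G u = adjInt G u x := by
  obtain ⟨u, rfl⟩ := Finset.card_eq_one.1 h
  refine ⟨u, rfl, by simpa using notMem_of_mem_comps hK (Finset.mem_singleton_self u), ?_⟩
  rw [vdeg_eq_add hK (Finset.mem_singleton_self u), degIn_singleton]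
  simp [adjInt_self]

lemma exists_eq_of_card_two (hK : K ∈ comps G {x}) (h : K.card = 2) :
    ∃ u w, u ≠ w ∧ K = {u, w} ∧ G.Adj u w ∧ vdeg G u = 1 + adjInt G u x ∧
      vdeg G w = 1 + adjInt G w x := by
  obtain ⟨u, w, huw, rfl⟩ := Finset.card_eq_two.1 h
  have hadj : G.Adj u w := by
    by_contra hno
    have := le_innerSum hK
    rw [h, innerSum, Finset.sum_pair huw, Finset.sum_pair huw, Finset.sum_pair huw, adjInt_self,
      adjInt_self, adjInt_comm G w u, adjInt_of_not_adj hno] at this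
    norm_num at this
  refine ⟨u, w, huw, rfl, hadj, ?_, ?_⟩
  · rw [vdeg_eq_add hK (by simp), degIn_singleton, Finset.sum_pair huw, adjInt_self,
      adjInt_of_adj hadj, zero_add]
  · rw [vdeg_eq_add hK (by simp), degIn_singleton, Finset.sum_pair huw, adjInt_self,
      adjInt_of_adj hadj.symm, add_zero]

lemma excess_nonadj_one (hK : K ∈ comps G {x}) (h : K.card = 1) (h0 : ∀ u ∈ K, ¬ G.Adj x u) :
    excess G x K = 2 * vdeg G x - 3 * n + 10 := by
  obtain ⟨u, rfl, -, hu⟩ := exists_eq_of_card_one hK h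
  have hux : adjInt G u x = 0 :=
    adjInt_of_not_adj fun h => h0 u (Finset.mem_singleton_self u) h.symm
  unfold excess
  rw [Finset.sum_singleton, Finset.sum_singleton, hu, hux, Finset.card_singleton]
  push_cast
  ring

lemma excess_adj_one (hK : K ∈ comps G {x}) (h : K.card = 1) (h1 : ∀ u ∈ K, G.Adj x u) :
    excess G x K = -n + 6 - 2 * vdeg G x := by
  obtain ⟨u, rfl, -, hu⟩ := exists_eq_of_card_one hK h
  have hux : adjInt G u x = 1 :=
    adjInt_of_adj (h1 u (Finset.mem_singleton_self u)).symm
  unfold excess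
  rw [Finset.sum_singleton, Finset.sum_singleton, hu, hux, Finset.card_singleton]
  push_cast
  ring

lemma excess_two (hK : K ∈ comps G {x}) (h : K.card = 2) :
    ∃ p q : ℤ, (∑ u ∈ K, adjInt G u x = p + q) ∧ (p = 0 ∨ p = 1) ∧ (q = 0 ∨ q = 1) ∧
      excess G x K = 2 * ((1 + p) * (n - 2 * (1 + p)) + (1 + q) * (n - 2 * (1 + q)))
        + 2 * vdeg G x * (2 - 2 * (p + q)) - (3 * n - 10) * 2 := by
  obtain ⟨u, w, huw, rfl, -, hu, hw⟩ := exists_eq_of_card_two hK h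
  have e : ∀ z, adjInt G z x = 0 ∨ adjInt G z x = 1 := by
    intro z; unfold adjInt; split_ifs <;> simp
  refine ⟨adjInt G u x, adjInt G w x, Finset.sum_pair huw, e u, e w, ?_⟩
  unfold excess
  rw [Finset.sum_pair huw, Finset.sum_pair huw, hu, hw, h]
  push_cast
  ring

lemma sum_adjInt_eq_zero (h0 : ∀ u ∈ K, ¬ G.Adj x u) : ∑ u ∈ K, adjInt G u x = 0 :=
  Finset.sum_eq_zero fun u hu => adjInt_of_not_adj fun h => h0 u hu h.symm

lemma sum_adjInt_eq_card (h1 : ∀ u ∈ K, G.Adj x u) : ∑ u ∈ K, adjInt G u x = K.card := by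
  rw [Finset.sum_congr rfl fun u hu => adjInt_of_adj (h1 u hu).symm]
  simp

/-- A component of `G - x` containing both a neighbour and a non-neighbour of `x`. -/
def IsMixed (G : SimpleGraph (Fin n)) (x : Fin n) (K : Finset (Fin n)) : Prop :=
  (∃ u ∈ K, G.Adj x u) ∧ ∃ w ∈ K, ¬ G.Adj x w

lemma IsMixed.two_le_card (h : IsMixed G x K) : 2 ≤ K.card := by
  obtain ⟨⟨u, hu, h1⟩, w, hw, h2⟩ := h
  exact Finset.one_lt_card.2 ⟨u, hu, w, hw, fun e => h2 (e ▸ h1)⟩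

lemma IsMixed.sum_adjInt (h : IsMixed G x K) :
    1 ≤ ∑ u ∈ K, adjInt G u x ∧ ∑ u ∈ K, adjInt G u x + 1 ≤ K.card := by
  obtain ⟨⟨u, hu, h1⟩, w, hw, h2⟩ := h
  constructor
  · rw [← adjInt_of_adj h1.symm]
    exact Finset.single_le_sum (f := fun u => adjInt G u x) (fun _ _ => adjInt_nonneg _ _ _) hu
  · have e1 : ∑ u ∈ K, (1 - adjInt G u x) = K.card - ∑ u ∈ K, adjInt G u x := by
      rw [Finset.sum_sub_distrib]; simp
    have e2 : 1 - adjInt G w x ≤ ∑ u ∈ K, (1 - adjInt G u x) :=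
      Finset.single_le_sum (f := fun u => 1 - adjInt G u x)
        (fun u _ => by have := adjInt_le_one G u x; linarith) hw
    rw [adjInt_of_not_adj fun h => h2 h.symm, e1] at e2
    linarith

lemma IsMixed.excess_two (h : IsMixed G x K) (hK : K ∈ comps G {x}) (h2 : K.card = 2) :
    excess G x K = 0 ∧ ∑ u ∈ K, adjInt G u x = 1 := by
  obtain ⟨p, q, hsum, hp, hq, he⟩ := SimplicialCut.excess_two hK h2
  have := h.sum_adjInt
  rw [h2, hsum] at this
  rw [he, hsum]
  push_cast at this
  rcases hp with rfl | rfl <;> rcases hq with rfl | rfl <;>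
    first | (exfalso; omega) | exact ⟨by ring, by norm_num⟩

lemma IsMixed.isLeg_two (h : IsMixed G x K) (hK : K ∈ comps G {x}) (h2 : K.card = 2) :
    IsLeg G x K 2 := by
  obtain ⟨u, w, huw, rfl, hadj, -, -⟩ := exists_eq_of_card_two hK h2
  have key : ∀ u w : Fin n, u ≠ w → G.Adj u w → G.Adj x u → ¬ G.Adj x w →
      IsLeg G x {u, w} 2 := by
    intro u w huw hadj h1 h2
    refine ⟨![u, w], ?_, ?_, ?_, ?_⟩
    · intro i j; fin_cases i <;> fin_cases j <;> simp [huw, huw.symm]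
    · intro z; simp [Fin.exists_fin_two, eq_comm]
    · intro j; fin_cases j <;> simp [h1, h2]
    · intro i j; fin_cases i <;> fin_cases j <;> simp [hadj, hadj.symm]
  obtain ⟨⟨a, ha, h1⟩, b, hb, h3⟩ := h
  simp only [Finset.mem_insert, Finset.mem_singleton] at ha hb
  rcases ha with rfl | rfl <;> rcases hb with rfl | rfl
  · exact absurd h1 h3
  · exact key _ _ huw hadj h1 h3
  · rw [Finset.pair_comm]; exact key _ _ huw.symm hadj.symm h1 h3
  · exact absurd h1 h3

lemma isLeg_one (hK : K ∈ comps G {x}) (h : K.card = 1) (h1 : ∀ u ∈ K, G.Adj x u) :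
    IsLeg G x K 1 := by
  obtain ⟨u, rfl, -, -⟩ := exists_eq_of_card_one hK h
  refine ⟨![u], Function.injective_of_subsingleton _, ?_, ?_, ?_⟩
  · intro z; simp [eq_comm]
  · intro j; fin_cases j; simpa using h1
  · intro i j; fin_cases i; fin_cases j; simp

/-- A path on three vertices with one neighbour of `x` is attached to `x` by an end vertex: were it
attached by its middle vertex, the two other vertices would be twins. -/
lemma isLeg_three {C : Finset (Face n)} (hC : IsMinimalCoboundary C)
    (hG : Cᶜ = oddFaces G) (hn : 12 ≤ n) (hcard : (Cᶜ.card : ℤ) ≤ n ^ 2)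
    (hK : K ∈ comps G {x}) (h : K.card = 3) (hS : innerSum G K = 4)
    (ha : ∑ u ∈ K, adjInt G u x = 1) : IsLeg G x K 3 := by
  have key : ∀ p q r : Fin n, p ≠ q → p ≠ r → q ≠ r → K = {p, q, r} → G.Adj p q → G.Adj q r →
      ¬ G.Adj p r → IsLeg G x K 3 := by
    have key2 : ∀ p q r : Fin n, p ≠ q → p ≠ r → q ≠ r → K = {p, q, r} → G.Adj p q →
        G.Adj q r → ¬ G.Adj p r → G.Adj x p → ¬ G.Adj x q → ¬ G.Adj x r → IsLeg G x K 3 := by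
      rintro p q r hpq hpr hqr rfl h1 h2 h3 h4 h5 h6
      refine ⟨![p, q, r], ?_, ?_, ?_, ?_⟩
      · intro i j
        fin_cases i <;> fin_cases j <;> simp [hpq, hpq.symm, hpr, hpr.symm, hqr, hqr.symm]
      · intro z; simp [Fin.exists_fin_succ, eq_comm]
      · intro j; fin_cases j <;> simp [h4, h5, h6]
      · have h3' : ¬ G.Adj r p := fun h => h3 h.symm
        intro i j
        fin_cases i <;> fin_cases j <;> simp [h1, h1.symm, h2, h2.symm, h3, h3']
    intro p q r hpq hpr hqr hKe h1 h2 h3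
    have ha' := ha
    rw [hKe, Finset.sum_insert (by simp [hpq, hpr]), Finset.sum_pair hqr] at ha'
    by_cases xp : G.Adj x p <;> by_cases xq : G.Adj x q <;> by_cases xr : G.Adj x r <;>
      simp [adjInt, G.adj_comm _ x, xp, xq, xr] at ha'
    · exact key2 p q r hpq hpr hqr hKe h1 h2 h3 xp xq xr
    · exfalso
      have hp : p ∈ K := by simp [hKe]
      have hr : r ∈ K := by simp [hKe]
      refine no_twin_sets (K₁ := {p}) (K₂ := {r}) hC hG hn hcard (Finset.singleton_nonempty p)
        (Finset.singleton_nonempty r) (by simp [hpr]) ⟨q, by simpa using hpq.symm, by simpa using hqr⟩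
        (by simpa using h3) ?_
      intro z hzp hzr u hu w hw
      rw [Finset.mem_singleton] at hu hw
      subst hu hw
      by_cases hzx : z = x
      · subst hzx; simp [xp, xr]
      by_cases hzq : z = q
      · subst hzq; simp [h1.symm, h2]
      have hzK : z ∉ K := by
        rw [hKe]
        simp only [Finset.mem_insert, Finset.mem_singleton] at hzp hzr ⊢
        tauto
      have hzx' : z ∉ ({x} : Finset (Fin n)) := by simpa using hzx
      exact ⟨fun h => absurd (mem_of_adj hK hp hzx' h.symm) hzK,
        fun h => absurd (mem_of_adj hK hr hzx' h.symm) hzK⟩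
    · refine key2 r q p hqr.symm hpr.symm hpq.symm ?_ h2.symm h1.symm (fun h => h3 h.symm) xr xq xp
      rw [hKe]; ext z; simp only [Finset.mem_insert, Finset.mem_singleton]; tauto
  obtain ⟨p, q, r, hpq, hpr, hqr, hKe⟩ := Finset.card_eq_three.1 h
  have hS' := hS
  have e : ∀ f : Fin n → ℤ, ∑ u ∈ K, f u = f p + (f q + f r) := by
    intro f
    rw [hKe, Finset.sum_insert (by simp [hpq, hpr]), Finset.sum_pair hqr]
  simp only [innerSum, e, adjInt_self] at hS'
  by_cases pq : G.Adj p q <;> by_cases pr : G.Adj p r <;> by_cases qr : G.Adj q r <;>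
    simp [adjInt, G.adj_comm q p, G.adj_comm r p, G.adj_comm r q, pq, pr, qr] at hS'
  · refine key q p r hpq.symm hqr hpr ?_ pq.symm pr qr
    rw [hKe]; ext z; simp only [Finset.mem_insert, Finset.mem_singleton]; tauto
  · exact key p q r hpq hpr hqr hKe pq qr pr
  · refine key p r q hpr hpq hqr.symm ?_ pr qr.symm pq
    rw [hKe]; ext z; simp only [Finset.mem_insert, Finset.mem_singleton]; tauto

end Excess

/-! ### Fine structure around the centre -/

section Structure

variable {G : SimpleGraph (Fin n)} {x : Fin n}

open Classical in
/-- The components of `G - x` with no neighbour of `x`. -/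
noncomputable def farComps (G : SimpleGraph (Fin n)) (x : Fin n) : Finset (Finset (Fin n)) :=
  (comps G {x}).filter fun K => ∀ u ∈ K, ¬ G.Adj x u

open Classical in
/-- The components of `G - x` consisting of neighbours of `x`. -/
noncomputable def nearComps (G : SimpleGraph (Fin n)) (x : Fin n) : Finset (Finset (Fin n)) :=
  (comps G {x}).filter fun K => ∀ u ∈ K, G.Adj x u

open Classical in
/-- The components of `G - x` with both neighbours and non-neighbours of `x`. -/
noncomputable def mixedComps (G : SimpleGraph (Fin n)) (x : Fin n) : Finset (Finset (Fin n)) :=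
  (comps G {x}).filter fun K => IsMixed G x K

lemma mem_farComps {K} : K ∈ farComps G x ↔ K ∈ comps G {x} ∧ ∀ u ∈ K, ¬ G.Adj x u := by
  simp [farComps]

lemma mem_nearComps {K} : K ∈ nearComps G x ↔ K ∈ comps G {x} ∧ ∀ u ∈ K, G.Adj x u := by
  simp [nearComps]

lemma mem_mixedComps {K} : K ∈ mixedComps G x ↔ K ∈ comps G {x} ∧ IsMixed G x K := by
  simp [mixedComps]

lemma sum_comps_split (f : Finset (Fin n) → ℤ) :
    ∑ K ∈ comps G {x}, f K = ∑ K ∈ farComps G x, f K + ∑ K ∈ nearComps G x, f K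
      + ∑ K ∈ mixedComps G x, f K := by
  classical
  simp only [farComps, nearComps, mixedComps, Finset.sum_filter, ← Finset.sum_add_distrib]
  refine Finset.sum_congr rfl fun K hK => ?_
  obtain ⟨u, hu⟩ := comps_nonempty hK
  by_cases h0 : ∀ u ∈ K, ¬ G.Adj x u
  · have h1 : ¬ ∀ u ∈ K, G.Adj x u := fun h => h0 u hu (h u hu)
    have h2 : ¬ IsMixed G x K := fun ⟨⟨w, hw, h⟩, _⟩ => h0 w hw h
    rw [if_pos h0, if_neg h1, if_neg h2]; ring
  · by_cases h1 : ∀ u ∈ K, G.Adj x u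
    · have h2 : ¬ IsMixed G x K := fun ⟨_, w, hw, h⟩ => h (h1 w hw)
      rw [if_neg h0, if_pos h1, if_neg h2]; ring
    · have h2 : IsMixed G x K := by
        push Not at h0 h1
        exact ⟨h0, h1⟩
      rw [if_neg h0, if_neg h1, if_pos h2]; ring

lemma mem_comps_cases {K} (hK : K ∈ comps G {x}) :
    K ∈ farComps G x ∨ K ∈ nearComps G x ∨ K ∈ mixedComps G x := by
  rw [mem_farComps, mem_nearComps, mem_mixedComps]
  by_cases h0 : ∀ u ∈ K, ¬ G.Adj x u
  · exact Or.inl ⟨hK, h0⟩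
  · by_cases h1 : ∀ u ∈ K, G.Adj x u
    · exact Or.inr (Or.inl ⟨hK, h1⟩)
    · push Not at h0 h1
      exact Or.inr (Or.inr ⟨hK, h0, h1⟩)

/-- The vertex surplus of a component over twice its number of neighbours of the centre. -/
noncomputable def surplus (G : SimpleGraph (Fin n)) (x : Fin n) (K : Finset (Fin n)) : ℤ :=
  K.card - 2 * ∑ u ∈ K, adjInt G u x

lemma sum_surplus (G : SimpleGraph (Fin n)) (x : Fin n) :
    ∑ K ∈ comps G {x}, surplus G x K = n - 1 - 2 * vdeg G x := by
  unfold surplus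
  rw [Finset.sum_sub_distrib, ← Finset.mul_sum, sum_adjInt_center, sum_card_comps]

lemma eq_empty_or_singleton_of_subsingleton {α : Type*} {s : Finset α}
    (h : ∀ a ∈ s, ∀ b ∈ s, a = b) : s = ∅ ∨ ∃ a, s = {a} := by
  rcases s.eq_empty_or_nonempty with h0 | ⟨a, ha⟩
  · exact Or.inl h0
  · exact Or.inr ⟨a, Finset.eq_singleton_iff_unique_mem.2 ⟨ha, fun b hb => h b hb a ha⟩⟩

/-- The estimate `excess_ge` for `3` vertices and a tree. -/
lemma nine_mul_le_excess {K} (hK : K ∈ comps G {x}) (hd : 49 * (n : ℤ) ≤ 100 * vdeg G x)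
    (hd' : 2 * vdeg G x ≤ n - 1) (hsmall : ∀ u, u ≠ x → 200 * vdeg G u ≤ n) (h3 : 3 ≤ K.card) :
    9 * (n : ℤ) ≤ 5 * excess G x K := by
  have h1 := excess_ge hK hd hd' hsmall
  have h2 := le_innerSum hK
  have h3' : (3 : ℤ) ≤ K.card := by exact_mod_cast h3
  have h4 : (n : ℤ) * 180 ≤ n * (198 * innerSum G K - 204 * K.card) :=
    mul_le_mul_of_nonneg_left (by linarith) (by positivity)
  linarith

/-- A further vertex or edge doubles the bound of `nine_mul_le_excess`. -/
lemma eighteen_mul_le_excess {K} (hK : K ∈ comps G {x}) (hd : 49 * (n : ℤ) ≤ 100 * vdeg G x)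
    (hd' : 2 * vdeg G x ≤ n - 1) (hsmall : ∀ u, u ≠ x → 200 * vdeg G u ≤ n) (h3 : 3 ≤ K.card)
    (h : ¬ (K.card = 3 ∧ innerSum G K = 4)) : 18 * (n : ℤ) ≤ 5 * excess G x K := by
  have h1 := excess_ge hK hd hd' hsmall
  have h2 := le_innerSum hK
  have h360 : 360 ≤ 198 * innerSum G K - 204 * (K.card : ℤ) := by
    by_cases hc : K.card = 3
    · obtain ⟨m, hm⟩ := even_innerSum G K
      rw [hc] at h2 ⊢
      have : innerSum G K ≠ 4 := fun h' => h ⟨hc, h'⟩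
      push_cast at h2 ⊢
      omega
    · have : (4 : ℤ) ≤ K.card := by
        have : 4 ≤ K.card := by omega
        exact_mod_cast this
      linarith
  have h4 : (n : ℤ) * 360 ≤ n * (198 * innerSum G K - 204 * K.card) :=
    mul_le_mul_of_nonneg_left h360 (by positivity)
  linarith

/-- There is at most one component without neighbours of `x`; its size determines its excess unless
that excess is large. -/
lemma farComps_cases {C : Finset (Face n)} (hC : IsMinimalCoboundary C)
    (hG : Cᶜ = oddFaces G) (hn : 12 ≤ n) (hcard : (Cᶜ.card : ℤ) ≤ n ^ 2)
    (hd : 49 * (n : ℤ) ≤ 100 * vdeg G x)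
    (hd' : 2 * vdeg G x ≤ n - 1) (hsmall : ∀ u, u ≠ x → 200 * vdeg G u ≤ n) :
    (∑ K ∈ farComps G x, excess G x K = 0 ∧ ∑ K ∈ farComps G x, surplus G x K = 0) ∨
    ((∃ v, farComps G x = {{v}}) ∧ ∑ K ∈ farComps G x, excess G x K = 2 * vdeg G x - 3 * n + 10 ∧
      ∑ K ∈ farComps G x, surplus G x K = 1) ∨
    (∑ K ∈ farComps G x, excess G x K = 4 * vdeg G x - 2 * n + 12 ∧
      ∑ K ∈ farComps G x, surplus G x K = 2) ∨
    9 * (n : ℤ) ≤ 5 * ∑ K ∈ farComps G x, excess G x K := by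
  have hsub : ∀ K₁ ∈ farComps G x, ∀ K₂ ∈ farComps G x, K₁ = K₂ := by
    intro K₁ h₁ K₂ h₂
    rw [mem_farComps] at h₁ h₂
    refine eq_of_uniform hC hG hn hcard (Finset.singleton_nonempty x) h₁.1 h₂.1 ?_
    intro b hb u hu w hw
    rw [Finset.mem_singleton.1 hb]
    exact iff_of_false (h₁.2 u hu) (h₂.2 w hw)
  rcases eq_empty_or_singleton_of_subsingleton hsub with h | ⟨K, h⟩
  · left; simp [h]
  right
  obtain ⟨hK, h0⟩ := mem_farComps.1 (h ▸ Finset.mem_singleton_self K)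
  rw [h, Finset.sum_singleton, Finset.sum_singleton, surplus, sum_adjInt_eq_zero h0]
  have hpos := (comps_nonempty hK).card_pos
  by_cases hc3 : 3 ≤ K.card
  · exact Or.inr (Or.inr (nine_mul_le_excess hK hd hd' hsmall hc3))
  obtain hc | hc : K.card = 1 ∨ K.card = 2 := by omega
  · left
    refine ⟨?_, excess_nonadj_one hK hc h0, by rw [hc]; norm_num⟩
    obtain ⟨v, rfl⟩ := Finset.card_eq_one.1 hc
    exact ⟨v, rfl⟩
  · right; left
    obtain ⟨p, q, hs, hp, hq, he⟩ := excess_two hK hc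
    rw [sum_adjInt_eq_zero h0] at hs
    have hp0 : p = 0 := by omega
    have hq0 : q = 0 := by omega
    subst hp0 hq0
    refine ⟨by rw [he]; ring, by rw [hc]; norm_num⟩

/-- There is at most one component consisting of neighbours of `x`; its size determines its excess
unless that excess is large. -/
lemma nearComps_cases {C : Finset (Face n)} (hC : IsMinimalCoboundary C)
    (hG : Cᶜ = oddFaces G) (hn : 12 ≤ n) (hcard : (Cᶜ.card : ℤ) ≤ n ^ 2)
    (hd : 49 * (n : ℤ) ≤ 100 * vdeg G x)
    (hd' : 2 * vdeg G x ≤ n - 1) (hsmall : ∀ u, u ≠ x → 200 * vdeg G u ≤ n) :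
    (nearComps G x = ∅ ∧
      ∑ K ∈ nearComps G x, excess G x K = 0 ∧ ∑ K ∈ nearComps G x, surplus G x K = 0) ∨
    ((∃ v, nearComps G x = {{v}}) ∧ ∑ K ∈ nearComps G x, excess G x K = -n + 6 - 2 * vdeg G x ∧
      ∑ K ∈ nearComps G x, surplus G x K = -1) ∨
    (∑ K ∈ nearComps G x, excess G x K = 2 * n - 12 - 4 * vdeg G x ∧
      ∑ K ∈ nearComps G x, surplus G x K = -2) ∨
    9 * (n : ℤ) ≤ 5 * ∑ K ∈ nearComps G x, excess G x K := by
  have hsub : ∀ K₁ ∈ nearComps G x, ∀ K₂ ∈ nearComps G x, K₁ = K₂ := by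
    intro K₁ h₁ K₂ h₂
    rw [mem_nearComps] at h₁ h₂
    refine eq_of_uniform hC hG hn hcard (Finset.singleton_nonempty x) h₁.1 h₂.1 ?_
    intro b hb u hu w hw
    rw [Finset.mem_singleton.1 hb]
    exact iff_of_true (h₁.2 u hu) (h₂.2 w hw)
  rcases eq_empty_or_singleton_of_subsingleton hsub with h | ⟨K, h⟩
  · left; simp [h]
  right
  obtain ⟨hK, h1⟩ := mem_nearComps.1 (h ▸ Finset.mem_singleton_self K)
  rw [h, Finset.sum_singleton, Finset.sum_singleton, surplus, sum_adjInt_eq_card h1]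
  have hpos := (comps_nonempty hK).card_pos
  by_cases hc3 : 3 ≤ K.card
  · exact Or.inr (Or.inr (nine_mul_le_excess hK hd hd' hsmall hc3))
  obtain hc | hc : K.card = 1 ∨ K.card = 2 := by omega
  · left
    refine ⟨?_, excess_adj_one hK hc h1, by rw [hc]; norm_num⟩
    obtain ⟨v, rfl⟩ := Finset.card_eq_one.1 hc
    exact ⟨v, rfl⟩
  · right; left
    obtain ⟨p, q, hs, hp, hq, he⟩ := excess_two hK hc
    rw [sum_adjInt_eq_card h1, hc] at hs
    push_cast at hs
    have hp0 : p = 1 := by omega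
    have hq0 : q = 1 := by omega
    subst hp0 hq0
    refine ⟨by rw [he]; ring, by rw [hc]; norm_num⟩

/-- The mixed components all have two vertices, or exactly one exception is a path on three vertices,
or their total excess is too large for an extremal graph. -/
lemma mixedComps_cases (hd : 49 * (n : ℤ) ≤ 100 * vdeg G x)
    (hd' : 2 * vdeg G x ≤ n - 1) (hsmall : ∀ u, u ≠ x → 200 * vdeg G u ≤ n) :
    ((∀ K ∈ mixedComps G x, K.card = 2) ∧ ∑ K ∈ mixedComps G x, excess G x K = 0 ∧
      ∑ K ∈ mixedComps G x, surplus G x K = 0) ∨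
    (9 * (n : ℤ) ≤ 5 * ∑ K ∈ mixedComps G x, excess G x K ∧
      ∃ K₃ ∈ mixedComps G x, K₃.card = 3 ∧ innerSum G K₃ = 4 ∧
        (∀ K ∈ mixedComps G x, K ≠ K₃ → K.card = 2) ∧
        ∑ K ∈ mixedComps G x, surplus G x K = 3 - 2 * ∑ u ∈ K₃, adjInt G u x) ∨
    18 * (n : ℤ) ≤ 5 * ∑ K ∈ mixedComps G x, excess G x K := by
  classical
  have hn0 : (0 : ℤ) ≤ n := by positivity
  have h2 : ∀ K ∈ mixedComps G x, K.card = 2 → excess G x K = 0 ∧ surplus G x K = 0 := by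
    intro K hK hc
    obtain ⟨hK, hm⟩ := mem_mixedComps.1 hK
    obtain ⟨e1, e2⟩ := hm.excess_two hK hc
    refine ⟨e1, ?_⟩
    rw [surplus, e2, hc]; norm_num
  have h3 : ∀ K ∈ mixedComps G x, K.card ≠ 2 → 3 ≤ K.card := by
    intro K hK hc
    have := (mem_mixedComps.1 hK).2.two_le_card
    omega
  have hge : ∀ K ∈ mixedComps G x, K.card ≠ 2 → 9 * (n : ℤ) ≤ 5 * excess G x K := fun K hK hc =>
    nine_mul_le_excess (mem_mixedComps.1 hK).1 hd hd' hsmall (h3 K hK hc)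
  have hnonneg : ∀ K ∈ mixedComps G x, 0 ≤ excess G x K := by
    intro K hK
    by_cases hc : K.card = 2
    · rw [(h2 K hK hc).1]
    · have := hge K hK hc
      linarith
  by_cases hall : ∀ K ∈ mixedComps G x, K.card = 2
  · left
    exact ⟨hall, Finset.sum_eq_zero fun K hK => (h2 K hK (hall K hK)).1,
      Finset.sum_eq_zero fun K hK => (h2 K hK (hall K hK)).2⟩
  right
  push Not at hall
  obtain ⟨K₃, hK₃, hc₃⟩ := hall
  by_cases hstd : K₃.card = 3 ∧ innerSum G K₃ = 4
  · by_cases hoth : ∀ K ∈ mixedComps G x, K ≠ K₃ → K.card = 2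
    · left
      refine ⟨?_, K₃, hK₃, hstd.1, hstd.2, hoth, ?_⟩
      · have := Finset.single_le_sum hnonneg hK₃
        linarith [hge K₃ hK₃ hc₃]
      · rw [Finset.sum_eq_single_of_mem K₃ hK₃ fun K hK hne => (h2 K hK (hoth K hK hne)).2, surplus,
          hstd.1]
        norm_num
    · right
      push Not at hoth
      obtain ⟨K, hK, hne, hc⟩ := hoth
      have h : excess G x K + excess G x K₃ ≤ ∑ K ∈ mixedComps G x, excess G x K := by
        rw [← Finset.sum_pair hne]
        exact Finset.sum_le_sum_of_subset_of_nonneg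
          (Finset.insert_subset hK (Finset.singleton_subset_iff.2 hK₃)) fun K hK _ => hnonneg K hK
      linarith [hge K₃ hK₃ hc₃, hge K hK hc]
  · right
    have := Finset.single_le_sum hnonneg hK₃
    linarith [eighteen_mul_le_excess (mem_mixedComps.1 hK₃).1 hd hd' hsmall (h3 K₃ hK₃ hc₃) hstd]

/-- The fine structure around the centre: one isolated vertex `v`, all other components of `G - x`
being legs of the lengths occurring in the extremal spiders. -/
lemma exists_legs {C : Finset (Face n)} (hC : IsMinimalCoboundary C)
    (hG : Cᶜ = oddFaces G) (hn : 100 ≤ n) (hcard : (Cᶜ.card : ℤ) ≤ n ^ 2)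
    (hd : 49 * (n : ℤ) ≤ 100 * vdeg G x)
    (hd' : 2 * vdeg G x ≤ n - 1) (hsmall : ∀ u, u ≠ x → 200 * vdeg G u ≤ n)
    (hbound : (Even n ∧ 4 * (Cᶜ.card : ℤ) ≤ 3 * n ^ 2 - 14 * n + 16) ∨
      (Odd n ∧ 4 * (Cᶜ.card : ℤ) ≤ 3 * n ^ 2 - 16 * n + 25)) :
    ∃ v, {v} ∈ comps G {x} ∧ ¬ G.Adj x v ∧
      ((Even n ∧ ∀ K ∈ comps G {x}, K ≠ {v} → K.card = 2 ∧ IsLeg G x K 2) ∨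
       (Even n ∧ ∃ K₁ ∈ comps G {x}, ∃ K₃ ∈ comps G {x}, K₁ ≠ {v} ∧ K₃ ≠ {v} ∧
        (K₁.card = 1 ∧ IsLeg G x K₁ 1) ∧ (K₃.card = 3 ∧ IsLeg G x K₃ 3) ∧
        ∀ K ∈ comps G {x}, K ≠ {v} → K ≠ K₁ → K ≠ K₃ → K.card = 2 ∧ IsLeg G x K 2) ∨
       (Odd n ∧ ∃ K₁ ∈ comps G {x}, K₁ ≠ {v} ∧ (K₁.card = 1 ∧ IsLeg G x K₁ 1) ∧
        ∀ K ∈ comps G {x}, K ≠ {v} → K ≠ K₁ → K.card = 2 ∧ IsLeg G x K 2)) := by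
  have hn12 : 12 ≤ n := by omega
  have hsum := sum_excess G x
  have hsur := sum_surplus G x
  rw [sum_comps_split] at hsum hsur
  have h6 := six_mul_card_oddFaces_eq G
  have hT := triangleSum_nonneg G
  rw [← hG] at h6
  have hfar := farComps_cases hC hG hn12 hcard hd hd' hsmall
  have hnear := nearComps_cases hC hG hn12 hcard hd hd' hsmall
  have hmix := mixedComps_cases hd hd' hsmall
  have hleg2 : ∀ K ∈ mixedComps G x, K.card = 2 → K.card = 2 ∧ IsLeg G x K 2 := fun K hK hc =>
    ⟨hc, (mem_mixedComps.1 hK).2.isLeg_two (mem_mixedComps.1 hK).1 hc⟩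
  have hleg1 : ∀ K ∈ nearComps G x, K.card = 1 → K.card = 1 ∧ IsLeg G x K 1 := fun K hK hc =>
    ⟨hc, isLeg_one (mem_nearComps.1 hK).1 hc (mem_nearComps.1 hK).2⟩
  have hfv : ∀ v, farComps G x = {{v}} → {v} ∈ comps G {x} ∧ ¬ G.Adj x v := by
    intro v hv
    have := mem_farComps.1 (hv ▸ Finset.mem_singleton_self ({v} : Finset (Fin n)))
    exact ⟨this.1, this.2 v (Finset.mem_singleton_self v)⟩
  have hnf : ∀ v, farComps G x = {{v}} → ∀ K ∈ nearComps G x, K ≠ {v} := by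
    rintro v hv K hK rfl
    exact (hfv v hv).2 ((mem_nearComps.1 hK).2 v (Finset.mem_singleton_self v))
  have hmf : ∀ v, farComps G x = {{v}} → ∀ K ∈ mixedComps G x, K ≠ {v} := by
    rintro v hv K hK rfl
    have := (mem_mixedComps.1 hK).2.two_le_card
    simp at this
  set d := vdeg G x with hdd
  set E₀ := ∑ K ∈ farComps G x, excess G x K with hE₀
  set E₁ := ∑ K ∈ nearComps G x, excess G x K with hE₁
  set Q := ∑ K ∈ mixedComps G x, excess G x K with hQ
  set Z₀ := ∑ K ∈ farComps G x, surplus G x K with hZ₀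
  set Z₁ := ∑ K ∈ nearComps G x, surplus G x K with hZ₁
  set Z := ∑ K ∈ mixedComps G x, surplus G x K with hZ
  have hnZ : (100 : ℤ) ≤ n := by exact_mod_cast hn
  have hQ0 : 0 ≤ Q := by
    rcases hmix with ⟨-, h, -⟩ | ⟨h, -⟩ | h
    · exact h.ge
    · linarith
    · linarith
  have htot : 2 * d + (3 * n - 10) * (n - 1) + (E₀ + E₁ + Q) ≤ 4 * (Cᶜ.card : ℤ) := by linarith
  -- since `2 * d` is close to `n`, the bounds on the total excess are about `-2 * n` for even `n` and
  -- `-4 * n` for odd `n`, while each of `E₀` and `E₁` is at least about `-2 * n` and `Q` is nonnegative;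
  -- the close cases are decided by the total surplus, which is nonnegative and has a fixed parity
  rcases hbound with ⟨heven, hb⟩ | ⟨hodd, hb⟩
  · have hE : E₀ + E₁ + Q ≤ -n + 6 - 2 * d := by linarith
    obtain ⟨m, hm⟩ := heven
    have hm' : (n : ℤ) = m + m := by exact_mod_cast hm
    rcases hfar with ⟨f1, f2⟩ | ⟨⟨v, hv⟩, f1, f2⟩ | ⟨f1, f2⟩ | f1
    · exfalso
      rcases hnear with ⟨-, g1, g2⟩ | ⟨-, g1, g2⟩ | ⟨g1, g2⟩ | g1
      · linarith
      · rcases hmix with ⟨-, q1, q2⟩ | ⟨q1, -⟩ | q1 <;> linarith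
      · linarith
      · linarith
    · refine ⟨v, (hfv v hv).1, (hfv v hv).2, ?_⟩
      rcases hnear with ⟨g0, g1, g2⟩ | ⟨⟨c, hc⟩, g1, g2⟩ | ⟨g1, g2⟩ | g1
      · left
        refine ⟨⟨m, hm⟩, fun K hK hKv => ?_⟩
        rcases hmix with ⟨q, -, -⟩ | ⟨q1, -⟩ | q1
        · rcases mem_comps_cases hK with h | h | h
          · rw [hv, Finset.mem_singleton] at h; exact absurd h hKv
          · rw [g0] at h; simp at h
          · exact hleg2 K h (q K h)
        · exfalso; linarith
        · exfalso; linarith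
      · right; left
        rcases hmix with ⟨-, q1, q2⟩ | ⟨q1, K₃, hK₃, q3, q4, q5, q6⟩ | q1
        · exfalso; omega
        · have hcn : {c} ∈ nearComps G x := hc ▸ Finset.mem_singleton_self _
          have hK₃m := mem_mixedComps.1 hK₃
          have ha := hK₃m.2.sum_adjInt.1
          have ha1 : ∑ u ∈ K₃, adjInt G u x = 1 := by omega
          refine ⟨⟨m, hm⟩, {c}, (mem_nearComps.1 hcn).1, K₃, hK₃m.1, hnf v hv _ hcn,
            hmf v hv _ hK₃, hleg1 _ hcn (Finset.card_singleton c),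
            ⟨q3, isLeg_three hC hG hn12 hcard hK₃m.1 q3 q4 ha1⟩, fun K hK hKv hKc hK3 => ?_⟩
          rcases mem_comps_cases hK with h | h | h
          · rw [hv, Finset.mem_singleton] at h; exact absurd h hKv
          · rw [hc, Finset.mem_singleton] at h; exact absurd h hKc
          · exact hleg2 K h (q5 K h hK3)
        · exfalso; linarith
      · exfalso
        rcases hmix with ⟨-, q1, q2⟩ | ⟨q1, -⟩ | q1 <;> linarith
      · exfalso; linarith
    · exfalso
      rcases hnear with ⟨-, g1, g2⟩ | ⟨-, g1, g2⟩ | ⟨g1, g2⟩ | g1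
      · linarith
      · rcases hmix with ⟨-, q1, q2⟩ | ⟨q1, -⟩ | q1 <;> linarith
      · linarith
      · linarith
    · exfalso
      rcases hnear with ⟨-, g1, g2⟩ | ⟨-, g1, g2⟩ | ⟨g1, g2⟩ | g1 <;> linarith
  · have hE : E₀ + E₁ + Q ≤ -3 * n + 15 - 2 * d := by linarith
    rcases hfar with ⟨f1, f2⟩ | ⟨⟨v, hv⟩, f1, f2⟩ | ⟨f1, f2⟩ | f1
    · exfalso
      rcases hnear with ⟨-, g1, g2⟩ | ⟨-, g1, g2⟩ | ⟨g1, g2⟩ | g1 <;> linarith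
    · refine ⟨v, (hfv v hv).1, (hfv v hv).2, ?_⟩
      rcases hnear with ⟨g0, g1, g2⟩ | ⟨⟨c, hc⟩, g1, g2⟩ | ⟨g1, g2⟩ | g1
      · exfalso; linarith
      · right; right
        have hcn : {c} ∈ nearComps G x := hc ▸ Finset.mem_singleton_self _
        refine ⟨hodd, {c}, (mem_nearComps.1 hcn).1, hnf v hv _ hcn,
          hleg1 _ hcn (Finset.card_singleton c), fun K hK hKv hKc => ?_⟩
        rcases hmix with ⟨q, -, -⟩ | ⟨q1, -⟩ | q1
        · rcases mem_comps_cases hK with h | h | h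
          · rw [hv, Finset.mem_singleton] at h; exact absurd h hKv
          · rw [hc, Finset.mem_singleton] at h; exact absurd h hKc
          · exact hleg2 K h (q K h)
        · exfalso; linarith
        · exfalso; linarith
      · exfalso; linarith
      · exfalso; linarith
    · exfalso
      rcases hnear with ⟨-, g1, g2⟩ | ⟨-, g1, g2⟩ | ⟨g1, g2⟩ | g1 <;> linarith
    · exfalso
      rcases hnear with ⟨-, g1, g2⟩ | ⟨-, g1, g2⟩ | ⟨g1, g2⟩ | g1 <;> linarith

end Structure

/-! ### Spiders -/

section Spider

variable {L : List ℕ}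

lemma spider_adj_none_none : ¬ (spider L).Adj none none := (spider L).loopless.irrefl _

lemma spider_adj_none_some {q : Σ i : Fin L.length, Fin (L.get i)} :
    (spider L).Adj none (some q) ↔ q.2.val = 0 := by
  simp [spider, SimpleGraph.fromRel_adj]

lemma spider_adj_some_none {q : Σ i : Fin L.length, Fin (L.get i)} :
    (spider L).Adj (some q) none ↔ q.2.val = 0 := by
  rw [SimpleGraph.adj_comm, spider_adj_none_some]

lemma spider_adj_some_some {p q : Σ i : Fin L.length, Fin (L.get i)} :
    (spider L).Adj (some p) (some q) ↔
      p.1 = q.1 ∧ (q.2.val = p.2.val + 1 ∨ p.2.val = q.2.val + 1) := by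
  simp only [spider, SimpleGraph.fromRel_adj]
  constructor
  · rintro ⟨-, ⟨h1, h2⟩ | ⟨h1, h2⟩⟩
    · exact ⟨h1, Or.inl h2⟩
    · exact ⟨h1.symm, Or.inr h2⟩
  · rintro ⟨h1, h2⟩
    refine ⟨?_, ?_⟩
    · intro h
      rw [Option.some.injEq] at h
      subst h
      omega
    · rcases h2 with h2 | h2
      · exact Or.inl ⟨h1, h2⟩
      · exact Or.inr ⟨h1.symm, h2⟩

lemma triangleSum_spider (L : List ℕ) : triangleSum (spider L) = 0 := by
  refine Finset.sum_eq_zero fun a _ => Finset.sum_eq_zero fun b _ =>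
    Finset.sum_eq_zero fun c _ => ?_
  by_contra hcon
  have f : ∀ a b, adjInt (spider L) a b ≠ 0 → (spider L).Adj a b := by
    intro a b h
    by_contra h'
    exact h (by simp [adjInt, h'])
  obtain ⟨⟨h1, h2⟩, h3⟩ := (by simpa only [mul_ne_zero_iff] using hcon :
    (adjInt (spider L) a b ≠ 0 ∧ adjInt (spider L) b c ≠ 0) ∧ adjInt (spider L) a c ≠ 0)
  have g1 := f _ _ h1
  have g2 := f _ _ h2
  have g3 := f _ _ h3
  rcases a with _ | a <;> rcases b with _ | b <;> rcases c with _ | c <;>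
    simp only [spider_adj_none_none, spider_adj_none_some, spider_adj_some_none,
      spider_adj_some_some] at g1 g2 g3 <;> omega

lemma vdeg_spider_none (h : ∀ ℓ ∈ L, 1 ≤ ℓ) : vdeg (spider L) none = L.length := by
  unfold vdeg
  rw [Fintype.sum_option, adjInt_self, zero_add, Fintype.sum_sigma]
  have : ∀ i : Fin L.length, ∑ j : Fin (L.get i), adjInt (spider L) none (some ⟨i, j⟩) = 1 := by
    intro i
    have hi : 0 < L.get i := h _ (L.get_mem i)
    rw [Finset.sum_eq_single_of_mem (⟨0, hi⟩ : Fin (L.get i)) (Finset.mem_univ _)]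
    · exact adjInt_of_adj (spider_adj_none_some.2 rfl)
    · intro j _ hj
      refine adjInt_of_not_adj fun h => hj (Fin.ext ?_)
      exact spider_adj_none_some.1 h
  simp [this]

lemma vdeg_spider_some (i : Fin L.length) (j : Fin (L.get i)) :
    vdeg (spider L) (some ⟨i, j⟩) = if j.val + 1 < L.get i then 2 else 1 := by
  unfold vdeg
  rw [Fintype.sum_option, Fintype.sum_sigma, Finset.sum_eq_single_of_mem i (Finset.mem_univ _)]
  · have e : ∀ j' : Fin (L.get i), adjInt (spider L) (some ⟨i, j⟩) (some ⟨i, j'⟩)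
        = (if j'.val = j.val + 1 then 1 else 0) + if j.val = j'.val + 1 then 1 else 0 := by
      intro j'
      rw [adjInt_eq_ite_of_iff spider_adj_some_some]
      simp only [true_and]
      split_ifs <;> first | rfl | omega
    have e0 : adjInt (spider L) (some ⟨i, j⟩) none = if j.val = 0 then 1 else 0 :=
      adjInt_eq_ite_of_iff spider_adj_some_none
    have e1 : ∑ j' : Fin (L.get i), (if j'.val = j.val + 1 then (1 : ℤ) else 0)
        = if j.val + 1 < L.get i then 1 else 0 := by
      split_ifs with h
      · rw [Finset.sum_eq_single_of_mem (⟨j.val + 1, h⟩ : Fin (L.get i)) (Finset.mem_univ _)]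
        · simp
        · intro j' _ hj'
          exact if_neg fun h => hj' (Fin.ext h)
      · exact Finset.sum_eq_zero fun j' _ => if_neg (by have := j'.2; omega)
    have e2 : ∑ j' : Fin (L.get i), (if j.val = j'.val + 1 then (1 : ℤ) else 0)
        = if j.val = 0 then 0 else 1 := by
      split_ifs with h
      · exact Finset.sum_eq_zero fun j' _ => if_neg (by omega)
      · have hlt : j.val - 1 < L.get i := by have := j.2; omega
        rw [Finset.sum_eq_single_of_mem (⟨j.val - 1, hlt⟩ : Fin (L.get i)) (Finset.mem_univ _)]
        · exact if_pos (by simp only; omega)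
        · intro j' _ hj'
          exact if_neg fun h => hj' (Fin.ext (by simp only; omega))
    rw [e0, Finset.sum_congr rfl fun j' _ => e j', Finset.sum_add_distrib, e1, e2]
    split_ifs <;> norm_num
  · intro k _ hk
    refine Finset.sum_eq_zero fun j' _ => adjInt_of_not_adj fun h => hk ?_
    exact (spider_adj_some_some.1 h).1.symm

/-- The degree statistic of a spider entering the number of odd faces. -/
lemma sum_vdeg_spider (h : ∀ ℓ ∈ L, 1 ≤ ℓ) (N : ℤ) :
    ∑ a, vdeg (spider L) a * (N - 2 * vdeg (spider L) a)
      = L.length * (N - 2 * L.length)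
        + (L.map fun ℓ : ℕ => (N - 2) + ((ℓ : ℤ) - 1) * (2 * (N - 4))).sum := by
  rw [Fintype.sum_option, vdeg_spider_none h, Fintype.sum_sigma]
  congr 1
  have : ∀ i : Fin L.length, ∑ j : Fin (L.get i),
      vdeg (spider L) (some ⟨i, j⟩) * (N - 2 * vdeg (spider L) (some ⟨i, j⟩))
      = (N - 2) + ((L.get i : ℤ) - 1) * (2 * (N - 4)) := by
    intro i
    have hi : 1 ≤ L.get i := h _ (L.get_mem i)
    simp only [vdeg_spider_some]
    generalize L.get i = m at hi
    obtain ⟨k, rfl⟩ := Nat.exists_eq_add_of_le' hi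
    rw [Fin.sum_univ_castSucc]
    have e : ∀ j : Fin k, (if (Fin.castSucc j).val + 1 < k + 1 then (2 : ℤ) else 1) = 2 := by
      intro j; exact if_pos (by have := j.2; simp)
    have e' : (if (Fin.last k).val + 1 < k + 1 then (2 : ℤ) else 1) = 1 := if_neg (by simp)
    simp only [e, e']
    simp
    ring
  rw [Finset.sum_congr rfl fun i _ => this i]
  rw [← List.sum_ofFn, ← List.ofFn_get (L.map _)]
  congr 1
  apply List.ext_get <;> simp

/-- In a spider with at most one leg of length one, any function on pairs that is constant along
edges whose ends are both nonadjacent to the other argument is constant on nonadjacent pairs: every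
such pair slides to a pair of a tip and the centre. -/
lemma spider_pairs_constant (h1 : ∀ i : Fin L.length, 1 ≤ L.get i)
    (h2 : ∀ i k : Fin L.length, i ≠ k → 2 ≤ L.get i ∨ 2 ≤ L.get k)
    (h3 : ∃ i : Fin L.length, 2 ≤ L.get i)
    {ζ : Option (Σ i : Fin L.length, Fin (L.get i)) → Option (Σ i : Fin L.length, Fin (L.get i)) →
      ZMod 2}
    (hsymm : ∀ a b, ζ a b = ζ b a)
    (hslide : ∀ a b c, (spider L).Adj a b → a ≠ c → b ≠ c → ¬ (spider L).Adj a c →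
      ¬ (spider L).Adj b c → ζ a c = ζ b c) :
    ∃ β, ∀ a b, a ≠ b → ¬ (spider L).Adj a b → ζ a b = β := by
  let tip : ∀ i : Fin L.length, Fin (L.get i) := fun i => ⟨L.get i - 1, by have := h1 i; omega⟩
  have slide : ∀ (s : Option (Σ i : Fin L.length, Fin (L.get i))) (i : Fin L.length)
      (j : Fin (L.get i)),
      (∀ j' : Fin (L.get i), j.val ≤ j'.val → s ≠ some ⟨i, j'⟩ ∧ ¬ (spider L).Adj s (some ⟨i, j'⟩)) →
      ζ s (some ⟨i, j⟩) = ζ s (some ⟨i, tip i⟩) := by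
    intro s i j hs
    have : ∀ t (ht : j.val + t < L.get i), ζ s (some ⟨i, j⟩) = ζ s (some ⟨i, ⟨j.val + t, ht⟩⟩) := by
      intro t
      induction t with
      | zero => intro _; rfl
      | succ t ih =>
        intro ht
        rw [ih (by omega), hsymm s, hsymm s]
        refine hslide _ _ _ ?_ ?_ ?_ ?_ ?_
        · exact spider_adj_some_some.2 ⟨rfl, Or.inl (by simp only; omega)⟩
        · exact (hs _ (by simp)).1.symm
        · exact (hs _ (by simp only; omega)).1.symm
        · rw [SimpleGraph.adj_comm]; exact (hs _ (by simp)).2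
        · rw [SimpleGraph.adj_comm]; exact (hs _ (by simp only; omega)).2
    have hj := j.2
    rw [this (L.get i - 1 - j.val) (by omega)]
    congr 3
    exact Fin.ext (by simp only [tip]; omega)
  have tip_other : ∀ i k : Fin L.length, 2 ≤ L.get i → i ≠ k → ∀ j : Fin (L.get k),
      ζ (some ⟨i, tip i⟩) (some ⟨k, j⟩) = ζ (some ⟨i, tip i⟩) none := by
    intro i k hi hik
    have hne : ∀ j, (some ⟨k, j⟩ : Option (Σ i : Fin L.length, Fin (L.get i))) ≠ some ⟨i, tip i⟩ := by
      intro j h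
      rw [Option.some.injEq, Sigma.mk.injEq] at h
      exact hik h.1.symm
    have hna : ∀ j, ¬ (spider L).Adj (some ⟨k, j⟩) (some ⟨i, tip i⟩) := fun j h =>
      hik (spider_adj_some_some.1 h).1.symm
    have h0 : ¬ (spider L).Adj none (some ⟨i, tip i⟩) := by
      rw [spider_adj_none_some]; simp only [tip]; omega
    have : ∀ m (hm : m < L.get k), ζ (some ⟨i, tip i⟩) (some ⟨k, ⟨m, hm⟩⟩)
        = ζ (some ⟨i, tip i⟩) none := by
      intro m
      induction m with
      | zero =>
        intro hm
        rw [hsymm, hsymm _ none]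
        exact hslide _ _ _ (spider_adj_some_none.2 rfl) (hne _) (by simp) (hna _) h0
      | succ m ih =>
        intro hm
        rw [← ih (by omega), hsymm, hsymm (some ⟨i, tip i⟩)]
        exact hslide _ _ _ (spider_adj_some_some.2 ⟨rfl, Or.inr rfl⟩) (hne _) (hne _) (hna _) (hna _)
    exact fun j => this j.val j.2
  have tip_same : ∀ i : Fin L.length, ∀ j : Fin (L.get i), j.val + 2 < L.get i →
      ζ (some ⟨i, tip i⟩) (some ⟨i, j⟩) = ζ (some ⟨i, tip i⟩) none := by
    intro i
    have hne : ∀ j : Fin (L.get i), j.val + 2 < L.get i →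
        (some ⟨i, j⟩ : Option (Σ i : Fin L.length, Fin (L.get i))) ≠ some ⟨i, tip i⟩ := by
      intro j hj h
      rw [Option.some.injEq, Sigma.mk.injEq] at h
      have := congrArg Fin.val (eq_of_heq h.2)
      simp only [tip] at this
      omega
    have hna : ∀ j : Fin (L.get i), j.val + 2 < L.get i →
        ¬ (spider L).Adj (some ⟨i, j⟩) (some ⟨i, tip i⟩) := by
      intro j hj h
      have := (spider_adj_some_some.1 h).2
      simp only [tip] at this
      omega
    have : ∀ m (hm : m + 2 < L.get i), ζ (some ⟨i, tip i⟩) (some ⟨i, ⟨m, by omega⟩⟩)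
        = ζ (some ⟨i, tip i⟩) none := by
      intro m
      induction m with
      | zero =>
        intro hm
        rw [hsymm, hsymm _ none]
        refine hslide _ _ _ (spider_adj_some_none.2 rfl) (hne _ hm) (by simp) (hna _ hm) ?_
        rw [spider_adj_none_some]; simp only [tip]; omega
      | succ m ih =>
        intro hm
        rw [← ih (by omega), hsymm, hsymm (some ⟨i, tip i⟩)]
        exact hslide _ _ _ (spider_adj_some_some.2 ⟨rfl, Or.inr rfl⟩) (hne _ hm)
          (hne _ (by simp only; omega)) (hna _ hm) (hna _ (by simp only; omega))
    exact fun j hj => this j.val hj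
  obtain ⟨i₀, hi₀⟩ := h3
  refine ⟨ζ (some ⟨i₀, tip i₀⟩) none, ?_⟩
  have hβ : ∀ i : Fin L.length, 2 ≤ L.get i →
      ζ (some ⟨i, tip i⟩) none = ζ (some ⟨i₀, tip i₀⟩) none := by
    intro i hi
    by_cases h : i = i₀
    · subst h; rfl
    · rw [← tip_other i i₀ hi h (tip i₀), hsymm, tip_other i₀ i hi₀ (Ne.symm h)]
  have hcentre : ∀ i (j : Fin (L.get i)), j.val ≠ 0 →
      ζ none (some ⟨i, j⟩) = ζ (some ⟨i₀, tip i₀⟩) none := by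
    intro i j hj
    rw [slide none i j, hsymm, hβ i (by have := j.2; omega)]
    intro j' hj'
    refine ⟨by simp, ?_⟩
    rw [spider_adj_none_some]; simp only; omega
  have hdiff : ∀ i k (j : Fin (L.get i)) (j' : Fin (L.get k)), i ≠ k → 2 ≤ L.get i →
      ζ (some ⟨k, j'⟩) (some ⟨i, j⟩) = ζ (some ⟨i₀, tip i₀⟩) none := by
    intro i k j j' hik hi
    rw [slide _ i j, hsymm, tip_other i k hi hik, hβ i hi]
    intro j'' _
    refine ⟨?_, fun h => hik (spider_adj_some_some.1 h).1.symm⟩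
    intro h
    rw [Option.some.injEq, Sigma.mk.injEq] at h
    exact hik h.1.symm
  have hsame : ∀ i (j j' : Fin (L.get i)), j.val + 2 ≤ j'.val →
      ζ (some ⟨i, j⟩) (some ⟨i, j'⟩) = ζ (some ⟨i₀, tip i₀⟩) none := by
    intro i j j' hjj
    have := j'.2
    rw [slide _ i j', hsymm, tip_same i j (by omega), hβ i (by omega)]
    intro j'' hj''
    constructor
    · intro h
      rw [Option.some.injEq, Sigma.mk.injEq] at h
      have := congrArg Fin.val (eq_of_heq h.2)
      omega
    · intro h
      have := (spider_adj_some_some.1 h).2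
      simp only at this
      omega
  intro a b hab hnadj
  rcases a with _ | ⟨i, j⟩ <;> rcases b with _ | ⟨k, j'⟩
  · exact absurd rfl hab
  · exact hcentre k j' fun h => hnadj (spider_adj_none_some.2 h)
  · rw [hsymm]
    exact hcentre i j fun h => hnadj (spider_adj_some_none.2 h)
  · by_cases hik : i = k
    · subst hik
      rw [spider_adj_some_some] at hnadj
      have hne : j.val ≠ j'.val := fun h => hab (by rw [Fin.ext h])
      rcases Nat.lt_or_ge j.val j'.val with h | h
      · exact hsame i j j' (by simp at hnadj; omega)
      · rw [hsymm]; exact hsame i j' j (by simp at hnadj; omega)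
    · rcases h2 i k hik with h | h
      · rw [hsymm]; exact hdiff i k j j' hik h
      · exact hdiff k i j' j (Ne.symm hik) h

end Spider

section Link


lemma linkGraph_adj_iff {G : SimpleGraph (Fin n)} {v : Fin n} (hv : ∀ u, ¬ G.Adj v u)
    (u w : {u : Fin n // u ≠ v}) : (linkGraph (oddFaces G) v).Adj u w ↔ G.Adj u.1 w.1 := by
  have key : ∀ h1 h2 h3, face v u.1 w.1 h1 h2 h3 ∈ oddFaces G ↔ G.Adj u.1 w.1 := by
    intro h1 h2 h3
    rw [face_mem_oddFaces]
    simp [adjBit, hv]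
  constructor
  · rintro ⟨σ, hσ, hσe, hne⟩
    have hne' : u.1 ≠ w.1 := fun h => hne (Subtype.ext h)
    have : σ = face v u.1 w.1 u.2.symm w.2.symm hne' := Subtype.ext hσe
    rw [this, key] at hσ
    exact hσ
  · intro h
    have hne' : u.1 ≠ w.1 := G.ne_of_adj h
    exact ⟨face v u.1 w.1 u.2.symm w.2.symm hne', (key _ _ _).2 h, rfl, fun h => hne' (congrArg _ h)⟩

/-- Switching makes any given vertex isolated. -/
lemma exists_isolated_representative (G₀ : SimpleGraph (Fin n)) (v : Fin n) :
    ∃ G : SimpleGraph (Fin n), oddFaces G = oddFaces G₀ ∧ ∀ u, ¬ G.Adj v u := by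
  refine ⟨switch G₀ (adjBit G₀ v), oddFaces_switch _ _, ?_⟩
  rintro u ⟨-, h⟩
  apply h
  rw [adjBit_self]
  generalize adjBit G₀ v u = p
  revert p; decide

lemma vdeg_iso {V W : Type*} [Fintype V] [Fintype W] {G : SimpleGraph V} {G' : SimpleGraph W}
    (φ : G ≃g G') (u : V) : vdeg G' (φ u) = vdeg G u := by
  unfold vdeg
  rw [← φ.toEquiv.sum_comp]
  exact Finset.sum_congr rfl fun w _ => adjInt_congr φ.map_adj_iff

lemma triangleSum_iso {V W : Type*} [Fintype V] [Fintype W] {G : SimpleGraph V}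
    {G' : SimpleGraph W} (φ : G ≃g G') : triangleSum G' = triangleSum G := by
  unfold triangleSum
  rw [← φ.toEquiv.sum_comp]
  refine Finset.sum_congr rfl fun u _ => ?_
  rw [← φ.toEquiv.sum_comp]
  refine Finset.sum_congr rfl fun v _ => ?_
  rw [← φ.toEquiv.sum_comp]
  refine Finset.sum_congr rfl fun w _ => ?_
  have e : ∀ a b, adjInt G' (φ.toEquiv a) (φ.toEquiv b) = adjInt G a b :=
    fun a b => adjInt_congr φ.map_adj_iff
  rw [e, e, e]

/-- The size of the complement of a coboundary with a spider as a link: a graph with an isolated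
vertex `v` has the same degrees and triangles as its link at `v`. -/
lemma six_mul_card_of_link {C : Finset (Face n)} (hC : IsCoboundary C) {v : Fin n} {L : List ℕ}
    (φ : linkGraph Cᶜ v ≃g spider L) (h : ∀ ℓ ∈ L, 1 ≤ ℓ) :
    2 * (Cᶜ.card : ℤ) = L.length * (n - 2 * L.length)
        + (L.map fun ℓ : ℕ => ((n : ℤ) - 2) + ((ℓ : ℤ) - 1) * (2 * (n - 4))).sum := by
  obtain ⟨G₀, hG₀⟩ := isCoboundary_iff_compl.1 hC
  obtain ⟨G, hG, hv⟩ := exists_isolated_representative G₀ v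
  rw [← hG] at hG₀
  rw [hG₀] at φ ⊢
  have hadj := linkGraph_adj_iff hv
  have hv0 : ∀ u, adjInt G v u = 0 := fun u => adjInt_of_not_adj (hv u)
  have hv0' : ∀ u, adjInt G u v = 0 := fun u => by rw [adjInt_comm, hv0]
  have hdv : vdeg G v = 0 := Finset.sum_eq_zero fun u _ => hv0 u
  have hsplit : ∀ f : Fin n → ℤ, ∑ u, f u = f v + ∑ u : {u : Fin n // u ≠ v}, f u.1 :=
    fun f => Fintype.sum_eq_add_sum_subtype_ne f v
  have hdeg : ∀ u : {u : Fin n // u ≠ v}, vdeg G u.1 = vdeg (linkGraph (oddFaces G) v) u := by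
    intro u
    unfold vdeg
    rw [hsplit, hv0', zero_add]
    exact Finset.sum_congr rfl fun w _ => (adjInt_congr (hadj u w)).symm
  have htri : triangleSum G = triangleSum (linkGraph (oddFaces G) v) := by
    unfold triangleSum
    rw [hsplit]
    simp only [hv0, zero_mul, Finset.sum_const_zero, zero_add]
    refine Finset.sum_congr rfl fun a _ => ?_
    rw [hsplit]
    simp only [hv0', zero_mul, Finset.sum_const_zero, zero_add]
    refine Finset.sum_congr rfl fun b _ => ?_
    rw [hsplit]
    simp only [hv0', mul_zero, zero_add]
    refine Finset.sum_congr rfl fun c _ => ?_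
    rw [adjInt_congr (hadj a b), adjInt_congr (hadj b c), adjInt_congr (hadj a c)]
  have h6 := six_mul_card_oddFaces_eq G
  rw [htri, ← triangleSum_iso φ, triangleSum_spider, hsplit, hdv, zero_mul, zero_add] at h6
  have hs : ∑ u : {u : Fin n // u ≠ v}, vdeg G u.1 * (n - 2 * vdeg G u.1)
      = ∑ a, vdeg (spider L) a * (n - 2 * vdeg (spider L) a) := by
    rw [← φ.toEquiv.sum_comp]
    refine Finset.sum_congr rfl fun u _ => ?_
    have : vdeg (spider L) (φ.toEquiv u) = vdeg (linkGraph (oddFaces G) v) u := vdeg_iso φ u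
    rw [this, hdeg]
  rw [hs, sum_vdeg_spider h] at h6
  linarith

/-- A coboundary whose complement has a spider with at most one leg of length one as a link is a
minimal coboundary. -/
lemma isMinimalCoboundary_of_link {C : Finset (Face n)} (hC : IsCoboundary C) {v : Fin n}
    {L : List ℕ} (φ : linkGraph Cᶜ v ≃g spider L) (h1 : ∀ i : Fin L.length, 1 ≤ L.get i)
    (h2 : ∀ i k : Fin L.length, i ≠ k → 2 ≤ L.get i ∨ 2 ≤ L.get k)
    (h3 : ∃ i : Fin L.length, 2 ≤ L.get i) : IsMinimalCoboundary C := by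
  obtain ⟨G₀, hG₀⟩ := isCoboundary_iff_compl.1 hC
  obtain ⟨G, hG, hv⟩ := exists_isolated_representative G₀ v
  rw [← hG] at hG₀
  rw [hG₀] at φ
  have hadj := linkGraph_adj_iff hv
  have hmemC : ∀ a b c hab hac hbc, face a b c hab hac hbc ∈ C ↔
      adjBit G a b + adjBit G b c + adjBit G a c = 0 := by
    intro a b c hab hac hbc
    rw [← not_iff_not, ← Finset.mem_compl, hG₀, face_mem_oddFaces]
  have bit2 : ∀ p q : ZMod 2, p + q = 0 → p = q := by decide
  have main : ∀ D : Finset (Face n), IsCoboundary D → D ⊆ C → D.Nonempty → C ⊆ D := by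
    intro D hD hDC hDne
    obtain ⟨y, rfl⟩ := isCoboundary_iff.1 hD
    set z : Fin n → Fin n → ZMod 2 :=
      fun u w => pairVal y v u + pairVal y v w + pairVal y u w with hz
    have hzsymm : ∀ u w, z u w = z w u := by
      intro u w; simp only [hz]; rw [pairVal_comm y u w]; ring
    have hval : ∀ a b c hab hac hbc, (y ᵥ* boundary n) (face a b c hab hac hbc)
        = z a b + z b c + z a c := by
      intro a b c hab hac hbc
      rw [vecMul_boundary_face]
      simp only [hz]
      generalize pairVal y a b = p
      generalize pairVal y b c = q
      generalize pairVal y a c = r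
      generalize pairVal y v a = s
      generalize pairVal y v b = t
      generalize pairVal y v c = u
      revert p q r s t u; decide
    have hzero : ∀ a b c, a ≠ b → a ≠ c → b ≠ c →
        adjBit G a b + adjBit G b c + adjBit G a c ≠ 0 → z a b + z b c + z a c = 0 := by
      intro a b c hab hac hbc h
      rw [← hval a b c hab hac hbc]
      by_contra hne
      exact h ((hmemC a b c hab hac hbc).1 (hDC (mem_cobd.2 hne)))
    have hzv : ∀ u, z v u = 0 := by
      intro u
      have : pairVal y v v = 0 := by simp [pairVal]
      simp only [hz, this]
      generalize pairVal y v u = p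
      revert p; decide
    have hzadj : ∀ a b, G.Adj a b → z a b = 0 := by
      intro a b h
      have ha : v ≠ a := by rintro rfl; exact hv _ h
      have hb : v ≠ b := by rintro rfl; exact hv _ h.symm
      have := hzero v a b ha hb (G.ne_of_adj h) (by simp [adjBit, hv, h])
      simpa [hzv] using this
    obtain ⟨β, hβ⟩ := spider_pairs_constant h1 h2 h3
      (ζ := fun a b => z (φ.symm a).1 (φ.symm b).1) (fun a b => hzsymm _ _) (by
        intro a b c hab hac hbc nac nbc
        have e : ∀ a b, (spider L).Adj a b ↔ G.Adj (φ.symm a).1 (φ.symm b).1 := by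
          intro a b
          rw [← hadj, φ.symm.map_adj_iff]
        have ne : ∀ a b, a ≠ b → (φ.symm a).1 ≠ (φ.symm b).1 :=
          fun a b h h' => h (φ.symm.injective (Subtype.ext h'))
        rw [e] at hab nac nbc
        have := hzero _ _ _ (G.ne_of_adj hab) (ne _ _ hac) (ne _ _ hbc)
          (by simp [adjBit, hab, nac, nbc])
        rw [hzadj _ _ hab, zero_add] at this
        exact (bit2 _ _ this).symm)
    have hβ' : ∀ u w, u ≠ v → w ≠ v → u ≠ w → z u w = β * (1 + adjBit G u w) := by
      intro u w hu hw huw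
      by_cases h : G.Adj u w
      · rw [hzadj u w h]
        have : (1 + 1 : ZMod 2) = 0 := by decide
        simp [adjBit, h, this]
      · have := hβ (φ ⟨u, hu⟩) (φ ⟨w, hw⟩) (fun h' => huw (congrArg Subtype.val (φ.injective h')))
          (by rw [φ.map_adj_iff, hadj]; exact h)
        simp only [RelIso.symm_apply_apply] at this
        rw [this]
        simp [adjBit, h]
    -- the value of `y` on a face is `β` times the indicator of `C`
    have hface : ∀ a b c hab hac hbc, (y ᵥ* boundary n) (face a b c hab hac hbc)
        = β * (1 + (adjBit G a b + adjBit G b c + adjBit G a c)) := by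
      have hzv' : ∀ u, z u v = 0 := fun u => by rw [hzsymm, hzv]
      have hav : ∀ u, adjBit G v u = 0 := fun u => by simp [adjBit, hv]
      have hav' : ∀ u, adjBit G u v = 0 := fun u => by rw [adjBit_comm, hav]
      intro a b c hab hac hbc
      rw [hval]
      by_cases ha : a = v
      · subst ha
        rw [hzv, hzv, hβ' b c hab.symm hac.symm hbc, hav, hav]; ring
      by_cases hb : b = v
      · subst hb
        rw [hzv, hzv', hβ' a c hab hbc.symm hac, hav, hav']; ring
      by_cases hc : c = v
      · subst hc
        rw [hzv', hzv', hβ' a b hac hbc hab, hav', hav']; ring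
      rw [hβ' a b ha hb hab, hβ' b c hb hc hbc, hβ' a c ha hc hac]
      generalize adjBit G a b = p
      generalize adjBit G b c = q
      generalize adjBit G a c = r
      generalize β = s
      revert p q r s; decide
    have hβ1 : β ≠ 0 := by
      rintro rfl
      obtain ⟨σ, hσ⟩ := hDne
      obtain ⟨a, b, c, hab, hac, hbc, rfl⟩ := Face.exists_eq σ
      exact mem_cobd.1 hσ (by rw [hface, zero_mul])
    intro σ hσ
    obtain ⟨a, b, c, hab, hac, hbc, rfl⟩ := Face.exists_eq σ
    rw [mem_cobd, hface, (hmemC a b c hab hac hbc).1 hσ]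
    simpa using hβ1
  refine ⟨⟨hC, ?_⟩, fun D hD hle => main D hD.1 hle hD.2⟩
  -- the second vertex of a long leg, the centre and `v` span no edge
  obtain ⟨i, hi⟩ := h3
  set t : Option (Σ i : Fin L.length, Fin (L.get i)) := some ⟨i, ⟨1, by omega⟩⟩ with ht
  have hnt : ¬ G.Adj (φ.symm none).1 (φ.symm t).1 := by
    rw [← hadj, φ.symm.map_adj_iff, ht, spider_adj_none_some]
    simp
  have hne : (φ.symm none).1 ≠ (φ.symm t).1 := by
    intro h
    have := φ.symm.injective (Subtype.ext h)
    simp [ht] at this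
  refine ⟨face v (φ.symm none).1 (φ.symm t).1 (φ.symm none).2.symm (φ.symm t).2.symm hne, ?_⟩
  rw [hmemC]
  simp [adjBit, hv, hnt]

/-- Every spider on `n - 1` vertices is a link of the complement of a coboundary. -/
lemma exists_coboundary_link (L : List ℕ) (hn : L.sum + 2 = n) :
    ∃ (C : Finset (Face n)) (v : Fin n), IsCoboundary C ∧ Nonempty (linkGraph Cᶜ v ≃g spider L) := by
  let v : Fin n := ⟨0, by omega⟩
  have hcard : Fintype.card {u : Fin n // u ≠ v}
      = Fintype.card (Option (Σ i : Fin L.length, Fin (L.get i))) := by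
    rw [Fintype.card_option, Fintype.card_sigma]
    simp only [Fintype.card_fin]
    have h1 : ∑ i : Fin L.length, L.get i = L.sum := by
      rw [← List.sum_ofFn, List.ofFn_get]
    have h2 : Fintype.card {u : Fin n // u ≠ v} = n - 1 := by
      rw [Fintype.card_subtype_compl]; simp
    rw [h1, h2]; omega
  let e := Fintype.equivOfCardEq hcard
  let G : SimpleGraph (Fin n) :=
    { Adj := fun u w => ∃ hu hw, (spider L).Adj (e ⟨u, hu⟩) (e ⟨w, hw⟩)
      symm := ⟨fun u w ⟨hu, hw, h⟩ => ⟨hw, hu, h.symm⟩⟩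
      loopless := ⟨fun u ⟨_, _, h⟩ => (spider L).loopless.irrefl _ h⟩ }
  refine ⟨(oddFaces G)ᶜ, v, isCoboundary_iff_compl.2 ⟨G, compl_compl _⟩, ⟨⟨e, ?_⟩⟩⟩
  intro u w
  rw [compl_compl, linkGraph_adj_iff (G := G) (v := v) (fun u h => h.1 rfl)]
  exact ⟨fun h => ⟨u.2, w.2, h⟩, fun ⟨_, _, h⟩ => h⟩

end Link

/-! ### Extremal spiders and the conclusion -/

/-- A graph with an isolated vertex `v`, all of whose other components after deleting the centre `x`
are legs, has a spider as link at `v`. -/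
lemma nonempty_link_iso {G : SimpleGraph (Fin n)} {x v : Fin n} (hv : {v} ∈ comps G {x})
    (hxv : ¬ G.Adj x v) {l : List (Finset (Fin n))} {L : List ℕ} (hnd : l.Nodup)
    (hl : ∀ K, K ∈ l ↔ K ∈ comps G {x} ∧ K ≠ {v}) (hlen : List.Forall₂ (IsLeg G x) l L) :
    Nonempty (linkGraph (oddFaces G) v ≃g spider L) := by
  have hvx : v ≠ x := by simpa using notMem_of_mem_comps hv (Finset.mem_singleton_self v)
  have hiso : ∀ u, ¬ G.Adj v u := by
    intro u h
    by_cases hu : u = x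
    · subst hu; exact hxv h.symm
    · have := mem_of_adj hv (Finset.mem_singleton_self v) (by simpa using hu) h
      rw [Finset.mem_singleton] at this
      exact G.ne_of_adj h this.symm
  obtain ⟨hlength, hleg⟩ := List.forall₂_iff_get.1 hlen
  let Kof : Fin L.length → Finset (Fin n) := fun i => l.get (i.cast hlength.symm)
  have hKof : ∀ i, Kof i ∈ comps G {x} ∧ Kof i ≠ {v} := fun i => (hl _).1 (l.get_mem _)
  have hKinj : Function.Injective Kof := by
    intro i j hij
    have := hnd.injective_get hij
    exact Fin.ext (by simpa using congrArg Fin.val this)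
  have hlegK : ∀ i : Fin L.length, IsLeg G x (Kof i) (L.get i) := fun i =>
    hleg i.val (by rw [hlength]; exact i.2) i.2
  choose g hginj hgmem hgx hgadj using hlegK
  have hgK : ∀ i j, g i j ∈ Kof i := fun i j => (hgmem i _).2 ⟨j, rfl⟩
  have hgv : ∀ i j, g i j ≠ v := by
    intro i j h
    exact (hKof i).2 (eq_of_mem_comps (hKof i).1 hv (hgK i j) (by rw [h]; simp))
  have hgx' : ∀ i j, g i j ≠ x := by
    intro i j
    simpa using notMem_of_mem_comps (hKof i).1 (hgK i j)
  have hsame : ∀ i j i', g i j ∈ Kof i' → i = i' := by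
    intro i j i' h
    exact hKinj (eq_of_mem_comps (hKof i).1 (hKof i').1 (hgK i j) h)
  let φ : Option (Σ i : Fin L.length, Fin (L.get i)) → {u : Fin n // u ≠ v} := fun a =>
    match a with
    | none => ⟨x, hvx.symm⟩
    | some p => ⟨g p.1 p.2, hgv p.1 p.2⟩
  have hφ : Function.Bijective φ := by
    constructor
    · intro a b hab
      rcases a with _ | ⟨i, j⟩ <;> rcases b with _ | ⟨i', j'⟩
      · rfl
      · exact absurd (congrArg Subtype.val hab).symm (hgx' i' j')
      · exact absurd (congrArg Subtype.val hab) (hgx' i j)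
      · have h : g i j = g i' j' := congrArg Subtype.val hab
        have hi : i = i' := hsame i j i' (h ▸ hgK i' j')
        subst hi
        rw [hginj i h]
    · rintro ⟨u, hu⟩
      by_cases hux : u = x
      · exact ⟨none, Subtype.ext hux.symm⟩
      · have hK : compOf G {x} u ∈ l := by
          refine (hl _).2 ⟨compOf_mem_comps (by simpa using hux), fun h => hu ?_⟩
          have : u ∈ compOf G {x} u := self_mem_compOf
          rw [h] at this
          simpa using this
        obtain ⟨m, hm⟩ := List.mem_iff_get.1 hK
        have hm' : Kof (m.cast hlength) = compOf G {x} u := hm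
        obtain ⟨j, hj⟩ := (hgmem (m.cast hlength) u).1 (hm' ▸ self_mem_compOf)
        exact ⟨some ⟨_, j⟩, Subtype.ext hj⟩
  refine ⟨(⟨Equiv.ofBijective φ hφ, ?_⟩ : spider L ≃g linkGraph (oddFaces G) v).symm⟩
  intro a b
  rw [linkGraph_adj_iff hiso]
  rcases a with _ | ⟨i, j⟩ <;> rcases b with _ | ⟨i', j'⟩
  · exact iff_of_false (G.loopless.irrefl _) spider_adj_none_none
  · rw [spider_adj_none_some]; exact hgx i' j'
  · rw [spider_adj_some_none, SimpleGraph.adj_comm]; exact hgx i j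
  · rw [spider_adj_some_some]
    constructor
    · intro h
      have hi : i = i' := hsame i j i' (mem_of_adj (hKof i').1 (hgK i' j')
        (by simpa using hgx' i j) h.symm)
      subst hi
      exact ⟨rfl, (hgadj i j j').1 h⟩
    · rintro ⟨hi, h⟩
      simp only at hi
      subst hi
      exact (hgadj i j j').2 h

lemma forall₂_replicate {α β : Type*} {R : α → β → Prop} {b : β} :
    ∀ {l : List α}, (∀ a ∈ l, R a b) → List.Forall₂ R l (List.replicate l.length b)
  | [], _ => List.Forall₂.nil
  | a :: l, h => List.Forall₂.cons (h a (by simp)) (forall₂_replicate fun c hc => h c (by simp [hc]))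

/-- The spiders that are links of the complements of largest hypercuts. -/
def IsExtremalSpider (n : ℕ) (L : List ℕ) : Prop :=
  (Even n ∧ (L = List.replicate ((n - 2) / 2) 2 ∨ L = 1 :: 3 :: List.replicate ((n - 6) / 2) 2)) ∨
    (Odd n ∧ L = 1 :: List.replicate ((n - 3) / 2) 2)

/-- Counting vertices determines the number of legs of length `2`. -/
lemma exists_extremalSpider_of_legs {G : SimpleGraph (Fin n)} {x v : Fin n} (hn : 100 ≤ n)
    (hv : {v} ∈ comps G {x}) (hxv : ¬ G.Adj x v)
    (h : (Even n ∧ ∀ K ∈ comps G {x}, K ≠ {v} → K.card = 2 ∧ IsLeg G x K 2) ∨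
       (Even n ∧ ∃ K₁ ∈ comps G {x}, ∃ K₃ ∈ comps G {x}, K₁ ≠ {v} ∧ K₃ ≠ {v} ∧
        (K₁.card = 1 ∧ IsLeg G x K₁ 1) ∧ (K₃.card = 3 ∧ IsLeg G x K₃ 3) ∧
        ∀ K ∈ comps G {x}, K ≠ {v} → K ≠ K₁ → K ≠ K₃ → K.card = 2 ∧ IsLeg G x K 2) ∨
       (Odd n ∧ ∃ K₁ ∈ comps G {x}, K₁ ≠ {v} ∧ (K₁.card = 1 ∧ IsLeg G x K₁ 1) ∧
        ∀ K ∈ comps G {x}, K ≠ {v} → K ≠ K₁ → K.card = 2 ∧ IsLeg G x K 2)) :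
    ∃ L, IsExtremalSpider n L ∧ Nonempty (linkGraph (oddFaces G) v ≃g spider L) := by
  classical
  have hsum := sum_card_comps G x
  have hsum1 : ∑ K ∈ (comps G {x}).erase {v}, (K.card : ℤ) = n - 2 := by
    have := Finset.add_sum_erase (comps G {x}) (fun K => (K.card : ℤ)) hv
    simp only [Finset.card_singleton] at this
    push_cast at this
    linarith
  rcases h with ⟨he, h2⟩ | ⟨he, K₁, hK₁, K₃, hK₃, hv₁, hv₃, ⟨c₁, l₁⟩, ⟨c₃, l₃⟩, h2⟩ |
    ⟨ho, K₁, hK₁, hv₁, ⟨c₁, l₁⟩, h2⟩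
  · set l := ((comps G {x}).erase {v}).toList with hl
    have hm : ∀ K, K ∈ l ↔ K ∈ comps G {x} ∧ K ≠ {v} := by
      intro K; simp [hl, and_comm]
    refine ⟨List.replicate l.length 2, Or.inl ⟨he, Or.inl ?_⟩,
      nonempty_link_iso hv hxv (Finset.nodup_toList _) hm
        (forall₂_replicate fun K hK => (h2 K ((hm K).1 hK).1 ((hm K).1 hK).2).2)⟩
    rw [Finset.sum_congr rfl fun K hK => by
      rw [(h2 K (Finset.mem_of_mem_erase hK) (Finset.ne_of_mem_erase hK)).1]] at hsum1
    rw [Finset.sum_const, nsmul_eq_mul] at hsum1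
    have : l.length = (n - 2) / 2 := by
      rw [hl, Finset.length_toList]
      push_cast at hsum1
      omega
    rw [this]
  · have hne : K₃ ≠ K₁ := by rintro rfl; omega
    have hmem₁ : K₁ ∈ (comps G {x}).erase {v} := Finset.mem_erase.2 ⟨hv₁, hK₁⟩
    have hmem₃ : K₃ ∈ ((comps G {x}).erase {v}).erase K₁ :=
      Finset.mem_erase.2 ⟨hne, Finset.mem_erase.2 ⟨hv₃, hK₃⟩⟩
    set R := (((comps G {x}).erase {v}).erase K₁).erase K₃ with hR
    have hmR : ∀ K, K ∈ R ↔ K ∈ comps G {x} ∧ K ≠ {v} ∧ K ≠ K₁ ∧ K ≠ K₃ := by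
      intro K; simp only [hR, Finset.mem_erase]; tauto
    have hR2 : ∀ K ∈ R, K.card = 2 ∧ IsLeg G x K 2 := by
      intro K hK
      obtain ⟨a, b, c, d⟩ := (hmR K).1 hK
      exact h2 K a b c d
    rw [← Finset.add_sum_erase _ _ hmem₁, ← Finset.add_sum_erase _ _ hmem₃, ← hR, c₁, c₃,
      Finset.sum_congr rfl fun K hK => by rw [(hR2 K hK).1], Finset.sum_const,
      nsmul_eq_mul] at hsum1
    refine ⟨1 :: 3 :: List.replicate R.toList.length 2, Or.inl ⟨he, Or.inr ?_⟩,
      nonempty_link_iso (l := K₁ :: K₃ :: R.toList) hv hxv ?_ ?_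
        (.cons l₁ (.cons l₃ (forall₂_replicate fun K hK => (hR2 K (Finset.mem_toList.1 hK)).2)))⟩
    · have : R.toList.length = (n - 6) / 2 := by
        rw [Finset.length_toList]
        push_cast at hsum1
        omega
      rw [this]
    · simp [Finset.nodup_toList, hmR, hne.symm]
    · intro K
      simp only [List.mem_cons, Finset.mem_toList, hmR]
      constructor
      · rintro (rfl | rfl | h)
        · exact ⟨hK₁, hv₁⟩
        · exact ⟨hK₃, hv₃⟩
        · exact ⟨h.1, h.2.1⟩
      · rintro ⟨a, b⟩
        tauto
  · have hmem₁ : K₁ ∈ (comps G {x}).erase {v} := Finset.mem_erase.2 ⟨hv₁, hK₁⟩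
    set R := ((comps G {x}).erase {v}).erase K₁ with hR
    have hmR : ∀ K, K ∈ R ↔ K ∈ comps G {x} ∧ K ≠ {v} ∧ K ≠ K₁ := by
      intro K; simp only [hR, Finset.mem_erase]; tauto
    have hR2 : ∀ K ∈ R, K.card = 2 ∧ IsLeg G x K 2 := by
      intro K hK
      obtain ⟨a, b, c⟩ := (hmR K).1 hK
      exact h2 K a b c
    rw [← Finset.add_sum_erase _ _ hmem₁, ← hR, c₁,
      Finset.sum_congr rfl fun K hK => by rw [(hR2 K hK).1], Finset.sum_const,
      nsmul_eq_mul] at hsum1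
    refine ⟨1 :: List.replicate R.toList.length 2, Or.inr ⟨ho, ?_⟩,
      nonempty_link_iso (l := K₁ :: R.toList) hv hxv ?_ ?_
        (.cons l₁ (forall₂_replicate fun K hK => (hR2 K (Finset.mem_toList.1 hK)).2))⟩
    · have : R.toList.length = (n - 3) / 2 := by
        rw [Finset.length_toList]
        push_cast at hsum1
        omega
      rw [this]
    · simp [Finset.nodup_toList, hmR]
    · intro K
      simp only [List.mem_cons, Finset.mem_toList, hmR]
      constructor
      · rintro (rfl | h)
        · exact ⟨hK₁, hv₁⟩
        · exact ⟨h.1, h.2.1⟩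
      · rintro ⟨a, b⟩
        tauto

/-- Four times the least number of faces in the complement of a hypercut. -/
def fourMinCompl (n : ℕ) : ℤ :=
  if Even n then 3 * n ^ 2 - 14 * n + 16 else 3 * n ^ 2 - 16 * n + 25

/-- Coboundaries with an extremal spider as a link are hypercuts of the extremal size. -/
lemma IsExtremalSpider.isHypercut {L : List ℕ} (hL : IsExtremalSpider n L) (hn : 100 ≤ n)
    {C : Finset (Face n)} (hC : IsCoboundary C) {v : Fin n}
    (φ : linkGraph Cᶜ v ≃g spider L) :
    IsHypercut C ∧ 4 * (Cᶜ.card : ℤ) = fourMinCompl n := by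
  have hshape : (∀ ℓ ∈ L, 1 ≤ ℓ) ∧
      (∀ i k : Fin L.length, i ≠ k → 2 ≤ L.get i ∨ 2 ≤ L.get k) ∧
      (∃ i : Fin L.length, 2 ≤ L.get i) ∧
      2 * ((L.length : ℤ) * (n - 2 * L.length)
        + (L.map fun ℓ : ℕ => ((n : ℤ) - 2) + ((ℓ : ℤ) - 1) * (2 * (n - 4))).sum)
        = fourMinCompl n := by
    rcases hL with ⟨he, rfl | rfl⟩ | ⟨ho, rfl⟩
    · obtain ⟨m, hm⟩ : ∃ m, n = 2 * m + 2 := by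
        obtain ⟨k, hk⟩ := he; exact ⟨k - 1, by omega⟩
      have hm' : (n - 2) / 2 = m := by omega
      refine ⟨?_, ?_, ⟨⟨0, by simp; omega⟩, by simp⟩, ?_⟩
      · intro ℓ hℓ; rw [List.eq_of_mem_replicate hℓ]; norm_num
      · intro i k _; left; simp
      · rw [hm', fourMinCompl, if_pos he, List.map_replicate, List.sum_replicate,
          List.length_replicate, hm]
        push_cast
        ring
    · obtain ⟨m, hm⟩ : ∃ m, n = 2 * m + 6 := by
        obtain ⟨k, hk⟩ := he; exact ⟨k - 3, by omega⟩
      have hm' : (n - 6) / 2 = m := by omega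
      refine ⟨?_, ?_, ⟨⟨1, by simp⟩, by simp⟩, ?_⟩
      · intro ℓ hℓ
        simp only [List.mem_cons, List.mem_replicate] at hℓ
        omega
      · rintro ⟨i, hi⟩ ⟨k, hk⟩ hik
        have hik' : i ≠ k := fun h => hik (Fin.ext h)
        rcases i with _ | _ | i <;> rcases k with _ | _ | k <;> simp at hik' ⊢
      · rw [hm', fourMinCompl, if_pos he, List.map_cons, List.map_cons, List.map_replicate,
          List.sum_cons, List.sum_cons, List.sum_replicate, List.length_cons, List.length_cons,
          List.length_replicate, hm]
        push_cast
        ring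
    · obtain ⟨m, hm⟩ : ∃ m, n = 2 * m + 3 := by
        obtain ⟨k, hk⟩ := ho; exact ⟨k - 1, by omega⟩
      have hm' : (n - 3) / 2 = m := by omega
      refine ⟨?_, ?_, ⟨⟨1, by simp; omega⟩, by simp⟩, ?_⟩
      · intro ℓ hℓ
        simp only [List.mem_cons, List.mem_replicate] at hℓ
        omega
      · rintro ⟨i, hi⟩ ⟨k, hk⟩ hik
        have hik' : i ≠ k := fun h => hik (Fin.ext h)
        rcases i with _ | i <;> rcases k with _ | k <;> simp at hik' ⊢
      · rw [hm', fourMinCompl, if_neg (Nat.not_even_iff_odd.2 ho), List.map_cons,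
          List.map_replicate, List.sum_cons, List.sum_replicate, List.length_cons,
          List.length_replicate, hm]
        push_cast
        ring
  obtain ⟨s1, s2, s3, s4⟩ := hshape
  have h := six_mul_card_of_link hC φ s1
  exact ⟨isHypercut_iff.2 (isMinimalCoboundary_of_link hC φ (fun i => s1 _ (L.get_mem i)) s2 s3),
    by linarith⟩

/-- The number of vertices from which on `exists_center` applies. -/
def threshold : ℕ :=
  10000 * (2 * largeVertexBound + largeVertexBound ^ 2 + 2 * 2 ^ largeVertexBound)

lemma hundred_le_of_threshold_le (hn : threshold ≤ n) : 100 ≤ n := by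
  have h : 0 < 2 ^ largeVertexBound := by positivity
  unfold threshold at hn
  nlinarith

/-- A hypercut whose complement is as small as in the extremal examples has an extremal spider as a
link. -/
lemma IsHypercut.exists_extremalSpider {C : Finset (Face n)} (hC : IsHypercut C)
    (hn : threshold ≤ n) (hcard : 4 * (Cᶜ.card : ℤ) ≤ fourMinCompl n) :
    ∃ v L, IsExtremalSpider n L ∧ Nonempty (linkGraph Cᶜ v ≃g spider L) := by
  have hn100 := hundred_le_of_threshold_le hn
  have hn100' : (100 : ℤ) ≤ n := by exact_mod_cast hn100
  have hmin := isHypercut_iff.1 hC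
  obtain ⟨G₀, hG₀⟩ := isCoboundary_iff_compl.1 hmin.prop.1
  obtain ⟨G, hG, hdeg, hsum⟩ := exists_sparse_representative G₀
  rw [← hG] at hG₀
  have hb : (Even n ∧ 4 * (Cᶜ.card : ℤ) ≤ 3 * n ^ 2 - 14 * n + 16) ∨
      (Odd n ∧ 4 * (Cᶜ.card : ℤ) ≤ 3 * n ^ 2 - 16 * n + 25) := by
    unfold fourMinCompl at hcard
    split_ifs at hcard with he
    · exact Or.inl ⟨he, hcard⟩
    · exact Or.inr ⟨Nat.not_even_iff_odd.1 he, hcard⟩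
  have hb3 : 4 * (Cᶜ.card : ℤ) ≤ 3 * n ^ 2 := by
    rcases hb with ⟨-, hb⟩ | ⟨-, hb⟩ <;> linarith
  have hb1 : (Cᶜ.card : ℤ) ≤ n ^ 2 := by nlinarith
  obtain ⟨x, hx, hsmall⟩ := exists_center hmin hG₀ hn hb3 hdeg hsum
  obtain ⟨v, hv, hxv, h⟩ := exists_legs hmin hG₀ hn100 hb1 hx (hdeg x) hsmall hb
  obtain ⟨L, hL, hφ⟩ := exists_extremalSpider_of_legs hn100 hv hxv h
  rw [hG₀]
  exact ⟨v, L, hL, hφ⟩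

/-- A smaller complement would have an extremal spider as a link, hence the extremal size. -/
lemma IsHypercut.fourMinCompl_le {C : Finset (Face n)} (hC : IsHypercut C)
    (hn : threshold ≤ n) : fourMinCompl n ≤ 4 * (Cᶜ.card : ℤ) := by
  by_contra! hlt
  obtain ⟨v, L, hL, ⟨φ⟩⟩ := hC.exists_extremalSpider hn hlt.le
  have := (hL.isHypercut (hundred_le_of_threshold_le hn) (isHypercut_iff.1 hC).prop.1 φ).2
  omega

lemma exists_extremalSpider (hn : 100 ≤ n) : ∃ L, IsExtremalSpider n L ∧ L.sum + 2 = n := by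
  rcases Nat.even_or_odd n with he | ho
  · refine ⟨_, Or.inl ⟨he, Or.inl rfl⟩, ?_⟩
    obtain ⟨k, hk⟩ := he
    rw [List.sum_replicate, smul_eq_mul]; omega
  · refine ⟨_, Or.inr ⟨ho, rfl⟩, ?_⟩
    obtain ⟨k, hk⟩ := ho
    rw [List.sum_cons, List.sum_replicate, smul_eq_mul]; omega

lemma exists_hypercut_attaining (hn : 100 ≤ n) :
    ∃ C : Finset (Face n), IsHypercut C ∧ 4 * (Cᶜ.card : ℤ) = fourMinCompl n := by
  obtain ⟨L, hL, hs⟩ := exists_extremalSpider hn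
  obtain ⟨C, v, hC, ⟨φ⟩⟩ := exists_coboundary_link L hs
  exact ⟨C, hL.isHypercut hn hC φ⟩

lemma card_eq_real (C : Finset (Face n)) : (C.card : ℝ) = n.choose 3 - Cᶜ.card := by
  have : (C.card : ℝ) + Cᶜ.card = n.choose 3 := by exact_mod_cast card_add_card_compl C
  linarith

lemma isGreatest_card_hypercut (hn : threshold ≤ n) :
    IsGreatest {x : ℝ | ∃ C : Finset (Face n), IsHypercut C ∧ x = (C.card : ℝ)}
      ((n.choose 3 : ℝ) - (fourMinCompl n : ℝ) / 4) := by
  constructor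
  · obtain ⟨C, hC, h⟩ := exists_hypercut_attaining (hundred_le_of_threshold_le hn)
    refine ⟨C, hC, ?_⟩
    have : 4 * (Cᶜ.card : ℝ) = fourMinCompl n := by exact_mod_cast h
    rw [card_eq_real]
    linarith
  · rintro _ ⟨C, hC, rfl⟩
    have : (fourMinCompl n : ℝ) ≤ 4 * (Cᶜ.card : ℝ) := by exact_mod_cast hC.fourMinCompl_le hn
    rw [card_eq_real]
    linarith

lemma isLargestHypercut_iff (hn : threshold ≤ n) {C : Finset (Face n)} :
    IsLargestHypercut C ↔ IsCoboundary C ∧ ∃ v L, IsExtremalSpider n L ∧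
      Nonempty (linkGraph Cᶜ v ≃g spider L) := by
  have hn100 := hundred_le_of_threshold_le hn
  constructor
  · rintro ⟨hC, hmax⟩
    refine ⟨(isHypercut_iff.1 hC).prop.1, hC.exists_extremalSpider hn ?_⟩
    obtain ⟨D, hD, h⟩ := exists_hypercut_attaining hn100
    have h1 := hmax D hD
    have h2 := card_add_card_compl C
    have h3 := card_add_card_compl D
    omega
  · rintro ⟨hC, v, L, hL, ⟨φ⟩⟩
    obtain ⟨h1, h2⟩ := hL.isHypercut hn100 hC φ
    refine ⟨h1, fun D hD => ?_⟩
    have h3 := hD.fourMinCompl_le hn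
    have h4 := card_add_card_compl C
    have h5 := card_add_card_compl D
    omega

lemma four_mul_choose_two (hn : 1 ≤ n) : 4 * ((n - 1).choose 2 : ℤ) = 2 * (n - 1) * (n - 2) := by
  obtain ⟨m, rfl⟩ := Nat.exists_eq_add_of_le' hn
  rw [Nat.add_sub_cancel, Nat.choose_two_right]
  have h : 2 * (m * (m - 1) / 2) = m * (m - 1) :=
    Nat.mul_div_cancel' (Nat.even_mul_pred_self m).two_dvd
  rcases m with _ | m
  · simp
  · rw [Nat.add_sub_cancel] at h ⊢
    have : (2 : ℤ) * ((m + 1) * m / 2 : ℕ) = (m + 1) * m := by exact_mod_cast h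
    push_cast at this ⊢
    linarith

/-- The least size of the shadow of an almost-hypertree. -/
noncomputable def minShadow (n : ℕ) : ℕ :=
  sInf {k : ℕ | ∃ S : Finset (Face n), IsAlmostHypertree S ∧ k = (shadow S).card}

/-- Four times the least shadow size. -/
lemma minShadow_spec (hn : threshold ≤ n) :
    IsLeast {k : ℕ | ∃ S : Finset (Face n), IsAlmostHypertree S ∧ k = (shadow S).card}
      (minShadow n) ∧
    4 * (minShadow n : ℤ) = fourMinCompl n - 2 * (n - 1) * (n - 2) + 4 := by
  have hn100 := hundred_le_of_threshold_le hn
  have hn0 : 0 < n := by omega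
  have hchoose := four_mul_choose_two (n := n) (by omega)
  obtain ⟨C, hC, hCcard⟩ := exists_hypercut_attaining hn100
  obtain ⟨S, hS, hScard⟩ := hC.exists_almostHypertree hn0
  have hleast : IsLeast {k : ℕ | ∃ S : Finset (Face n), IsAlmostHypertree S ∧ k = (shadow S).card}
      (shadow S).card := by
    refine ⟨⟨S, hS, rfl⟩, ?_⟩
    rintro _ ⟨T, hT, rfl⟩
    obtain ⟨D, hD, hDcard⟩ := hT.exists_hypercut hn0
    have h1 := hD.fourMinCompl_le hn
    have h2 := hT.2
    have h3 := hS.2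
    omega
  have heq : minShadow n = (shadow S).card := hleast.csInf_eq
  rw [heq]
  refine ⟨hleast, ?_⟩
  have h3 := hS.2
  omega

lemma minShadow_isTheta :
    (fun n : ℕ => (minShadow n : ℝ) - (n : ℝ) ^ 2 / 4) =Θ[atTop] (fun n : ℕ => (n : ℝ)) := by
  have key : ∀ᶠ n : ℕ in atTop, (n : ℝ) ≤ (n : ℝ) ^ 2 / 4 - minShadow n ∧
      (n : ℝ) ^ 2 / 4 - minShadow n ≤ 3 * n := by
    filter_upwards [eventually_ge_atTop threshold] with n hn
    have hn100 : (100 : ℝ) ≤ n := by exact_mod_cast hundred_le_of_threshold_le hn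
    have h : 4 * (minShadow n : ℝ) = fourMinCompl n - 2 * (n - 1) * (n - 2) + 4 := by
      exact_mod_cast (minShadow_spec hn).2
    unfold fourMinCompl at h
    split_ifs at h <;> push_cast at h <;> constructor <;> linarith
  constructor
  · refine IsBigO.of_bound 3 ?_
    filter_upwards [key] with n hn
    have h0 : (0 : ℝ) ≤ n := by positivity
    rw [Real.norm_eq_abs, Real.norm_eq_abs, abs_of_nonneg h0, abs_sub_comm, abs_of_nonneg] <;>
      linarith [hn.1, hn.2]
  · refine IsBigO.of_bound 1 ?_
    filter_upwards [key] with n hn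
    have h0 : (0 : ℝ) ≤ n := by positivity
    rw [Real.norm_eq_abs, Real.norm_eq_abs, abs_of_nonneg h0, abs_sub_comm, abs_of_nonneg] <;>
      linarith [hn.1, hn.2]

end SimplicialCut

theorem theorem4p1 :
    -- the largest size of a hypercut, and the extremal hypercuts
    (∃ N : ℕ, ∀ n : ℕ, N ≤ n →
      (Even n →
        IsGreatest {x : ℝ | ∃ C : Finset (SimplicialCut.Face n),
            SimplicialCut.IsHypercut C ∧ x = (C.card : ℝ)}
          ((n.choose 3 : ℝ) - (3 / 4 * (n : ℝ) ^ 2 - 7 / 2 * (n : ℝ) + 4)) ∧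
        ∀ C : Finset (SimplicialCut.Face n),
          SimplicialCut.IsLargestHypercut C ↔
            SimplicialCut.IsCoboundary C ∧ ∃ v : Fin n,
              Nonempty (SimplicialCut.linkGraph Cᶜ v ≃g
                SimplicialCut.spider (List.replicate ((n - 2) / 2) 2)) ∨
              Nonempty (SimplicialCut.linkGraph Cᶜ v ≃g
                SimplicialCut.spider (1 :: 3 :: List.replicate ((n - 6) / 2) 2))) ∧
      (Odd n →
        IsGreatest {x : ℝ | ∃ C : Finset (SimplicialCut.Face n),
            SimplicialCut.IsHypercut C ∧ x = (C.card : ℝ)}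
          ((n.choose 3 : ℝ) - (3 / 4 * (n : ℝ) ^ 2 - 4 * (n : ℝ) + 25 / 4)) ∧
        ∀ C : Finset (SimplicialCut.Face n),
          SimplicialCut.IsLargestHypercut C ↔
            SimplicialCut.IsCoboundary C ∧ ∃ v : Fin n,
              Nonempty (SimplicialCut.linkGraph Cᶜ v ≃g
                SimplicialCut.spider (1 :: List.replicate ((n - 3) / 2) 2)))) ∧
    -- the least size of the shadow of an almost-hypertree
    (∃ s : ℕ → ℕ,
      (∀ᶠ n : ℕ in atTop, IsLeast {k : ℕ | ∃ S : Finset (SimplicialCut.Face n),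
        SimplicialCut.IsAlmostHypertree S ∧ k = (SimplicialCut.shadow S).card} (s n)) ∧
      (fun n : ℕ => (s n : ℝ) - (n : ℝ) ^ 2 / 4) =Θ[atTop] (fun n : ℕ => (n : ℝ))) := by
  refine ⟨⟨SimplicialCut.threshold, fun n hn => ⟨fun he => ⟨?_, fun C => ?_⟩,
    fun ho => ⟨?_, fun C => ?_⟩⟩⟩, SimplicialCut.minShadow, ?_, SimplicialCut.minShadow_isTheta⟩
  · convert SimplicialCut.isGreatest_card_hypercut hn using 2
    rw [SimplicialCut.fourMinCompl, if_pos he]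
    push_cast
    ring
  · rw [SimplicialCut.isLargestHypercut_iff hn]
    refine and_congr_right fun _ => exists_congr fun v => ⟨?_, ?_⟩
    · rintro ⟨L, ⟨-, rfl | rfl⟩ | ⟨ho, -⟩, h⟩
      · exact Or.inl h
      · exact Or.inr h
      · exact absurd he (Nat.not_even_iff_odd.2 ho)
    · rintro (h | h)
      · exact ⟨_, Or.inl ⟨he, Or.inl rfl⟩, h⟩
      · exact ⟨_, Or.inl ⟨he, Or.inr rfl⟩, h⟩
  · convert SimplicialCut.isGreatest_card_hypercut hn using 2
    rw [SimplicialCut.fourMinCompl, if_neg (Nat.not_even_iff_odd.2 ho)]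
    push_cast
    ring
  · rw [SimplicialCut.isLargestHypercut_iff hn]
    refine and_congr_right fun _ => exists_congr fun v => ⟨?_, ?_⟩
    · rintro ⟨L, ⟨he, -⟩ | ⟨-, rfl⟩, h⟩
      · exact absurd he (Nat.not_even_iff_odd.2 ho)
      · exact h
    · exact fun h => ⟨_, Or.inr ⟨ho, rfl⟩, h⟩
  · filter_upwards [Filter.eventually_ge_atTop SimplicialCut.threshold] with n hn
    exact (SimplicialCut.minShadow_spec hn).1
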